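/- Let $T>0$ and let $P,Q\in L^\infty(\mathbb R^3)^{3\times 3}$ be complex matrix-valued functions which are Hermitian a.e. and uniformly elliptic: there is $\alpha>0$ such that $$\min\{P(x)\xi\cdot\overline\xi,\ Q(x)\xi\cdot\overline\xi\}\ge\alpha|\xi|^2\qquad\text{for all }\xi\in\mathbb C^3\text{ and a.e. }x\in\mathbb R^3 ,$$ where $\xi\cdot\eta=\sum_{j}\xi_j\eta_j$. Functions are complex valued, and $L^p(0,T;L^2(\mathbb R^3)^3)$ denotes the Bochner space. Then for all $f,g\in L^1(0,T;L^2(\mathbb R^3)^3)$ and all $E^0,B^0\in L^2(\mathbb R^3)^3$ there is a unique pair $(E,B)\in[L^\infty(0,T;L^2(\mathbb R^3)^3)]^2$ solving $$\partial_tB+\operatorname{curl}E=f,\qquad P\,\partial_tE-\operatorname{curl}(Q^{-1}B)=g\quad\text{in }(0,T)\times\mathbb R^3,\qquad B|_{t=0}=B^0,\quad E|_{t=0}=E^0$$ in the weak sense, that is, such that for every $\varphi\in C_c^\infty((-\infty,T)\times\mathbb R^3;\mathbb C^3)$ $$\int_0^T\!\!\int_{\mathbb R^3}\big(-B\cdot\partial_t\overline\varphi+E\cdot\operatorname{curl}\overline\varphi\big)\,dx\,dt=\int_0^T\!\!\int_{\mathbb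 R^3} f\cdot\overline\varphi\,dx\,dt+\int_{\mathbb R^3} B^0\cdot\overline{\varphi(0,\cdot)}\,dx,$$ $$\int_0^T\!\!\int_{\mathbb R^3}\big(-PE\cdot\partial_t\overline\varphi-Q^{-1}B\cdot\operatorname{curl}\overline\varphi\big)\,dx\,dt=\int_0^T\!\!\int_{\mathbb R^3} g\cdot\overline\varphi\,dx\,dt+\int_{\mathbb R^3} PE^0\cdot\overline{\varphi(0,\cdot)}\,dx.$$ Moreover, this solution satisfies the energy identity $$\frac12\frac{d}{dt}\int_{\mathbb R^3}\big(Q^{-1}B\cdot\overline B+PE\cdot\overline E\big)\,dx=\int_{\mathbb R^3}\operatorname{Re}\big(Q^{-1}f\cdot\overline B+g\cdot\overline E\big)\,dx\quad\text{in }(0,T),$$ in the following sense: the function $t\mapsto\frac12\int_{\mathbb R^3}(Q^{-1}B\cdot\overline B+PE\cdot\overline E)\,dx$ coincides for a.e. $t\in(0,T)$ with an absolutely continuous function on $[0,T]$ whose value at $t=0$ is $\frac12\int_{\mathbb R^3}(Q^{-1}B^0\cdot\overline{B^0}+PE^0\cdot\overline{E^0})\,dx$ and whose derivative is the right-hand side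 for a.e. $t\in(0,T)$. -/

import Mathlib

open MeasureTheory Set
open scoped ENNReal ContDiff

noncomputable section

namespace Maxwell

/-- Physical space `ℝ³`. -/
abbrev R3 : Type := EuclideanSpace ℝ (Fin 3)

/-- Complex vectors `ℂ³` with the Hermitian norm. With Mathlib's convention
`inner ℂ η ξ = ∑ j, ξ j * conj (η j)`, the scalar product `ξ · η̄` is `inner ℂ η ξ`. -/
abbrev C3 : Type := EuclideanSpace ℂ (Fin 3)

/-- `L²(ℝ³)³`, complex valued. -/
abbrev L2 : Type := Lp C3 2 (volume : Measure R3)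

/-- The Bochner space `L^p(0,T; L²(ℝ³)³)`. -/
abbrev LpL2 (p : ℝ≥0∞) (T : ℝ) : Type :=
  Lp L2 p ((volume : Measure ℝ).restrict (Ioo 0 T))

/-- The matrix-vector product `A ξ` in `ℂ³`. -/
def act (A : Matrix (Fin 3) (Fin 3) ℂ) (ξ : C3) : C3 := WithLp.toLp 2 (A.mulVec ξ.ofLp)

/-- `A ∈ L^∞(ℝ³)^{3×3}`. -/
def IsBoundedCoeff (A : R3 → Matrix (Fin 3) (Fin 3) ℂ) : Prop :=
  ∀ i j, MemLp (fun x => A x i j) ∞ volume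

/-- `A(x)` is Hermitian for a.e. `x`. -/
def IsHermitianCoeff (A : R3 → Matrix (Fin 3) (Fin 3) ℂ) : Prop :=
  ∀ᵐ x, (A x).IsHermitian

/-- `min {P(x)ξ·ξ̄, Q(x)ξ·ξ̄} ≥ α |ξ|²` for all `ξ ∈ ℂ³` and a.e. `x ∈ ℝ³`, for some `α > 0`
(for Hermitian matrices the two products are real, so taking real parts changes nothing). -/
def UniformlyElliptic (P Q : R3 → Matrix (Fin 3) (Fin 3) ℂ) : Prop :=
  ∃ α : ℝ, 0 < α ∧ ∀ᵐ x : R3, ∀ ξ : C3,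
    α * ‖ξ‖ ^ 2 ≤ min (inner ℂ ξ (act (P x) ξ)).re (inner ℂ ξ (act (Q x) ξ)).re

/-- The partial derivative `∂ⱼ vₖ (x)`. -/
def pderiv (v : R3 → C3) (j k : Fin 3) (x : R3) : ℂ :=
  fderiv ℝ (fun y => v y k) x (EuclideanSpace.single j 1)

/-- The curl of a (smooth) field `v : ℝ³ → ℂ³`, the components being indexed by `0, 1, 2`. -/
def curl (v : R3 → C3) (x : R3) : C3 :=
  !₂[pderiv v 1 2 x - pderiv v 2 1 x,
     pderiv v 2 0 x - pderiv v 0 2 x,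
     pderiv v 0 1 x - pderiv v 1 0 x]

/-- Test fields `φ ∈ C_c^∞((-∞,T) × ℝ³; ℂ³)`. Restricted to `t ≥ 0` they are the test fields on
`[0,T) × ℝ³`: they vanish near `t = T` but need not vanish at `t = 0`. -/
structure IsTestField (T : ℝ) (φ : ℝ → R3 → C3) : Prop where
  smooth : ContDiff ℝ ∞ (Function.uncurry φ)
  compact : HasCompactSupport (Function.uncurry φ)
  support : tsupport (Function.uncurry φ) ⊆ Iio T ×ˢ univ

/-- `(E,B)` solves, in the sense of distributions and with the initial conditions,
`∂ₜB + curl E = f`, `P ∂ₜE - curl (Q⁻¹B) = g` in `(0,T) × ℝ³`, `B|ₜ₌₀ = B⁰`, `E|ₜ₌₀ = E⁰`.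
The equations are tested with the complex conjugates of test fields. As `P` is independent of
time, `P ∂ₜE` is the distribution `∂ₜ(PE)`. -/
structure IsWeakSolution (T : ℝ) (P Q : R3 → Matrix (Fin 3) (Fin 3) ℂ)
    (f g : LpL2 1 T) (E₀ B₀ : L2) (E B : LpL2 ∞ T) : Prop where
  faraday : ∀ φ : ℝ → R3 → C3, IsTestField T φ →
    (∫ t in Ioo 0 T, ∫ x, (-inner ℂ (deriv (fun s => φ s x) t) (B t x)
        + inner ℂ (curl (φ t) x) (E t x)))
      = (∫ t in Ioo 0 T, ∫ x, inner ℂ (φ t x) (f t x)) + ∫ x, inner ℂ (φ 0 x) (B₀ x)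
  ampere : ∀ φ : ℝ → R3 → C3, IsTestField T φ →
    (∫ t in Ioo 0 T, ∫ x, (-inner ℂ (deriv (fun s => φ s x) t) (act (P x) (E t x))
        - inner ℂ (curl (φ t) x) (act (Q x)⁻¹ (B t x))))
      = (∫ t in Ioo 0 T, ∫ x, inner ℂ (φ t x) (g t x))
        + ∫ x, inner ℂ (φ 0 x) (act (P x) (E₀ x))

/-- The energy `½ ∫ (Q⁻¹B·B̄ + PE·Ē) dx` (the integrand is real for Hermitian `P`, `Q`). -/
def energy (P Q : R3 → Matrix (Fin 3) (Fin 3) ℂ) (E B : L2) : ℝ :=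
  (1 / 2) * ∫ x, (inner ℂ (B x) (act (Q x)⁻¹ (B x)) + inner ℂ (E x) (act (P x) (E x))).re

/-- The power `∫ Re (Q⁻¹f·B̄ + g·Ē) dx` of the sources. -/
def power (Q : R3 → Matrix (Fin 3) (Fin 3) ℂ) (f g E B : L2) : ℝ :=
  ∫ x, (inner ℂ (B x) (act (Q x)⁻¹ (f x)) + inner ℂ (E x) (g x)).re

/-- The energy identity `d/dt energy = power` in `(0,T)`. The energy of an element of
`L^∞(0,T; L²)²` is defined for a.e. `t` only; the identity says that it has an absolutely
continuous representative on `[0,T]`, which starts from the energy of the initial data and whose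
derivative is the power a.e. in `(0,T)`. -/
def EnergyIdentity (T : ℝ) (P Q : R3 → Matrix (Fin 3) (Fin 3) ℂ)
    (f g : LpL2 1 T) (E₀ B₀ : L2) (E B : LpL2 ∞ T) : Prop :=
  ∃ e : ℝ → ℝ, AbsolutelyContinuousOnInterval e 0 T ∧
    e 0 = energy P Q E₀ B₀ ∧
    (∀ᵐ t ∂(volume : Measure ℝ).restrict (Ioo 0 T), e t = energy P Q (E t) (B t)) ∧
    (∀ᵐ t ∂(volume : Measure ℝ).restrict (Ioo 0 T),
      HasDerivAt e (power Q (f t) (g t) (E t) (B t)) t)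

end Maxwell

end

/-! The system is treated abstractly in a complex Hilbert space `X`, with `P` and `R = Q⁻¹` bounded,
symmetric and coercive, and with the curl entering only through its graph `G`. Three properties of
`G` are used: it is symmetric, it is closed, and `(0, y) ∈ G` forces `y = 0`. Symmetry cancels the
two curl terms in the time derivative of `⟨E, PE⟩ + ⟨B, RB⟩`, so the power of the sources alone
drives this quantity. Coercivity then bounds `‖E‖ + ‖B‖` at any time by its value at any other time,
earlier or later, plus the `L¹` norm of the sources (`exists_apriori_bound`).

Existence is by duality. The adjoint system has the same form, so the a priori bound, run backwards
from test curves that vanish at `T`, bounds the data functional by the `L²(0,T;X)` norm of the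
adjoint operator applied to the test pair. Hahn-Banach and Riesz represent the functional, and the
representing pair is a weak solution in `L²(0,T;X)` (`exists_isCurveWeakSolution`).

Regularity and uniqueness come from mollification in time. Kernels that look forward turn a weak
solution into classical solutions near every `t` in `[0,T)`, without touching the initial data.
These are Cauchy, uniformly on compact subintervals of `[0,T)`, so a weak solution has a continuous
representative `contRep`. It is bounded, it attains the initial data (`contRep_zero`) and it
satisfies the integrated energy balance (`integral_sourcePower_contRep`). Boundedness upgrades the
constructed solution to `L^∞`; the balance applied to a difference of two solutions gives
uniqueness, and applied to a solution gives the energy identity.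

For the concrete system, the maximal weak curl on `L²(ℝ³)³` is the Fourier multiplier with a
Hermitian symbol (`mem_curlGraph_iff`), hence symmetric. Weak solutions need only be tested with
products `η(t) ζ(x)` for regularity and uniqueness, whereas existence provides the equation for all
test curves, which include the slices of test fields. -/

noncomputable section

namespace Maxwell

/-! ### Abstract energy balance and a priori estimate -/

section EnergyEstimates

open Filter Topology

variable {X : Type*} [NormedAddCommGroup X] [InnerProductSpace ℂ X]

/-- A bounded, self-adjoint, coercive operator. -/
structure IsCoerciveSymm (A : X →L[ℂ] X) : Prop where
  symm : ∀ x y, inner ℂ (A x) y = inner ℂ x (A y)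
  lower : ∃ c : ℝ, 0 < c ∧ ∀ x, c * ‖x‖ ^ 2 ≤ (inner ℂ x (A x)).re

/-- A symmetric operator, given by its graph. -/
def IsSymmGraph (G : Submodule ℂ (X × X)) : Prop :=
  ∀ p ∈ G, ∀ q ∈ G, inner ℂ p.2 q.1 = inner ℂ p.1 q.2

/-- The quadratic form `⟨E, P E⟩ + ⟨B, R B⟩`. -/
def quadForm (P R : X →L[ℂ] X) (E B : X) : ℝ := (inner ℂ E (P E)).re + (inner ℂ B (R B)).re

/-- The power of the sources `(f, g)` along `(E, B)`. -/
def sourcePower (R : X →L[ℂ] X) (f g E B : X) : ℝ :=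
  (inner ℂ E g).re + (inner ℂ B (R f)).re

variable {P R : X →L[ℂ] X} {G : Submodule ℂ (X × X)}

lemma abs_re_inner_le (x y : X) : |(inner ℂ x y).re| ≤ ‖x‖ * ‖y‖ :=
  (Complex.abs_re_le_norm _).trans (norm_inner_le_norm x y)

lemma quadForm_le (P R : X →L[ℂ] X) (E B : X) :
    quadForm P R E B ≤ (‖P‖ + ‖R‖) * (‖E‖ + ‖B‖) ^ 2 := by
  have h1 := (le_abs_self _).trans (abs_re_inner_le E (P E))
  have h2 := (le_abs_self _).trans (abs_re_inner_le B (R B))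
  have h3 : ‖E‖ * ‖P E‖ ≤ ‖E‖ * (‖P‖ * ‖E‖) := by gcongr; exact P.le_opNorm E
  have h4 : ‖B‖ * ‖R B‖ ≤ ‖B‖ * (‖R‖ * ‖B‖) := by gcongr; exact R.le_opNorm B
  unfold quadForm
  have hE := norm_nonneg E
  have hB := norm_nonneg B
  have : 0 ≤ ‖P‖ * (2 * ‖E‖ * ‖B‖ + ‖B‖ ^ 2) := by positivity
  have : 0 ≤ ‖R‖ * (2 * ‖E‖ * ‖B‖ + ‖E‖ ^ 2) := by positivity
  nlinarith

lemma exists_sq_le_quadForm (hP : IsCoerciveSymm P) (hR : IsCoerciveSymm R) :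
    ∃ c : ℝ, 0 < c ∧ ∀ E B, c * (‖E‖ + ‖B‖) ^ 2 ≤ quadForm P R E B := by
  obtain ⟨c, hc, h⟩ := hP.lower
  obtain ⟨d, hd, h'⟩ := hR.lower
  refine ⟨min c d / 2, by positivity, fun E B => ?_⟩
  have h1 := h E
  have h2 := h' B
  unfold quadForm
  have h3 : min c d * ‖E‖ ^ 2 ≤ c * ‖E‖ ^ 2 := by gcongr; exact min_le_left _ _
  have h4 : min c d * ‖B‖ ^ 2 ≤ d * ‖B‖ ^ 2 := by gcongr; exact min_le_right _ _
  have h5 : 0 < min c d := lt_min hc hd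
  nlinarith [mul_nonneg h5.le (sq_nonneg (‖E‖ - ‖B‖))]

lemma abs_sourcePower_le (R : X →L[ℂ] X) (f g E B : X) :
    |sourcePower R f g E B| ≤ (1 + ‖R‖) * (‖E‖ + ‖B‖) * (‖f‖ + ‖g‖) := by
  have h1 := abs_re_inner_le E g
  have h2 := abs_re_inner_le B (R f)
  have h4 : ‖B‖ * ‖R f‖ ≤ ‖B‖ * (‖R‖ * ‖f‖) := by gcongr; exact R.le_opNorm f
  have hE := norm_nonneg E
  have hB := norm_nonneg B
  have hf := norm_nonneg f
  have hg := norm_nonneg g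
  have hR := norm_nonneg R
  have h5 : ‖E‖ * ‖g‖ + ‖B‖ * (‖R‖ * ‖f‖) ≤ (1 + ‖R‖) * (‖E‖ + ‖B‖) * (‖f‖ + ‖g‖) := by
    have : 0 ≤ ‖E‖ * ‖f‖ + ‖B‖ * (‖f‖ + ‖g‖) + ‖R‖ * (‖E‖ * (‖f‖ + ‖g‖) + ‖B‖ * ‖g‖) := by
      positivity
    nlinarith
  exact (abs_add_le _ _).trans (by linarith)

/-- As `P` and `R` are symmetric, the derivative is `2 Re ⟨E, PE'⟩ + 2 Re ⟨B, RB'⟩`. Symmetry of `G`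
for the two given pairs reads `⟨f - B', RB⟩ = ⟨E, PE' - g⟩`, and its real part exchanges these terms
for the power. The factor 2 is there because `quadForm` is twice the energy. -/
lemma hasDerivAt_quadForm (hP : IsCoerciveSymm P) (hR : IsCoerciveSymm R) (hG : IsSymmGraph G)
    {E B : ℝ → X} {E' B' f g : X} {t : ℝ} (hE : HasDerivAt E E' t) (hB : HasDerivAt B B' t)
    (h₁ : (E t, f - B') ∈ G) (h₂ : (R (B t), P E' - g) ∈ G) :
    HasDerivAt (fun s => quadForm P R (E s) (B s)) (2 * sourcePower R f g (E t) (B t)) t := by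
  have hPE : HasDerivAt (fun s => P (E s)) (P E') t :=
    (P.restrictScalars ℝ).hasFDerivAt.comp_hasDerivAt t hE
  have hRB : HasDerivAt (fun s => R (B s)) (R B') t :=
    (R.restrictScalars ℝ).hasFDerivAt.comp_hasDerivAt t hB
  have h3 := Complex.reCLM.hasFDerivAt.comp_hasDerivAt t (hE.inner ℂ hPE)
  have h4 := Complex.reCLM.hasFDerivAt.comp_hasDerivAt t (hB.inner ℂ hRB)
  refine (h3.add h4).congr_deriv ?_
  have h5 := congrArg Complex.re (hG _ h₁ _ h₂)
  simp only [inner_sub_left, inner_sub_right, Complex.sub_re] at h5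
  have h6 : (inner ℂ E' (P (E t))).re = (inner ℂ (E t) (P E')).re := by
    rw [← hP.symm, ← inner_conj_symm, Complex.conj_re]
  have h7 : (inner ℂ B' (R (B t))).re = (inner ℂ (B t) (R B')).re := by
    rw [← hR.symm, ← inner_conj_symm, Complex.conj_re]
  have h8 : (inner ℂ f (R (B t))).re = (inner ℂ (B t) (R f)).re := by
    rw [← hR.symm, ← inner_conj_symm, Complex.conj_re]
  simp only [Complex.reCLM_apply, Complex.add_re, sourcePower]
  linarith

lemma continuous_quadForm (P R : X →L[ℂ] X) :
    Continuous fun p : X × X => quadForm P R p.1 p.2 := by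
  unfold quadForm
  fun_prop

lemma continuous_sourcePower (R : X →L[ℂ] X) :
    Continuous fun p : (X × X) × X × X => sourcePower R p.1.1 p.1.2 p.2.1 p.2.2 := by
  unfold sourcePower
  fun_prop

/-- `(E, B)` is a classical solution on `[a, b]` with continuous sources `(f, g)`. -/
structure IsClassicalSolution (G : Submodule ℂ (X × X)) (P R : X →L[ℂ] X) (a b : ℝ)
    (E B f g : ℝ → X) : Prop where
  eqn : ∀ t ∈ Icc a b, ∃ E' B', HasDerivAt E E' t ∧ HasDerivAt B B' t ∧
    (E t, f t - B') ∈ G ∧ (R (B t), P E' - g t) ∈ G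
  continuousOn_f : ContinuousOn f (Icc a b)
  continuousOn_g : ContinuousOn g (Icc a b)

namespace IsClassicalSolution

variable {a b : ℝ} {E B f g : ℝ → X}

lemma sub {E₂ B₂ f₂ g₂ : ℝ → X} (h : IsClassicalSolution G P R a b E B f g)
    (h' : IsClassicalSolution G P R a b E₂ B₂ f₂ g₂) :
    IsClassicalSolution G P R a b (E - E₂) (B - B₂) (f - f₂) (g - g₂) where
  eqn t ht := by
    obtain ⟨E', B', h1, h2, h3, h4⟩ := h.eqn t ht
    obtain ⟨E₂', B₂', k1, k2, k3, k4⟩ := h'.eqn t ht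
    refine ⟨_, _, h1.sub k1, h2.sub k2, ?_, ?_⟩
    · convert G.sub_mem h3 k3 using 1
      simp only [Pi.sub_apply, Prod.mk_sub_mk, Prod.mk.injEq, true_and]
      abel
    · convert G.sub_mem h4 k4 using 1
      simp only [Pi.sub_apply, Prod.mk_sub_mk, Prod.mk.injEq, map_sub, true_and]
      abel
  continuousOn_f := h.continuousOn_f.sub h'.continuousOn_f
  continuousOn_g := h.continuousOn_g.sub h'.continuousOn_g

lemma continuousOn_E (h : IsClassicalSolution G P R a b E B f g) : ContinuousOn E (Icc a b) := by
  intro t ht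
  obtain ⟨E', B', h1, -⟩ := h.eqn t ht
  exact h1.continuousAt.continuousWithinAt

lemma continuousOn_B (h : IsClassicalSolution G P R a b E B f g) : ContinuousOn B (Icc a b) := by
  intro t ht
  obtain ⟨E', B', -, h1, -⟩ := h.eqn t ht
  exact h1.continuousAt.continuousWithinAt

lemma continuousOn_sourcePower (h : IsClassicalSolution G P R a b E B f g) :
    ContinuousOn (fun t => sourcePower R (f t) (g t) (E t) (B t)) (Icc a b) :=
  (continuous_sourcePower R).comp_continuousOn
    ((h.continuousOn_f.prodMk h.continuousOn_g).prodMk (h.continuousOn_E.prodMk h.continuousOn_B))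

/-- The energy balance for classical solutions. -/
lemma quadForm_sub (h : IsClassicalSolution G P R a b E B f g)
    (hP : IsCoerciveSymm P) (hR : IsCoerciveSymm R) (hG : IsSymmGraph G)
    {s t : ℝ} (hs : s ∈ Icc a b) (ht : t ∈ Icc a b) :
    ∫ r in s..t, 2 * sourcePower R (f r) (g r) (E r) (B r) =
      quadForm P R (E t) (B t) - quadForm P R (E s) (B s) := by
  have hst : uIcc s t ⊆ Icc a b := uIcc_subset_Icc hs ht
  refine intervalIntegral.integral_eq_sub_of_hasDerivAt
    (f := fun r => quadForm P R (E r) (B r)) (fun r hr => ?_)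
    (ContinuousOn.intervalIntegrable ?_)
  · obtain ⟨E', B', h1, h2, h3, h4⟩ := h.eqn r (hst hr)
    exact hasDerivAt_quadForm hP hR hG h1 h2 h3 h4
  · exact (continuousOn_const.mul h.continuousOn_sourcePower).mono hst

end IsClassicalSolution

/-- The a priori estimate for classical solutions, with a constant that depends on the
coefficients only. -/
theorem exists_apriori_bound (hP : IsCoerciveSymm P) (hR : IsCoerciveSymm R)
    (hG : IsSymmGraph G) :
    ∃ K : ℝ, 0 < K ∧ ∀ (a b : ℝ) (E B f g : ℝ → X), IsClassicalSolution G P R a b E B f g →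
      ∀ s ∈ Icc a b, ∀ t ∈ Icc a b,
        ‖E t‖ + ‖B t‖ ≤ K * (‖E s‖ + ‖B s‖ + ∫ r in a..b, (‖f r‖ + ‖g r‖)) := by
  obtain ⟨c, hc, hlow⟩ := exists_sq_le_quadForm hP hR
  set C₁ : ℝ := ‖P‖ + ‖R‖ with hC₁
  set C₂ : ℝ := 2 * (1 + ‖R‖) with hC₂
  have hC₁0 : 0 ≤ C₁ := by positivity
  have hC₂0 : 0 ≤ C₂ := by positivity
  refine ⟨(C₁ + 1 + C₂) / c + 1, by positivity, fun a b E B f g h s hs t ht => ?_⟩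
  have hab : a ≤ b := hs.1.trans hs.2
  have hcont : ContinuousOn (fun r => ‖E r‖ + ‖B r‖) (Icc a b) :=
    h.continuousOn_E.norm.add h.continuousOn_B.norm
  have hfg : ContinuousOn (fun r => ‖f r‖ + ‖g r‖) (Icc a b) :=
    h.continuousOn_f.norm.add h.continuousOn_g.norm
  -- Gronwall's lemma is avoided by comparing `s` with a time `m` at which the norm is maximal, on
  -- either side of `s`. With `N` the norm at `s`, the balance gives `c M² ≤ C₁ N² + C₂ M I ≤ (C₁ N
  -- + C₂ I) M`, and a factor `M` cancels. The resulting constant does not depend on the interval.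
  obtain ⟨m, hm, hmax⟩ := isCompact_Icc.exists_isMaxOn ⟨s, hs⟩ hcont
  set M := ‖E m‖ + ‖B m‖ with hM
  set I := ∫ r in a..b, (‖f r‖ + ‖g r‖) with hI
  set N := ‖E s‖ + ‖B s‖ with hN
  have hM0 : 0 ≤ M := by positivity
  have hN0 : 0 ≤ N := by positivity
  have hNM : N ≤ M := hmax hs
  have hI0 : 0 ≤ I := intervalIntegral.integral_nonneg hab fun r _ => by positivity
  have hbd : |∫ r in s..m, 2 * sourcePower R (f r) (g r) (E r) (B r)| ≤ C₂ * M * I := by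
    have h1 : ∀ r ∈ Icc a b, ‖2 * sourcePower R (f r) (g r) (E r) (B r)‖ ≤
        C₂ * M * (‖f r‖ + ‖g r‖) := by
      intro r hr
      rw [norm_mul, Real.norm_eq_abs, Real.norm_eq_abs, abs_two]
      have h2 := abs_sourcePower_le R (f r) (g r) (E r) (B r)
      have h3 : (1 + ‖R‖) * (‖E r‖ + ‖B r‖) * (‖f r‖ + ‖g r‖) ≤
          (1 + ‖R‖) * M * (‖f r‖ + ‖g r‖) := by
        gcongr
        exact hmax hr
      calc _ ≤ 2 * ((1 + ‖R‖) * M * (‖f r‖ + ‖g r‖)) := by linarith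
        _ = _ := by rw [hC₂]; ring
    have hsub : uIoc s m ⊆ Ioc a b := fun r hr => by
      rw [mem_uIoc] at hr
      rcases hr with hr | hr
      · exact ⟨hs.1.trans_lt hr.1, hr.2.trans hm.2⟩
      · exact ⟨hm.1.trans_lt hr.1, hr.2.trans hs.2⟩
    have hint : IntegrableOn (fun r => C₂ * M * (‖f r‖ + ‖g r‖)) (Ioc a b) :=
      ((continuousOn_const.mul hfg).integrableOn_Icc).mono_set Ioc_subset_Icc_self
    calc |∫ r in s..m, 2 * sourcePower R (f r) (g r) (E r) (B r)|
        ≤ ∫ r in uIoc s m, ‖2 * sourcePower R (f r) (g r) (E r) (B r)‖ :=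
          (Real.norm_eq_abs _).symm.trans_le intervalIntegral.norm_integral_le_integral_norm_uIoc
      _ ≤ ∫ r in uIoc s m, C₂ * M * (‖f r‖ + ‖g r‖) := by
          refine integral_mono_of_nonneg (.of_forall fun r => norm_nonneg _)
            (hint.mono_set hsub) ?_
          exact (ae_restrict_iff' measurableSet_uIoc).2
            (.of_forall fun r hr => h1 r (Ioc_subset_Icc_self (hsub hr)))
      _ ≤ ∫ r in Ioc a b, C₂ * M * (‖f r‖ + ‖g r‖) :=
          setIntegral_mono_set hint (.of_forall fun r => by positivity) hsub.eventuallyLE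
      _ = C₂ * M * I := by
          rw [integral_const_mul, hI, intervalIntegral.integral_of_le hab]
  have hq := h.quadForm_sub hP hR hG hs hm
  have h1 := hlow (E m) (B m)
  have h2 := quadForm_le P R (E s) (B s)
  rw [← hM] at h1
  rw [← hN, ← hC₁] at h2
  have h3 : c * M ^ 2 ≤ (C₁ * N + C₂ * I) * M := by
    have h4 : C₁ * N ^ 2 ≤ C₁ * N * M := by
      rw [sq, ← mul_assoc]
      gcongr
    have h5 := (abs_le.1 hbd).2
    nlinarith
  have h6 : c * M ≤ C₁ * N + C₂ * I := by
    rcases hM0.eq_or_lt with h0 | h0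
    · rw [← h0]
      simp only [mul_zero]
      positivity
    · refine le_of_mul_le_mul_right ?_ h0
      linarith [h3, sq M, mul_assoc c M M]
  refine (hmax ht).trans ?_
  change M ≤ _
  have h7 : M ≤ (C₁ * N + C₂ * I) / c := by rwa [le_div_iff₀ hc, mul_comm]
  refine h7.trans ?_
  rw [div_add_one hc.ne', div_mul_eq_mul_div]
  gcongr
  nlinarith

end EnergyEstimates

/-! ### One-sided mollification in time -/

section Mollifier

open Filter Topology

/-- Width of the `n`-th mollifier. -/
def mollWidth (n : ℕ) : ℝ := 1 / ((n : ℝ) + 1)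

lemma mollWidth_pos (n : ℕ) : 0 < mollWidth n := Nat.one_div_pos_of_nat

lemma tendsto_mollWidth : Tendsto mollWidth atTop (𝓝 0) := tendsto_one_div_add_atTop_nhds_zero_nat

/-- A bump function with support in `(0, 2δ)`, where `δ = mollWidth n`. -/
def mollBump (n : ℕ) : ContDiffBump (mollWidth n) where
  -- With centre `δ = mollWidth n` and outer radius `δ/2`, the closed support is `[δ/2, 3δ/2]`,
  -- which stays away from both ends of `(0, 2δ)`.
  rIn := mollWidth n / 3
  rOut := mollWidth n / 2
  rIn_pos := by have := mollWidth_pos n; positivity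
  rIn_lt_rOut := by have := mollWidth_pos n; linarith

/-- Smooth one-sided approximations of the Dirac mass. -/
def mollKernel (n : ℕ) : ℝ → ℝ := (mollBump n).normed volume

lemma contDiff_mollKernel (n : ℕ) : ContDiff ℝ ∞ (mollKernel n) := (mollBump n).contDiff_normed

lemma continuous_mollKernel (n : ℕ) : Continuous (mollKernel n) :=
  (contDiff_mollKernel n).continuous

lemma hasCompactSupport_mollKernel (n : ℕ) : HasCompactSupport (mollKernel n) :=
  (mollBump n).hasCompactSupport_normed

lemma mollKernel_nonneg (n : ℕ) (y : ℝ) : 0 ≤ mollKernel n y := (mollBump n).nonneg_normed y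

lemma integral_mollKernel (n : ℕ) : ∫ y, mollKernel n y = 1 := (mollBump n).integral_normed

lemma integrable_mollKernel (n : ℕ) : Integrable (mollKernel n) := (mollBump n).integrable_normed

lemma tsupport_mollKernel (n : ℕ) :
    tsupport (mollKernel n) ⊆ Ioo 0 (2 * mollWidth n) := by
  have := mollWidth_pos n
  rw [mollKernel, ContDiffBump.tsupport_normed_eq, Real.closedBall_eq_Icc]
  intro y hy
  simp only [mollBump, mem_Icc] at hy
  constructor <;> linarith [hy.1, hy.2]

lemma mollKernel_eq_zero {n : ℕ} {y : ℝ} (hy : y ∉ Ioo 0 (2 * mollWidth n)) :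
    mollKernel n y = 0 :=
  image_eq_zero_of_notMem_tsupport fun h => hy (tsupport_mollKernel n h)

variable {X : Type*} [NormedAddCommGroup X] [NormedSpace ℝ X]

/-- The mollification of `u`, looking forward in time. -/
def moll (n : ℕ) (u : ℝ → X) (t : ℝ) : X := ∫ s, mollKernel n (s - t) • u s

/-- The mollification against the derivative of the kernel. -/
def mollDeriv (n : ℕ) (u : ℝ → X) (t : ℝ) : X := ∫ s, deriv (mollKernel n) (s - t) • u s

lemma moll_eq (n : ℕ) (u : ℝ → X) (t : ℝ) : moll n u t = ∫ y, mollKernel n y • u (y + t) := by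
  rw [moll, ← integral_add_right_eq_self _ t]
  simp

lemma integrable_mollKernel_smul (n : ℕ) {u : ℝ → X} (hu : Integrable u) (t : ℝ) :
    Integrable fun s => mollKernel n (s - t) • u s := by
  obtain ⟨C, hC⟩ := (hasCompactSupport_mollKernel n).exists_bound_of_continuous
    (continuous_mollKernel n)
  have hc := continuous_mollKernel n
  exact hu.bdd_smul C (Continuous.aestronglyMeasurable (by fun_prop))
    (.of_forall fun s => hC _)

lemma continuous_deriv_mollKernel (n : ℕ) : Continuous (deriv (mollKernel n)) :=
  (contDiff_mollKernel n).continuous_deriv (by simp)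

lemma integrable_deriv_mollKernel_smul (n : ℕ) {u : ℝ → X} (hu : Integrable u) (t : ℝ) :
    Integrable fun s => deriv (mollKernel n) (s - t) • u s := by
  obtain ⟨C, hC⟩ := (hasCompactSupport_mollKernel n).deriv.exists_bound_of_continuous
    (continuous_deriv_mollKernel n)
  have hc := continuous_deriv_mollKernel n
  exact hu.bdd_smul C (Continuous.aestronglyMeasurable (by fun_prop))
    (.of_forall fun s => hC _)

/-- `moll n u` is the convolution of `u` with the reflected kernel, so the derivative falls on the
kernel; the reflection accounts for the sign. -/
lemma hasDerivAt_moll [CompleteSpace X] (n : ℕ) {u : ℝ → X} (hu : Integrable u) (t : ℝ) :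
    HasDerivAt (moll n u) (-mollDeriv n u t) t := by
  have h := (((hasCompactSupport_mollKernel n).comp_homeomorph
    (Homeomorph.neg ℝ))).hasDerivAt_convolution_left (ContinuousLinearMap.lsmul ℝ ℝ)
    (((contDiff_mollKernel n).comp contDiff_neg).of_le (by simp)) hu.locallyIntegrable t
  have hd : deriv (mollKernel n ∘ Homeomorph.neg ℝ) = fun y => -deriv (mollKernel n) (-y) := by
    ext y
    exact deriv_comp_neg (mollKernel n) y
  refine (h.congr_deriv ?_).congr_of_eventuallyEq (.of_forall fun r => ?_)
  · rw [hd, convolution_eq_swap, mollDeriv, ← integral_neg]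
    simp
  · rw [convolution_eq_swap, moll]
    simp

lemma continuous_moll [CompleteSpace X] (n : ℕ) {u : ℝ → X} (hu : Integrable u) :
    Continuous (moll n u) :=
  continuous_iff_continuousAt.2 fun t => (hasDerivAt_moll n hu t).continuousAt

lemma moll_congr (n : ℕ) {u v : ℝ → X} (h : u =ᵐ[volume] v) : moll n u = moll n v := by
  ext t
  exact integral_congr_ae (h.mono fun s hs => by simp only [hs])

-- This is the continuity of translations in `L¹`, rewritten with integrals of norms.
omit [NormedSpace ℝ X] in
lemma tendsto_lintegral_translate {u : ℝ → X} (hu : Integrable u) :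
    Tendsto (fun y => ∫⁻ t, ‖u (y + t) - u t‖ₑ) (𝓝 0) (𝓝 0) := by
  let g : C(ℝ, C(ℝ, ℝ)) := (ContinuousMap.mk (fun a : ℝ × ℝ => a.1 + a.2) (by fun_prop)).curry
  have hg : ∀ y, MeasurePreserving (g y) volume volume := fun y => measurePreserving_add_left _ y
  have hu1 : MemLp u 1 volume := memLp_one_iff_integrable.2 hu
  have hc : Continuous fun y => Lp.compMeasurePreserving (g y) (hg y) (hu1.toLp u) :=
    continuous_const.compMeasurePreservingLp g.continuous hg ENNReal.one_ne_top
  have hcoe : ∀ y, Lp.compMeasurePreserving (g y) (hg y) (hu1.toLp u)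
      =ᵐ[volume] fun t => u (y + t) := fun y =>
    (Lp.coeFn_compMeasurePreserving _ (hg y)).trans
      ((hg y).quasiMeasurePreserving.ae_eq_comp hu1.coeFn_toLp)
  have h := (hc.tendsto 0).edist (tendsto_const_nhds
    (x := Lp.compMeasurePreserving (g 0) (hg 0) (hu1.toLp u)))
  rw [edist_self] at h
  refine h.congr fun y => ?_
  rw [Lp.edist_def, eLpNorm_one_eq_lintegral_enorm]
  refine lintegral_congr_ae ?_
  filter_upwards [hcoe y, hcoe 0] with t h1 h2
  rw [Pi.sub_apply, h1, h2, zero_add]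

/-- Since the kernel has mass one, the error is a weighted mean over `y` of `u (y + t) - u t`; the
triangle inequality and Tonelli's theorem conclude. -/
lemma lintegral_moll_sub_le [CompleteSpace X] (n : ℕ) {u : ℝ → X} (hu : Integrable u) :
    ∫⁻ t, ‖moll n u t - u t‖ₑ ≤
      ∫⁻ y, ENNReal.ofReal (mollKernel n y) * ∫⁻ t, ‖u (y + t) - u t‖ₑ := by
  -- A strongly measurable representative makes `u (y + t) - u t` jointly measurable, as Tonelli's
  -- theorem requires. Neither side changes when `u` is modified on a null set.
  wlog hm : StronglyMeasurable u generalizing u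
  · have h := this (hu.congr hu.1.ae_eq_mk) hu.1.stronglyMeasurable_mk
    have h1 : ∀ y, ∫⁻ t, ‖hu.1.mk u (y + t) - hu.1.mk u t‖ₑ = ∫⁻ t, ‖u (y + t) - u t‖ₑ := by
      intro y
      refine lintegral_congr_ae ?_
      filter_upwards [hu.1.ae_eq_mk, (measurePreserving_add_left volume
        y).quasiMeasurePreserving.ae_eq_comp hu.1.ae_eq_mk] with t h1 h2
      simp only [Function.comp_apply] at h2
      rw [h1, h2]
    simp only [h1] at h
    refine le_trans (le_of_eq (lintegral_congr_ae ?_)) h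
    filter_upwards [hu.1.ae_eq_mk] with t h1
    rw [← moll_congr n hu.1.ae_eq_mk, h1]
  have hmeas : StronglyMeasurable fun p : ℝ × ℝ => u (p.2 + p.1) - u p.1 :=
    (hm.comp_measurable (by fun_prop)).sub (hm.comp_measurable (by fun_prop))
  have hk : Measurable (mollKernel n) := (continuous_mollKernel n).measurable
  have h1 : ∀ t, ‖moll n u t - u t‖ₑ ≤
      ∫⁻ y, ENNReal.ofReal (mollKernel n y) * ‖u (y + t) - u t‖ₑ := by
    intro t
    have h2 : moll n u t - u t = ∫ y, mollKernel n y • (u (y + t) - u t) := by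
      have h3 : Integrable fun y => mollKernel n y • u (y + t) := by
        have := (integrable_mollKernel_smul n hu t).comp_add_right t
        simpa using this
      simp only [smul_sub]
      rw [integral_sub h3 ((integrable_mollKernel n).smul_const _), integral_smul_const,
        integral_mollKernel, one_smul, moll_eq]
    rw [h2]
    refine (enorm_integral_le_lintegral_enorm _).trans (le_of_eq (lintegral_congr fun y => ?_))
    rw [enorm_smul, Real.enorm_of_nonneg (mollKernel_nonneg n y)]
  refine (lintegral_mono h1).trans ?_
  rw [lintegral_lintegral_swap]
  · refine lintegral_mono fun y => ?_
    rw [lintegral_const_mul]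
    exact (hmeas.comp_measurable (measurable_id.prodMk measurable_const)).enorm
  · exact ((hk.comp measurable_snd).ennreal_ofReal.mul hmeas.enorm).aemeasurable

lemma tendsto_lintegral_moll_sub [CompleteSpace X] {u : ℝ → X} (hu : Integrable u) :
    Tendsto (fun n => ∫⁻ t, ‖moll n u t - u t‖ₑ) atTop (𝓝 0) := by
  rw [ENNReal.tendsto_nhds_zero]
  intro ε hε
  have h1 := (ENNReal.tendsto_nhds_zero.1 (tendsto_lintegral_translate hu)) ε hε
  obtain ⟨r, hr, h2⟩ := Metric.eventually_nhds_iff.1 h1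
  have h3 : ∀ᶠ n in atTop, mollWidth n < r / 2 :=
    tendsto_mollWidth.eventually_lt_const (by positivity)
  filter_upwards [h3] with n hn
  refine (lintegral_moll_sub_le n hu).trans ?_
  have h4 : ∀ y, ENNReal.ofReal (mollKernel n y) * ∫⁻ t, ‖u (y + t) - u t‖ₑ ≤
      ENNReal.ofReal (mollKernel n y) * ε := by
    intro y
    by_cases hy : y ∈ Ioo 0 (2 * mollWidth n)
    · gcongr
      refine h2 ?_
      rw [Real.dist_eq, sub_zero, abs_of_pos hy.1]
      linarith [hy.2]
    · simp [mollKernel_eq_zero hy]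
  refine (lintegral_mono h4).trans ?_
  rw [lintegral_mul_const _ (continuous_mollKernel n).measurable.ennreal_ofReal,
    ← ofReal_integral_eq_lintegral_ofReal (integrable_mollKernel n)
      (.of_forall (mollKernel_nonneg n)), integral_mollKernel]
  simp

/-- Mollifications converge in `L¹`. -/
theorem tendsto_integral_norm_moll_sub [CompleteSpace X] {u : ℝ → X} (hu : Integrable u) :
    Tendsto (fun n => ∫ t, ‖moll n u t - u t‖) atTop (𝓝 0) := by
  have h := (ENNReal.tendsto_toReal ENNReal.zero_ne_top).comp (tendsto_lintegral_moll_sub hu)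
  refine h.congr fun n => ?_
  exact (integral_norm_eq_lintegral_enorm
    ((continuous_moll n hu).aestronglyMeasurable.sub hu.1)).symm

lemma eventually_integrable_moll_sub [CompleteSpace X] {u : ℝ → X} (hu : Integrable u) :
    ∀ᶠ n in atTop, Integrable fun t => moll n u t - u t := by
  filter_upwards [(tendsto_lintegral_moll_sub hu).eventually_lt_const ENNReal.zero_lt_top]
    with n hn
  exact ⟨(continuous_moll n hu).aestronglyMeasurable.sub hu.1, hn⟩

lemma moll_eq_zero {n : ℕ} {u : ℝ → X} {t : ℝ} (hu : ∀ s ≤ 0, u s = 0)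
    (ht : t + 2 * mollWidth n ≤ 0) : moll n u t = 0 := by
  refine integral_eq_zero_of_ae (.of_forall fun s => ?_)
  by_cases hs : s ≤ 0
  · simp [hu s hs]
  · simp only [Pi.zero_apply]
    rw [mollKernel_eq_zero, zero_smul]
    intro h
    linarith [h.2]

end Mollifier

/-! ### Evolution equations tested with functions of time -/

section TimeWeak

open Filter Topology

lemma continuous_mollDeriv {X : Type*} [NormedAddCommGroup X] [NormedSpace ℝ X]
    (n : ℕ) {u : ℝ → X} (hu : Integrable u) :
    Continuous (mollDeriv n u) := by
  have h := (((hasCompactSupport_mollKernel n).deriv.comp_homeomorph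
    (Homeomorph.neg ℝ))).continuous_convolution_left (ContinuousLinearMap.lsmul ℝ ℝ)
    ((continuous_deriv_mollKernel n).comp continuous_neg) hu.locallyIntegrable
  convert h using 1
  ext r
  rw [convolution_eq_swap, mollDeriv]
  simp

variable {X : Type*} [NormedAddCommGroup X] [InnerProductSpace ℂ X]

lemma map_moll [CompleteSpace X] (A : X →L[ℂ] X) (n : ℕ) {u : ℝ → X} (hu : Integrable u) (t : ℝ) :
    moll n (fun s => A (u s)) t = A (moll n u t) := by
  rw [moll, moll, ← A.integral_comp_comm (integrable_mollKernel_smul n hu t)]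
  simp

lemma map_mollDeriv [CompleteSpace X] (A : X →L[ℂ] X) (n : ℕ) {u : ℝ → X} (hu : Integrable u)
    (t : ℝ) : mollDeriv n (fun s => A (u s)) t = A (mollDeriv n u t) := by
  rw [mollDeriv, mollDeriv, ← A.integral_comp_comm (integrable_deriv_mollKernel_smul n hu t)]
  simp

/-- The evolution equation `∂ₜ w + A v = h`, `w(0) = w₀`, tested with functions of time; here `G` is
the graph of `A`. -/
def IsTimeWeak (G : Submodule ℂ (X × X)) (T : ℝ) (v h w : ℝ → X) (w₀ : X) : Prop :=
  ∀ η : ℝ → ℝ, ContDiff ℝ ∞ η → HasCompactSupport η → tsupport η ⊆ Iio T →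
    (∫ s, η s • v s, (∫ s, η s • h s) + (∫ s, deriv η s • w s) + η 0 • w₀) ∈ G

variable {G : Submodule ℂ (X × X)} {T : ℝ}

/-- The test function is `s ↦ mollKernel n (s - t)`. The kernel's closed support lies in an open
interval, so equality `t + 2 * mollWidth n = T` is allowed. -/
lemma IsTimeWeak.moll_mem {v h w : ℝ → X} {w₀ : X} (H : IsTimeWeak G T v h w w₀) {n : ℕ} {t : ℝ}
    (ht : t + 2 * mollWidth n ≤ T) :
    (moll n v t, moll n h t + mollDeriv n w t + mollKernel n (-t) • w₀) ∈ G := by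
  have h1 : tsupport (fun s => mollKernel n (s - t)) ⊆ Iio T := by
    have h2 := tsupport_comp_subset_preimage (mollKernel n) (f := fun s => s - t) (by fun_prop)
    intro s hs
    have h3 := (tsupport_mollKernel n (h2 hs)).2
    simp only [mem_Iio]
    linarith
  have h2 := H (fun s => mollKernel n (s - t))
    ((contDiff_mollKernel n).comp (contDiff_id.sub contDiff_const))
    ((hasCompactSupport_mollKernel n).comp_homeomorph (Homeomorph.subRight t)) h1
  simp only [deriv_comp_sub_const, zero_sub] at h2
  exact h2

/-- For `t ≥ 0` the forward-looking kernel vanishes at time 0, so the initial datum drops out and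
the mollified equation holds up to and including `t = 0`. -/
lemma IsTimeWeak.moll_mem_of_nonneg {v h w : ℝ → X} {w₀ : X} (H : IsTimeWeak G T v h w w₀) {n : ℕ}
    {t : ℝ} (h0 : 0 ≤ t) (ht : t + 2 * mollWidth n ≤ T) :
    (moll n v t, moll n h t + mollDeriv n w t) ∈ G := by
  have h1 := H.moll_mem ht
  rwa [mollKernel_eq_zero, zero_smul, add_zero] at h1
  intro h
  linarith [h.1]

lemma integral_mollKernel_neg {n : ℕ} (hn : 2 * mollWidth n ≤ 1) :
    ∫ t in Ioc (-1 : ℝ) 0, mollKernel n (-t) = 1 := by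
  rw [setIntegral_eq_integral_of_forall_compl_eq_zero]
  · rw [integral_neg_eq_self (mollKernel n) volume, integral_mollKernel]
  · intro t ht
    refine mollKernel_eq_zero fun h => ht ⟨?_, ?_⟩ <;> linarith [h.1, h.2]

/-- For `t ≤ 0` the function `u` vanishes, so `moll n u t` is itself the mollification error. -/
lemma norm_setIntegral_moll_le [CompleteSpace X] {n : ℕ} {u : ℝ → X}
    (h0 : ∀ s ≤ 0, u s = 0) (hn : Integrable fun t => moll n u t - u t) :
    ‖∫ t in Ioc (-1 : ℝ) 0, moll n u t‖ ≤ ∫ t, ‖moll n u t - u t‖ := by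
  refine (norm_integral_le_integral_norm _).trans ?_
  refine le_trans (le_of_eq (setIntegral_congr_fun measurableSet_Ioc fun t ht => ?_))
    (setIntegral_le_integral hn.norm (.of_forall fun t => norm_nonneg _))
  simp only [h0 t ht.2, sub_zero]

/-- The initial condition contained in a time-weak evolution equation. -/
lemma IsTimeWeak.initial_mem [CompleteSpace X] (hT : 0 < T) (hG : IsClosed (G : Set (X × X)))
    {v h w : ℝ → X} {w₀ wl : X}
    (H : IsTimeWeak G T v h w w₀) (hv : Integrable v) (hh : Integrable h) (hw : Integrable w)
    (hv0 : ∀ s ≤ 0, v s = 0) (hh0 : ∀ s ≤ 0, h s = 0) (hw0 : ∀ s ≤ 0, w s = 0)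
    (hlim : Tendsto (fun n => moll n w 0) atTop (𝓝 wl)) : (0, w₀ - wl) ∈ G := by
  -- The datum `w₀` is seen by the mollified equation only for `t < 0`, where its weight `mollKernel
  -- n (-t)` has total mass one. Averaging the equation over `(-1, 0]` therefore isolates `w₀`,
  -- while the contributions of `v` and `h` vanish in the limit.
  have hev : ∀ᶠ n in atTop, (∫ t in Ioc (-1 : ℝ) 0, moll n v t,
      (∫ t in Ioc (-1 : ℝ) 0, moll n h t) + (w₀ - moll n w 0)) ∈ G := by
    filter_upwards [tendsto_mollWidth.eventually_lt_const (u := 1 / 2) (by norm_num),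
      tendsto_mollWidth.eventually_lt_const (u := T / 2) (by positivity)] with n hn hnT
    -- The interval has length one, so the integral is a mean and stays in the closed convex set
    -- `G`.
    have : IsProbabilityMeasure ((volume : Measure ℝ).restrict (Ioc (-1 : ℝ) 0)) :=
      ⟨by simp⟩
    have hI : ∀ {F : ℝ → X}, Continuous F →
        Integrable F ((volume : Measure ℝ).restrict (Ioc (-1 : ℝ) 0)) := fun hF =>
      (hF.continuousOn.integrableOn_Icc).mono_set Ioc_subset_Icc_self
    have hk : Continuous fun t => mollKernel n (-t) • w₀ := by
      have := continuous_mollKernel n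
      fun_prop
    have h1 := hI (continuous_moll n hv)
    have h2 := hI (continuous_moll n hh)
    have h3 := hI (continuous_mollDeriv n hw)
    have h4 := hI hk
    have h23 : Integrable (fun t => moll n h t + mollDeriv n w t)
        ((volume : Measure ℝ).restrict (Ioc (-1 : ℝ) 0)) := h2.add h3
    have h234 : Integrable (fun t => moll n h t + mollDeriv n w t + mollKernel n (-t) • w₀)
        ((volume : Measure ℝ).restrict (Ioc (-1 : ℝ) 0)) := h23.add h4
    have hconv : Convex ℝ (G : Set (X × X)) := (G.restrictScalars ℝ).convex
    have h5 := hconv.integral_mem hG (μ := (volume : Measure ℝ).restrict (Ioc (-1 : ℝ) 0))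
      (f := fun t => (moll n v t, moll n h t + mollDeriv n w t + mollKernel n (-t) • w₀))
      ((ae_restrict_iff' measurableSet_Ioc).2 (.of_forall fun t ht =>
        H.moll_mem (by linarith [ht.2]))) (h1.prodMk h234)
    rw [integral_pair h1 h234, integral_add h23 h4, integral_add h2 h3,
      integral_smul_const, integral_mollKernel_neg (by linarith), one_smul] at h5
    -- `-mollDeriv n w` is the derivative of `moll n w`, which is still zero at `t = -1`.
    have h6 : ∫ t in Ioc (-1 : ℝ) 0, mollDeriv n w t = -moll n w 0 := by
      have h7 := intervalIntegral.integral_eq_sub_of_hasDerivAt (a := -1) (b := 0)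
        (fun t _ => hasDerivAt_moll n hw t)
        ((continuous_mollDeriv n hw).neg.intervalIntegrable _ _)
      rw [moll_eq_zero hw0 (t := -1) (by linarith), sub_zero,
        intervalIntegral.integral_of_le (by norm_num), integral_neg] at h7
      rw [← h7, neg_neg]
    rwa [h6, add_assoc, neg_add_eq_sub] at h5
  have hz : ∀ {u : ℝ → X}, Integrable u → (∀ s ≤ 0, u s = 0) →
      Tendsto (fun n => ∫ t in Ioc (-1 : ℝ) 0, moll n u t) atTop (𝓝 0) := fun hu hu0 =>
    squeeze_zero_norm' ((eventually_integrable_moll_sub hu).mono fun n hn =>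
      norm_setIntegral_moll_le hu0 hn) (tendsto_integral_norm_moll_sub hu)
  have hl := (hz hv hv0).prodMk_nhds ((hz hh hh0).add (hlim.const_sub w₀))
  rw [zero_add] at hl
  exact hG.mem_of_tendsto hl hev

end TimeWeak

/-! ### Continuous representatives of weak solutions and their energy balance -/

section Regularity

open Filter Topology

variable {X : Type*} [NormedAddCommGroup X] [InnerProductSpace ℂ X]

/-- The abstract Maxwell system with `L¹` sources, tested with functions of time only. All
functions are extended by zero to negative times. -/
structure IsTimeWeakSystem (G : Submodule ℂ (X × X)) (P R : X →L[ℂ] X) (T : ℝ)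
    (f g : ℝ → X) (E₀ B₀ : X) (E B : ℝ → X) : Prop where
  integrable_E : Integrable E
  integrable_B : Integrable B
  integrable_f : Integrable f
  integrable_g : Integrable g
  E_zero : ∀ s ≤ 0, E s = 0
  B_zero : ∀ s ≤ 0, B s = 0
  f_zero : ∀ s ≤ 0, f s = 0
  g_zero : ∀ s ≤ 0, g s = 0
  faraday : IsTimeWeak G T E f B B₀
  ampere : IsTimeWeak G T (fun s => -R (B s)) g (fun s => P (E s)) (P E₀)

namespace IsTimeWeakSystem

variable {G : Submodule ℂ (X × X)} {P R : X →L[ℂ] X} {T : ℝ} {f g : ℝ → X} {E₀ B₀ : X}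
  {E B : ℝ → X} [CompleteSpace X]

lemma isClassicalSolution_moll (H : IsTimeWeakSystem G P R T f g E₀ B₀ E B) {n : ℕ} {b : ℝ}
    (hb : b + 2 * mollWidth n ≤ T) :
    IsClassicalSolution G P R 0 b (moll n E) (moll n B) (moll n f) (moll n g) where
  eqn t ht := by
    have htT : t + 2 * mollWidth n ≤ T := by linarith [ht.2]
    refine ⟨_, _, hasDerivAt_moll n H.integrable_E t, hasDerivAt_moll n H.integrable_B t, ?_, ?_⟩
    · simpa using H.faraday.moll_mem_of_nonneg ht.1 htT
    · have h1 := G.neg_mem (H.ampere.moll_mem_of_nonneg ht.1 htT)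
      have h2 : moll n (fun s => -R (B s)) t = -R (moll n B t) :=
        map_moll (-R) n H.integrable_B t
      rw [h2, map_mollDeriv P n H.integrable_E, Prod.neg_mk, neg_neg] at h1
      convert h1 using 2
      rw [map_neg]
      abel
  continuousOn_f := (continuous_moll n H.integrable_f).continuousOn
  continuousOn_g := (continuous_moll n H.integrable_g).continuousOn

/-- The total `L¹` error of the `n`-th mollification. -/
def mollErr (f g E B : ℝ → X) (n : ℕ) : ℝ :=
  (∫ t, ‖moll n f t - f t‖) + (∫ t, ‖moll n g t - g t‖) +
    ((∫ t, ‖moll n E t - E t‖) + ∫ t, ‖moll n B t - B t‖)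

omit [CompleteSpace X] in
lemma mollErr_nonneg (n : ℕ) : 0 ≤ mollErr f g E B n := by
  unfold mollErr
  positivity

lemma tendsto_mollErr (H : IsTimeWeakSystem G P R T f g E₀ B₀ E B) :
    Tendsto (mollErr f g E B) atTop (𝓝 0) := by
  have h := ((tendsto_integral_norm_moll_sub H.integrable_f).add
    (tendsto_integral_norm_moll_sub H.integrable_g)).add
    ((tendsto_integral_norm_moll_sub H.integrable_E).add
      (tendsto_integral_norm_moll_sub H.integrable_B))
  simp only [add_zero] at h
  exact h

lemma eventually_integrable (H : IsTimeWeakSystem G P R T f g E₀ B₀ E B) :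
    ∀ᶠ n in atTop, (Integrable (fun t => moll n f t - f t) ∧
      Integrable fun t => moll n g t - g t) ∧
      (Integrable (fun t => moll n E t - E t) ∧ Integrable fun t => moll n B t - B t) :=
  ((eventually_integrable_moll_sub H.integrable_f).and
    (eventually_integrable_moll_sub H.integrable_g)).and
    ((eventually_integrable_moll_sub H.integrable_E).and
      (eventually_integrable_moll_sub H.integrable_B))

lemma intervalIntegral_norm_le {X : Type*} [NormedAddCommGroup X] {b : ℝ} (hb : 0 ≤ b)
    {v : ℝ → X} (hv : Integrable v) :
    ∫ t in (0 : ℝ)..b, ‖v t‖ ≤ ∫ t, ‖v t‖ := by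
  rw [intervalIntegral.integral_of_le hb]
  exact setIntegral_le_integral hv.norm (.of_forall fun t => norm_nonneg _)

omit [CompleteSpace X] in
lemma intervalIntegral_norm_moll_sub_moll_le {b : ℝ} (hb : 0 ≤ b) {n m : ℕ} {u : ℝ → X}
    (hn : Integrable fun t => moll n u t - u t) (hm : Integrable fun t => moll m u t - u t) :
    ∫ t in (0 : ℝ)..b, ‖moll n u t - moll m u t‖ ≤
      (∫ t, ‖moll n u t - u t‖) + ∫ t, ‖moll m u t - u t‖ := by
  have h1 : (fun t => moll n u t - moll m u t) =
      fun t => (moll n u t - u t) - (moll m u t - u t) := by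
    ext t
    abel
  have h0 : Integrable fun t => moll n u t - moll m u t := by
    rw [h1]
    exact hn.sub hm
  refine (intervalIntegral_norm_le hb h0).trans ?_
  rw [← integral_add hn.norm hm.norm]
  refine integral_mono h0.norm (hn.norm.add hm.norm) fun t => ?_
  have h2 := congrFun h1 t
  simp only at h2 ⊢
  rw [h2]
  exact norm_sub_le _ _

/-- The mollifications form a Cauchy sequence, uniformly on `[0, b]`. -/
lemma exists_uniform_bound (H : IsTimeWeakSystem G P R T f g E₀ B₀ E B)
    (hP : IsCoerciveSymm P) (hR : IsCoerciveSymm R) (hG : IsSymmGraph G) {b : ℝ} (hb : 0 < b)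
    (hbT : b < T) :
    ∃ K : ℝ, 0 ≤ K ∧ ∃ N : ℕ, ∀ n ≥ N, ∀ m ≥ N, ∀ t ∈ Icc 0 b,
      ‖moll n E t - moll m E t‖ + ‖moll n B t - moll m B t‖ ≤
        K * (mollErr f g E B n + mollErr f g E B m) := by
  obtain ⟨K, hK, hap⟩ := exists_apriori_bound hP hR hG
  have hev := H.eventually_integrable.and
    (tendsto_mollWidth.eventually_lt_const (u := (T - b) / 2) (by linarith))
  obtain ⟨N, hN⟩ := eventually_atTop.1 hev
  refine ⟨K * (1 / b + 1), by positivity, N, fun n hn m hm t ht => ?_⟩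
  obtain ⟨⟨⟨hfn, hgn⟩, hEn, hBn⟩, hwn⟩ := hN n hn
  obtain ⟨⟨⟨hfm, hgm⟩, hEm, hBm⟩, hwm⟩ := hN m hm
  have hsol := (H.isClassicalSolution_moll (n := n) (b := b) (by linarith)).sub
    (H.isClassicalSolution_moll (n := m) (b := b) (by linarith))
  have hap' := hap _ _ _ _ _ _ hsol
  set e := mollErr f g E B n + mollErr f g E B m with he
  have hii : ∀ {u : ℝ → X}, Integrable u →
      IntervalIntegrable (fun t => ‖(moll n u - moll m u) t‖) volume 0 b := fun hu =>
    ((continuous_moll n hu).sub (continuous_moll m hu)).norm.intervalIntegrable _ _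
  have hf1 := intervalIntegral_norm_moll_sub_moll_le hb.le hfn hfm
  have hg1 := intervalIntegral_norm_moll_sub_moll_le hb.le hgn hgm
  have hE1 := intervalIntegral_norm_moll_sub_moll_le hb.le hEn hEm
  have hB1 := intervalIntegral_norm_moll_sub_moll_le hb.le hBn hBm
  have hpos : ∀ (k : ℕ) (u : ℝ → X), 0 ≤ ∫ t, ‖moll k u t - u t‖ := fun k u => by positivity
  have hI : ∫ r in (0 : ℝ)..b, (‖(moll n f - moll m f) r‖ + ‖(moll n g - moll m g) r‖) ≤ e := by
    rw [intervalIntegral.integral_add (hii H.integrable_f) (hii H.integrable_g)]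
    simp only [Pi.sub_apply]
    rw [he, mollErr, mollErr]
    linarith [hpos n E, hpos n B, hpos m E, hpos m B]
  have hJ : ∫ r in (0 : ℝ)..b, (‖(moll n E - moll m E) r‖ + ‖(moll n B - moll m B) r‖) ≤ e := by
    rw [intervalIntegral.integral_add (hii H.integrable_E) (hii H.integrable_B)]
    simp only [Pi.sub_apply]
    rw [he, mollErr, mollErr]
    linarith [hpos n f, hpos n g, hpos m f, hpos m g]
  set D := ‖moll n E t - moll m E t‖ + ‖moll n B t - moll m B t‖
  -- No convergence of the mollifications at a fixed time is known yet. The a priori bound is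
  -- therefore averaged over the reference time `s ∈ [0, b]`, so that the values at `s` enter only
  -- through their `L¹` norm, which `e` controls.
  have h1 : ∫ _ in (0 : ℝ)..b, D ≤ ∫ s in (0 : ℝ)..b,
      K * ((‖(moll n E - moll m E) s‖ + ‖(moll n B - moll m B) s‖) + e) := by
    refine intervalIntegral.integral_mono_on hb.le intervalIntegrable_const
      ((((hii H.integrable_E).add (hii H.integrable_B)).add
        intervalIntegrable_const).const_mul K) fun s hs => ?_
    refine (hap' s hs t ht).trans ?_
    gcongr
  rw [intervalIntegral.integral_const, intervalIntegral.integral_const_mul,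
    intervalIntegral.integral_add ((hii H.integrable_E).add (hii H.integrable_B))
      intervalIntegrable_const, intervalIntegral.integral_const, sub_zero, smul_eq_mul,
    smul_eq_mul] at h1
  have h2 : b * D ≤ b * (K * (1 / b + 1) * e) := by
    have h3 : b * (K * (1 / b + 1) * e) = K * (e + b * e) := by field_simp
    rw [h3]
    refine h1.trans ?_
    gcongr
  exact le_of_mul_le_mul_left h2 hb

/-- The continuous representative of a time-weak solution, as the limit of its mollifications. -/
def contRep (u : ℝ → X) (t : ℝ) : X := limUnder atTop fun n => moll n u t

/-- The uniform bound makes the mollifications Cauchy at `t`. It is applied on `[0, (t + T)/2]`,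
since mollifying near `T` would need values beyond `T`. -/
lemma tendsto_contRep (H : IsTimeWeakSystem G P R T f g E₀ B₀ E B)
    (hP : IsCoerciveSymm P) (hR : IsCoerciveSymm R) (hG : IsSymmGraph G) {t : ℝ}
    (ht : t ∈ Ico 0 T) :
    Tendsto (fun n => moll n E t) atTop (𝓝 (contRep E t)) ∧
      Tendsto (fun n => moll n B t) atTop (𝓝 (contRep B t)) := by
  obtain ⟨K, hK, N, hN⟩ := H.exists_uniform_bound hP hR hG (b := (t + T) / 2)
    (by linarith [ht.1, ht.2]) (by linarith [ht.2])
  have htI : t ∈ Icc 0 ((t + T) / 2) := ⟨ht.1, by linarith [ht.2]⟩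
  have hc : ∀ u : ℝ → X, (∀ n ≥ N, ∀ m ≥ N, ‖moll n u t - moll m u t‖ ≤
      K * (mollErr f g E B n + mollErr f g E B m)) → CauchySeq fun n => moll n u t := by
    intro u hu
    rw [Metric.cauchySeq_iff]
    intro ε hε
    have h1 : Tendsto (fun n => K * (mollErr f g E B n + mollErr f g E B n)) atTop (𝓝 0) := by
      simpa using ((H.tendsto_mollErr).add H.tendsto_mollErr).const_mul K
    obtain ⟨N', hN'⟩ := eventually_atTop.1 (h1.eventually_lt_const hε)
    refine ⟨max N N', fun m hm n hn => ?_⟩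
    rw [dist_eq_norm]
    refine (hu m (le_of_max_le_left hm) n (le_of_max_le_left hn)).trans_lt ?_
    have h2 := hN' m (le_of_max_le_right hm)
    have h3 := hN' n (le_of_max_le_right hn)
    nlinarith
  refine ⟨(hc E fun n hn m hm => ?_).tendsto_limUnder, (hc B fun n hn m hm => ?_).tendsto_limUnder⟩
  · exact le_trans (le_add_of_nonneg_right (norm_nonneg _)) (hN n hn m hm t htI)
  · exact le_trans (le_add_of_nonneg_left (norm_nonneg _)) (hN n hn m hm t htI)

lemma exists_uniform_bound_contRep (H : IsTimeWeakSystem G P R T f g E₀ B₀ E B)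
    (hP : IsCoerciveSymm P) (hR : IsCoerciveSymm R) (hG : IsSymmGraph G) {b : ℝ} (hb : 0 < b)
    (hbT : b < T) :
    ∃ K : ℝ, 0 ≤ K ∧ ∀ᶠ n in atTop, ∀ t ∈ Icc 0 b,
      ‖moll n E t - contRep E t‖ + ‖moll n B t - contRep B t‖ ≤ K * mollErr f g E B n := by
  obtain ⟨K, hK, N, hN⟩ := H.exists_uniform_bound hP hR hG hb hbT
  refine ⟨K, hK, eventually_atTop.2 ⟨N, fun n hn t ht => ?_⟩⟩
  obtain ⟨hE, hB⟩ := H.tendsto_contRep hP hR hG ⟨ht.1, ht.2.trans_lt hbT⟩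
  have h1 := ((hE.const_sub (moll n E t)).norm.add (hB.const_sub (moll n B t)).norm)
  have h2 := ((H.tendsto_mollErr).const_add (mollErr f g E B n)).const_mul K
  rw [add_zero] at h2
  exact le_of_tendsto_of_tendsto h1 h2 (eventually_atTop.2 ⟨N, fun m hm => hN n hn m hm t ht⟩)

lemma continuousOn_contRep (H : IsTimeWeakSystem G P R T f g E₀ B₀ E B)
    (hP : IsCoerciveSymm P) (hR : IsCoerciveSymm R) (hG : IsSymmGraph G) :
    ContinuousOn (contRep E) (Ico 0 T) ∧ ContinuousOn (contRep B) (Ico 0 T) := by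
  have key : ∀ u : ℝ → X, Integrable u → (∀ b, 0 < b → b < T → ∃ K : ℝ, 0 ≤ K ∧
      ∀ᶠ n in atTop, ∀ t ∈ Icc 0 b, ‖moll n u t - contRep u t‖ ≤ K * mollErr f g E B n) →
      ContinuousOn (contRep u) (Ico 0 T) := by
    intro u hu h t ht
    obtain ⟨K, hK, hev⟩ := h ((t + T) / 2) (by linarith [ht.1, ht.2]) (by linarith [ht.2])
    have hunif : TendstoUniformlyOn (fun n => moll n u) (contRep u) atTop
        (Icc 0 ((t + T) / 2)) := by
      rw [Metric.tendstoUniformlyOn_iff]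
      intro ε hε
      have h1 : Tendsto (fun n => K * mollErr f g E B n) atTop (𝓝 0) := by
        simpa using H.tendsto_mollErr.const_mul K
      filter_upwards [hev, h1.eventually_lt_const hε] with n hn hn' r hr
      rw [dist_comm, dist_eq_norm]
      exact (hn r hr).trans_lt hn'
    have hcont := hunif.continuousOn (Frequently.of_forall fun n =>
      (continuous_moll n hu).continuousOn)
    refine (hcont t ⟨ht.1, by linarith [ht.2]⟩).mono_of_mem_nhdsWithin ?_
    filter_upwards [self_mem_nhdsWithin,
      mem_nhdsWithin_of_mem_nhds (Iio_mem_nhds (show t < (t + T) / 2 by linarith [ht.2]))]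
      with r hr hr'
    exact ⟨hr.1, le_of_lt hr'⟩
  refine ⟨key E H.integrable_E fun b hb hbT => ?_, key B H.integrable_B fun b hb hbT => ?_⟩
  · obtain ⟨K, hK, hev⟩ := H.exists_uniform_bound_contRep hP hR hG hb hbT
    exact ⟨K, hK, hev.mono fun n hn t ht =>
      le_trans (le_add_of_nonneg_right (norm_nonneg _)) (hn t ht)⟩
  · obtain ⟨K, hK, hev⟩ := H.exists_uniform_bound_contRep hP hR hG hb hbT
    exact ⟨K, hK, hev.mono fun n hn t ht =>
      le_trans (le_add_of_nonneg_left (norm_nonneg _)) (hn t ht)⟩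

omit [CompleteSpace X] in
lemma exists_subseq_moll_tendsto_ae [CompleteSpace X] {u : ℝ → X} (hu : Integrable u) :
    ∃ ns : ℕ → ℕ, StrictMono ns ∧
      ∀ᵐ t, Tendsto (fun i => moll (ns i) u t) atTop (𝓝 (u t)) := by
  refine (tendstoInMeasure_of_tendsto_eLpNorm one_ne_zero
    (fun n => (continuous_moll n hu).aestronglyMeasurable) hu.1 ?_).exists_seq_tendsto_ae
  refine (tendsto_lintegral_moll_sub hu).congr fun n => ?_
  rw [eLpNorm_one_eq_lintegral_enorm]
  rfl

/-- Convergence in `L¹` gives convergence almost everywhere along a subsequence, and the pointwise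
limit is already `contRep`. -/
lemma contRep_ae_eq (H : IsTimeWeakSystem G P R T f g E₀ B₀ E B)
    (hP : IsCoerciveSymm P) (hR : IsCoerciveSymm R) (hG : IsSymmGraph G) :
    ∀ᵐ t, t ∈ Ico 0 T → contRep E t = E t ∧ contRep B t = B t := by
  obtain ⟨ns, hns, hE⟩ := exists_subseq_moll_tendsto_ae H.integrable_E
  obtain ⟨ms, hms, hB⟩ := exists_subseq_moll_tendsto_ae H.integrable_B
  filter_upwards [hE, hB] with t h1 h2 ht
  obtain ⟨h3, h4⟩ := H.tendsto_contRep hP hR hG ht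
  exact ⟨tendsto_nhds_unique (h3.comp hns.tendsto_atTop) h1,
    tendsto_nhds_unique (h4.comp hms.tendsto_atTop) h2⟩

/-- The averaged equation puts `(0, w₀ - wl)` in `G`, where `wl` is the limit at time 0 of the
mollified unknown. Hence the two agree; for Ampère's equation this gives only `P (E₀ - contRep E 0)
= 0`, and coercivity of `P` removes the coefficient. -/
lemma contRep_zero (H : IsTimeWeakSystem G P R T f g E₀ B₀ E B) (hT : 0 < T)
    (hP : IsCoerciveSymm P) (hR : IsCoerciveSymm R) (hG : IsSymmGraph G)
    (hGc : IsClosed (G : Set (X × X))) (hG0 : ∀ y, (0, y) ∈ G → y = 0) :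
    contRep E 0 = E₀ ∧ contRep B 0 = B₀ := by
  obtain ⟨hE, hB⟩ := H.tendsto_contRep hP hR hG (t := 0) ⟨le_rfl, hT⟩
  constructor
  · have h1 : Tendsto (fun n => moll n (fun s => P (E s)) 0) atTop (𝓝 (P (contRep E 0))) := by
      simp only [map_moll P _ H.integrable_E]
      exact (P.continuous.tendsto _).comp hE
    have h2 := hG0 _ (H.ampere.initial_mem hT hGc (R.integrable_comp H.integrable_B).neg
      H.integrable_g (P.integrable_comp H.integrable_E) (fun s hs => by simp [H.B_zero s hs])
      H.g_zero (fun s hs => by simp [H.E_zero s hs]) h1)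
    rw [← map_sub] at h2
    obtain ⟨c, hc, hlow⟩ := hP.lower
    have h3 := hlow (E₀ - contRep E 0)
    rw [h2, inner_zero_right, Complex.zero_re] at h3
    have h4 : ‖E₀ - contRep E 0‖ ^ 2 = 0 := le_antisymm (by nlinarith) (by positivity)
    exact (sub_eq_zero.1 (norm_eq_zero.1 (pow_eq_zero_iff two_ne_zero |>.1 h4))).symm
  · exact (sub_eq_zero.1 (hG0 _ (H.faraday.initial_mem hT hGc H.integrable_E H.integrable_f
      H.integrable_B H.E_zero H.f_zero H.B_zero hB))).symm

/-- The a priori constant is independent of the interval, so the bounds for the mollifications on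
`[0, t]` pass to the limit with a constant that does not deteriorate as `t` approaches `T`. This is
what turns square integrable solutions into `L^∞` ones. -/
lemma exists_contRep_bound (H : IsTimeWeakSystem G P R T f g E₀ B₀ E B) (hT : 0 < T)
    (hP : IsCoerciveSymm P) (hR : IsCoerciveSymm R) (hG : IsSymmGraph G) :
    ∃ C : ℝ, ∀ t ∈ Ico 0 T, ‖contRep E t‖ + ‖contRep B t‖ ≤ C := by
  obtain ⟨K, hK, hap⟩ := exists_apriori_bound hP hR hG
  obtain ⟨hE0, hB0⟩ := H.tendsto_contRep hP hR hG (t := 0) ⟨le_rfl, hT⟩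
  -- The summand 0 is the limit of `mollErr`; keeping it makes the bound literally the limit of the
  -- bounds for the mollifications.
  refine ⟨K * (‖contRep E 0‖ + ‖contRep B 0‖ + ((∫ r, ‖f r‖) + (∫ r, ‖g r‖) + 0)),
    fun t ht => ?_⟩
  obtain ⟨hE, hB⟩ := H.tendsto_contRep hP hR hG ht
  refine le_of_tendsto_of_tendsto (hE.norm.add hB.norm)
    (((hE0.norm.add hB0.norm).add (H.tendsto_mollErr.const_add _)).const_mul K) ?_
  filter_upwards [H.eventually_integrable,
    tendsto_mollWidth.eventually_lt_const (u := (T - t) / 2) (by linarith [ht.2])] with n hn hw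
  obtain ⟨⟨hfn, hgn⟩, -, -⟩ := hn
  refine (hap 0 t _ _ _ _ (H.isClassicalSolution_moll (by linarith)) 0 ⟨le_rfl, ht.1⟩ t
    ⟨ht.1, le_rfl⟩).trans ?_
  have h1 : ∀ {u : ℝ → X}, Integrable u → Integrable (fun r => moll n u r - u r) →
      ∫ r in (0 : ℝ)..t, ‖moll n u r‖ ≤ (∫ r, ‖u r‖) + ∫ r, ‖moll n u r - u r‖ := by
    intro u hu hun
    have hm : Integrable (moll n u) := (hun.add hu).congr (.of_forall fun r => sub_add_cancel _ _)
    refine (intervalIntegral_norm_le ht.1 hm).trans ?_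
    rw [← integral_add hu.norm hun.norm]
    refine integral_mono hm.norm (hu.norm.add hun.norm) fun r => ?_
    simpa using norm_add_le (u r) (moll n u r - u r)
  have h2 := h1 H.integrable_f hfn
  have h3 := h1 H.integrable_g hgn
  rw [intervalIntegral.integral_add ((continuous_moll n H.integrable_f).norm.intervalIntegrable _ _)
    ((continuous_moll n H.integrable_g).norm.intervalIntegrable _ _)]
  have h4 : 0 ≤ (∫ t, ‖moll n E t - E t‖) + ∫ t, ‖moll n B t - B t‖ := by positivity
  simp only [mollErr]
  refine mul_le_mul_of_nonneg_left ?_ hK.le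
  linarith

omit [CompleteSpace X] in
lemma integrableOn_sourcePower (H : IsTimeWeakSystem G P R T f g E₀ B₀ E B)
    {s : Set ℝ} (hs : MeasurableSet s) {v w : ℝ → X}
    (hv : AEStronglyMeasurable v (volume.restrict s))
    (hw : AEStronglyMeasurable w (volume.restrict s)) {M : ℝ} (hM : ∀ t ∈ s, ‖v t‖ + ‖w t‖ ≤ M) :
    IntegrableOn (fun t => sourcePower R (f t) (g t) (v t) (w t)) s := by
  have hfg : IntegrableOn (fun t => (1 + ‖R‖) * M * (‖f t‖ + ‖g t‖)) s :=
    ((H.integrable_f.norm.add H.integrable_g.norm).const_mul _).integrableOn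
  refine hfg.mono' ?_ ((ae_restrict_iff' hs).2 (.of_forall fun t ht => ?_))
  · exact (continuous_sourcePower R).comp_aestronglyMeasurable
      ((H.integrable_f.1.restrict.prodMk H.integrable_g.1.restrict).prodMk (hv.prodMk hw))
  · refine (abs_sourcePower_le R _ _ _ _).trans ?_
    gcongr
    exact hM t ht

omit [CompleteSpace X] in
lemma sourcePower_sub_sourcePower (R : X →L[ℂ] X) (f g E B f' g' E' B' : X) :
    sourcePower R f' g' E' B' - sourcePower R f g E B =
      sourcePower R (f' - f) (g' - g) E' B' + sourcePower R f g (E' - E) (B' - B) := by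
  simp only [sourcePower, map_sub, inner_sub_left, inner_sub_right, Complex.sub_re]
  ring

/-- The energy balance for time-weak solutions. -/
lemma integral_sourcePower_contRep (H : IsTimeWeakSystem G P R T f g E₀ B₀ E B) (hT : 0 < T)
    (hP : IsCoerciveSymm P) (hR : IsCoerciveSymm R) (hG : IsSymmGraph G) {t : ℝ}
    (ht : t ∈ Ico 0 T) :
    ∫ r in (0 : ℝ)..t, 2 * sourcePower R (f r) (g r) (contRep E r) (contRep B r) =
      quadForm P R (contRep E t) (contRep B t) - quadForm P R (contRep E 0) (contRep B 0) := by
  obtain ⟨M, hM⟩ := H.exists_contRep_bound hT hP hR hG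
  obtain ⟨K, hK, hev⟩ := H.exists_uniform_bound_contRep hP hR hG (b := (t + T) / 2)
    (by linarith [ht.1]) (by linarith [ht.2])
  obtain ⟨hcE, hcB⟩ := H.continuousOn_contRep hP hR hG
  obtain ⟨hE0, hB0⟩ := H.tendsto_contRep hP hR hG (t := 0) ⟨le_rfl, hT⟩
  obtain ⟨hE, hB⟩ := H.tendsto_contRep hP hR hG ht
  have hsub : Ioc 0 t ⊆ Ico 0 T := fun r hr => ⟨hr.1.le, hr.2.trans_lt ht.2⟩
  have hlim1 := ((continuous_quadForm P R).tendsto (contRep E t, contRep B t)).comp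
    (hE.prodMk_nhds hB)
  have hlim2 := ((continuous_quadForm P R).tendsto (contRep E 0, contRep B 0)).comp
    (hE0.prodMk_nhds hB0)
  have hlim := hlim1.sub hlim2
  refine tendsto_nhds_unique ?_ hlim
  set C := 1 + ‖R‖
  have hC : 0 ≤ C := by positivity
  set L := (∫ r, ‖f r‖) + ∫ r, ‖g r‖
  -- The error in the power splits by bilinearity into the error of the sources, paired with the
  -- bounded fields `moll n E` and `moll n B`, and the exact `L¹` sources, paired with a uniformly
  -- small error of the fields. Both tend to zero.
  have hb0 : Tendsto (fun n => 2 * (C * (M + K * mollErr f g E B n) * mollErr f g E B n +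
      C * (K * mollErr f g E B n) * L)) atTop (𝓝 0) := by
    have h := H.tendsto_mollErr
    have h2 := (((((h.const_mul K).const_add M).const_mul C).mul h).add
      (((h.const_mul K).const_mul C).mul_const L)).const_mul 2
    simpa using h2
  rw [tendsto_iff_norm_sub_tendsto_zero]
  refine squeeze_zero' (.of_forall fun n => norm_nonneg _) ?_ hb0
  filter_upwards [hev, H.eventually_integrable,
    tendsto_mollWidth.eventually_lt_const (u := (T - t) / 2) (by linarith [ht.2])] with n hn hi hw
  obtain ⟨⟨hfn, hgn⟩, -, -⟩ := hi
  have hsol := H.isClassicalSolution_moll (n := n) (b := t) (by linarith)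
  have hq := hsol.quadForm_sub hP hR hG (s := 0) (t := t) ⟨le_rfl, ht.1⟩ ⟨ht.1, le_rfl⟩
  simp only [Function.comp_apply]
  rw [← hq, norm_sub_rev, intervalIntegral.integral_const_mul, intervalIntegral.integral_const_mul,
    ← mul_sub, norm_mul, Real.norm_ofNat]
  have hi1 : IntegrableOn (fun r => sourcePower R (f r) (g r) (contRep E r) (contRep B r))
      (Ioc 0 t) :=
    H.integrableOn_sourcePower measurableSet_Ioc
      ((hcE.mono hsub).aestronglyMeasurable measurableSet_Ioc)
      ((hcB.mono hsub).aestronglyMeasurable measurableSet_Ioc) fun r hr => hM r (hsub hr)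
  have hi2 : IntegrableOn (fun r => sourcePower R (moll n f r) (moll n g r) (moll n E r)
      (moll n B r)) (Ioc 0 t) :=
    (hsol.continuousOn_sourcePower.integrableOn_Icc).mono_set Ioc_subset_Icc_self
  rw [intervalIntegral.integral_of_le ht.1, intervalIntegral.integral_of_le ht.1, norm_sub_rev,
    ← integral_sub hi2 hi1]
  gcongr
  set e := mollErr f g E B n
  have he : 0 ≤ e := mollErr_nonneg n
  have hM0 : 0 ≤ M := le_trans (by positivity) (hM 0 ⟨le_rfl, hT⟩)
  have hdom : Integrable fun r => C * (M + K * e) * (‖moll n f r - f r‖ + ‖moll n g r - g r‖) +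
      C * (K * e) * (‖f r‖ + ‖g r‖) :=
    ((hfn.norm.add hgn.norm).const_mul _).add
      ((H.integrable_f.norm.add H.integrable_g.norm).const_mul _)
  have hpt : ∀ r ∈ Ioc 0 t, ‖sourcePower R (moll n f r) (moll n g r) (moll n E r) (moll n B r) -
      sourcePower R (f r) (g r) (contRep E r) (contRep B r)‖ ≤
      C * (M + K * e) * (‖moll n f r - f r‖ + ‖moll n g r - g r‖) +
        C * (K * e) * (‖f r‖ + ‖g r‖) := by
    intro r hr
    have h1 := hn r ⟨hr.1.le, by linarith [hr.2, ht.2]⟩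
    have h2 := hM r (hsub hr)
    have h3 : ‖moll n E r‖ + ‖moll n B r‖ ≤ M + K * e := by
      have h4 := norm_add_le (contRep E r) (moll n E r - contRep E r)
      have h5 := norm_add_le (contRep B r) (moll n B r - contRep B r)
      simp only [add_sub_cancel] at h4 h5
      linarith
    rw [sourcePower_sub_sourcePower]
    refine (norm_add_le _ _).trans (add_le_add ?_ ?_)
    · refine (abs_sourcePower_le R _ _ _ _).trans ?_
      gcongr
    · refine (abs_sourcePower_le R _ _ _ _).trans ?_
      gcongr
  refine (norm_integral_le_of_norm_le hdom.integrableOn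
    ((ae_restrict_iff' measurableSet_Ioc).2 (.of_forall hpt))).trans ?_
  refine (setIntegral_le_integral hdom (.of_forall fun r => ?_)).trans ?_
  · simp only [Pi.zero_apply]
    positivity
  have hd1 : Integrable fun r => ‖moll n f r - f r‖ + ‖moll n g r - g r‖ := hfn.norm.add hgn.norm
  have hd2 : Integrable fun r => ‖f r‖ + ‖g r‖ := H.integrable_f.norm.add H.integrable_g.norm
  rw [integral_add (hd1.const_mul _) (hd2.const_mul _), integral_const_mul,
    integral_const_mul, integral_add hfn.norm hgn.norm,
    integral_add H.integrable_f.norm H.integrable_g.norm]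
  gcongr
  simp only [e, mollErr]
  have h4 : 0 ≤ (∫ t, ‖moll n E t - E t‖) + ∫ t, ‖moll n B t - B t‖ := by positivity
  linarith

end IsTimeWeakSystem

end Regularity

/-! ### Existence of square integrable solutions by duality -/

section Existence

open Filter Topology

/-- A linear functional that is bounded by the images under two linear maps into a Hilbert space
is represented by a pair of vectors. -/
lemma exists_inner_representation {V Y : Type*} [AddCommGroup V] [Module ℂ V]
    [NormedAddCommGroup Y] [InnerProductSpace ℂ Y] [CompleteSpace Y] (T₁ T₂ : V →ₗ[ℂ] Y)
    (l : V →ₗ[ℂ] ℂ) {C : ℝ} (h : ∀ v, ‖l v‖ ≤ C * (‖T₁ v‖ + ‖T₂ v‖)) :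
    ∃ u₁ u₂ : Y, ∀ v, l v = inner ℂ u₁ (T₁ v) + inner ℂ u₂ (T₂ v) := by
  -- The product carries the maximum norm, hence the factor 2; the absolute value is needed because
  -- no sign of `C` is assumed.
  have hC : ∀ v, ‖l v‖ ≤ (2 * |C|) * ‖T₁.prod T₂ v‖ := fun v => by
    have h1 : ‖T₁ v‖ ≤ ‖T₁.prod T₂ v‖ := norm_fst_le (T₁.prod T₂ v)
    have h2 : ‖T₂ v‖ ≤ ‖T₁.prod T₂ v‖ := norm_snd_le (T₁.prod T₂ v)
    have h3 : C * (‖T₁ v‖ + ‖T₂ v‖) ≤ |C| * (‖T₁ v‖ + ‖T₂ v‖) := by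
      gcongr
      exact le_abs_self C
    nlinarith [h v, abs_nonneg C]
  have hker : LinearMap.ker (T₁.prod T₂) ≤ LinearMap.ker l := fun v hv => by
    rw [LinearMap.mem_ker] at hv ⊢
    have h1 := hC v
    rw [hv, norm_zero, mul_zero] at h1
    exact norm_le_zero_iff.1 h1
  let F : LinearMap.range (T₁.prod T₂) →ₗ[ℂ] ℂ :=
    (LinearMap.ker (T₁.prod T₂)).liftQ l hker ∘ₗ (T₁.prod T₂).quotKerEquivRange.symm.toLinearMap
  have hF : ∀ v, F ((T₁.prod T₂).rangeRestrict v) = l v := fun v => by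
    have h1 : (T₁.prod T₂).quotKerEquivRange.symm ((T₁.prod T₂).rangeRestrict v) =
        (LinearMap.ker (T₁.prod T₂)).mkQ v := by
      rw [LinearEquiv.symm_apply_eq]
      rfl
    simp only [F, LinearMap.comp_apply, LinearEquiv.coe_coe]
    rw [h1]
    rfl
  let Fc : LinearMap.range (T₁.prod T₂) →L[ℂ] ℂ := F.mkContinuous (2 * |C|) (by
    rintro ⟨_, v, rfl⟩
    have h1 := hF v
    change ‖F ((T₁.prod T₂).rangeRestrict v)‖ ≤ _
    rw [h1]
    exact hC v)
  -- `Y × Y` with the maximum norm is not a Hilbert space, so the functional is extended by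
  -- Hahn-Banach, and Riesz is applied to the restrictions to the two factors.
  obtain ⟨L, hL, -⟩ := exists_extension_norm_eq _ Fc
  refine ⟨(InnerProductSpace.toDual ℂ Y).symm (L ∘L ContinuousLinearMap.inl ℂ Y Y),
    (InnerProductSpace.toDual ℂ Y).symm (L ∘L ContinuousLinearMap.inr ℂ Y Y), fun v => ?_⟩
  rw [InnerProductSpace.toDual_symm_apply, InnerProductSpace.toDual_symm_apply]
  simp only [ContinuousLinearMap.comp_apply, ContinuousLinearMap.inl_apply,
    ContinuousLinearMap.inr_apply]
  rw [← map_add, ← hF v]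
  have h1 := hL ((T₁.prod T₂).rangeRestrict v)
  simp only [Prod.mk_add_mk, add_zero, zero_add]
  exact h1.symm

variable {X : Type*} [NormedAddCommGroup X] [InnerProductSpace ℂ X]

/-- Test curves: continuously differentiable curves in the domain of a graph, together with their
derivatives and images, which vanish for `t ≥ T`. -/
structure IsTestCurve (G : Submodule ℂ (X × X)) (T : ℝ) (Φ Φ' C : ℝ → X) : Prop where
  hasDerivAt : ∀ t, HasDerivAt Φ (Φ' t) t
  continuous_deriv : Continuous Φ'
  continuous_image : Continuous C
  mem : ∀ t, (Φ t, C t) ∈ G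
  zero : ∀ t, T ≤ t → Φ t = 0

lemma IsTestCurve.continuous {G : Submodule ℂ (X × X)} {T : ℝ} {Φ Φ' C : ℝ → X}
    (h : IsTestCurve G T Φ Φ' C) : Continuous Φ :=
  continuous_iff_continuousAt.2 fun t => (h.hasDerivAt t).continuousAt

/-- The space of test curves. -/
def testCurves (G : Submodule ℂ (X × X)) (T : ℝ) :
    Submodule ℂ (C(ℝ, X) × C(ℝ, X) × C(ℝ, X)) where
  carrier := {p | IsTestCurve G T p.1 p.2.1 p.2.2}
  add_mem' {p q} hp hq :=
    ⟨fun t => (hp.hasDerivAt t).add (hq.hasDerivAt t),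
      hp.continuous_deriv.add hq.continuous_deriv, hp.continuous_image.add hq.continuous_image,
      fun t => G.add_mem (hp.mem t) (hq.mem t),
      fun t ht => by
        change p.1 t + q.1 t = 0
        rw [hp.zero t ht, hq.zero t ht, add_zero]⟩
  zero_mem' := ⟨fun t => hasDerivAt_const t 0, continuous_const, continuous_const,
    fun _ => G.zero_mem, fun _ _ => rfl⟩
  smul_mem' c p hp :=
    ⟨fun t => (hp.hasDerivAt t).const_smul c,
      hp.continuous_deriv.const_smul c, hp.continuous_image.const_smul c,
      fun t => G.smul_mem c (hp.mem t),
      fun t ht => by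
        change c • p.1 t = 0
        rw [hp.zero t ht, smul_zero]⟩

omit [InnerProductSpace ℂ X] in
lemma exists_bound_Ioo (T : ℝ) (F : C(ℝ, X)) : ∃ M : ℝ, ∀ t ∈ Ioo 0 T, ‖F t‖ ≤ M := by
  obtain ⟨M, hM⟩ := isCompact_Icc.exists_bound_of_continuousOn
    (F.continuous.continuousOn (s := Icc 0 T))
  exact ⟨M, fun t ht => hM t (Ioo_subset_Icc_self ht)⟩

omit [InnerProductSpace ℂ X] in
lemma memLp_Ioo (T : ℝ) (p : ℝ≥0∞) (F : C(ℝ, X)) :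
    MemLp F p ((volume : Measure ℝ).restrict (Ioo 0 T)) := by
  obtain ⟨M, hM⟩ := exists_bound_Ioo T F
  exact MemLp.of_bound F.continuous.aestronglyMeasurable M
    ((ae_restrict_iff' measurableSet_Ioo).2 (.of_forall hM))

/-- Restriction of continuous curves to elements of `L²(0, T; X)`. -/
def curveToL2 (T : ℝ) : C(ℝ, X) →ₗ[ℂ] Lp X 2 ((volume : Measure ℝ).restrict (Ioo 0 T)) where
  toFun F := (memLp_Ioo T 2 F).toLp F
  map_add' F H := MemLp.toLp_add (memLp_Ioo T 2 F) (memLp_Ioo T 2 H)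
  map_smul' c F := MemLp.toLp_const_smul c (memLp_Ioo T 2 F)

lemma integrableOn_inner_curve {T : ℝ} {f : ℝ → X} (hf : IntegrableOn f (Ioo 0 T)) (F : C(ℝ, X)) :
    IntegrableOn (fun t => inner ℂ (f t) (F t)) (Ioo 0 T) := by
  obtain ⟨M, hM⟩ := exists_bound_Ioo T F
  refine (hf.norm.mul_const M).mono' (hf.1.inner F.continuous.aestronglyMeasurable)
    ((ae_restrict_iff' measurableSet_Ioo).2 (.of_forall fun t ht => ?_))
  refine (norm_inner_le_norm _ _).trans ?_
  gcongr
  exact hM t ht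

/-- The functional of the data `f`, `w₀`. -/
def dataFunctional (T : ℝ) {f : ℝ → X} (hf : IntegrableOn f (Ioo 0 T)) (w₀ : X) :
    C(ℝ, X) →ₗ[ℂ] ℂ where
  toFun F := (∫ t in Ioo 0 T, inner ℂ (f t) (F t)) + inner ℂ w₀ (F 0)
  map_add' F H := by
    simp only [ContinuousMap.add_apply, inner_add_right]
    rw [integral_add (integrableOn_inner_curve hf F) (integrableOn_inner_curve hf H)]
    ring
  map_smul' c F := by
    simp only [ContinuousMap.smul_apply, inner_smul_right, integral_const_mul, smul_eq_mul,
      RingHom.id_apply]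
    ring

lemma norm_dataFunctional_le {T : ℝ} (hT : 0 < T) {f : ℝ → X} (hf : IntegrableOn f (Ioo 0 T))
    (w₀ : X) {F : C(ℝ, X)} {M : ℝ} (hM : ∀ t ∈ Icc 0 T, ‖F t‖ ≤ M) :
    ‖dataFunctional T hf w₀ F‖ ≤ ((∫ t in Ioo 0 T, ‖f t‖) + ‖w₀‖) * M := by
  rw [add_mul]
  refine (norm_add_le _ _).trans (add_le_add ?_ ?_)
  · rw [← integral_mul_const]
    refine norm_integral_le_of_norm_le (hf.norm.mul_const M)
      ((ae_restrict_iff' measurableSet_Ioo).2 (.of_forall fun t ht => ?_))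
    refine (norm_inner_le_norm _ _).trans ?_
    gcongr
    exact hM t (Ioo_subset_Icc_self ht)
  · refine (norm_inner_le_norm _ _).trans ?_
    gcongr
    exact hM 0 ⟨le_rfl, hT.le⟩

/-- Hölder's inequality gives the factor `√T`, which is at most `1 + T`. Passing from `L¹` to `L²`
in time gives up sharpness, so that Riesz' theorem in a Hilbert space suffices. -/
lemma integral_norm_le_norm_curveToL2 (T : ℝ) (hT : 0 < T) (F : C(ℝ, X)) :
    ∫ t in (0 : ℝ)..T, ‖F t‖ ≤ (1 + T) * ‖curveToL2 T F‖ := by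
  have h1 := memLp_Ioo T 1 F
  have h2 := memLp_Ioo T 2 F
  have h3 : eLpNorm F 1 ((volume : Measure ℝ).restrict (Ioo 0 T)) ≤
      eLpNorm F 2 (volume.restrict (Ioo 0 T)) *
        (volume.restrict (Ioo 0 T)) univ ^ (1 / (1 : ℝ≥0∞).toReal - 1 / (2 : ℝ≥0∞).toReal) :=
    eLpNorm_le_eLpNorm_mul_rpow_measure_univ (by norm_num) h2.1
  have h4 : ∫ t in (0 : ℝ)..T, ‖F t‖ =
      (eLpNorm F 1 ((volume : Measure ℝ).restrict (Ioo 0 T))).toReal := by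
    rw [intervalIntegral.integral_of_le hT.le, integral_Ioc_eq_integral_Ioo,
      eLpNorm_one_eq_lintegral_enorm, integral_norm_eq_lintegral_enorm h1.1]
  have h5 : ‖curveToL2 T F‖ = (eLpNorm F 2 (volume.restrict (Ioo 0 T))).toReal :=
    Lp.norm_toLp F h2
  have h6 : (volume.restrict (Ioo 0 T)) univ ^ (1 / (1 : ℝ≥0∞).toReal - 1 / (2 : ℝ≥0∞).toReal) =
      ENNReal.ofReal (T ^ (1 / 2 : ℝ)) := by
    rw [Measure.restrict_apply_univ, Real.volume_Ioo, sub_zero,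
      ENNReal.ofReal_rpow_of_pos hT]
    norm_num
  have h7 : T ^ (1 / 2 : ℝ) ≤ 1 + T := by
    rw [← Real.sqrt_eq_rpow, Real.sqrt_le_iff]
    constructor <;> nlinarith
  rw [h6] at h3
  have h8 := ENNReal.toReal_mono (ENNReal.mul_ne_top h2.2.ne ENNReal.ofReal_ne_top) h3
  rw [ENNReal.toReal_mul, ENNReal.toReal_ofReal (by positivity), ← h4, ← h5] at h8
  refine h8.trans ?_
  rw [mul_comm]
  gcongr

lemma inner_curveToL2 {T : ℝ} (u : Lp X 2 ((volume : Measure ℝ).restrict (Ioo 0 T)))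
    (F : C(ℝ, X)) : inner ℂ u (curveToL2 T F) = ∫ t in Ioo 0 T, inner ℂ (u t) (F t) := by
  rw [L2.inner_def]
  exact integral_congr_ae ((memLp_Ioo T 2 F).coeFn_toLp.mono fun t ht => by
    simp only
    rw [curveToL2, LinearMap.coe_mk, AddHom.coe_mk, ht])

/-- `(E, B)` is a weak solution with respect to all test curves. -/
structure IsCurveWeakSolution (G : Submodule ℂ (X × X)) (P R : X →L[ℂ] X) (T : ℝ)
    (f g : ℝ → X) (E₀ B₀ : X) (E B : ℝ → X) : Prop where
  faraday : ∀ Φ Φ' C, IsTestCurve G T Φ Φ' C →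
    ∫ t in Ioo 0 T, (-inner ℂ (Φ' t) (B t) + inner ℂ (C t) (E t)) =
      (∫ t in Ioo 0 T, inner ℂ (Φ t) (f t)) + inner ℂ (Φ 0) B₀
  ampere : ∀ Φ Φ' C, IsTestCurve G T Φ Φ' C →
    ∫ t in Ioo 0 T, (-inner ℂ (Φ' t) (P (E t)) - inner ℂ (C t) (R (B t))) =
      (∫ t in Ioo 0 T, inner ℂ (Φ t) (g t)) + inner ℂ (Φ 0) (P E₀)

/-- Existence of square integrable weak solutions. -/
theorem exists_isCurveWeakSolution [CompleteSpace X] {G : Submodule ℂ (X × X)}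
    {P Q R : X →L[ℂ] X} (hP : IsCoerciveSymm P) (hR : IsCoerciveSymm R) (hG : IsSymmGraph G)
    (hQR : ∀ x, Q (R x) = x) (hRQ : ∀ x, R (Q x) = x) {T : ℝ} (hT : 0 < T) {f g : ℝ → X}
    (hf : IntegrableOn f (Ioo 0 T)) (hg : IntegrableOn g (Ioo 0 T)) (E₀ B₀ : X) :
    ∃ E B : Lp X 2 ((volume : Measure ℝ).restrict (Ioo 0 T)),
      IsCurveWeakSolution G P R T f g E₀ B₀ E B := by
  obtain ⟨K, hK, hap⟩ := exists_apriori_bound hP hR hG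
  let V := testCurves G T × testCurves G T
  let φ : V →ₗ[ℂ] C(ℝ, X) × C(ℝ, X) × C(ℝ, X) :=
    (testCurves G T).subtype ∘ₗ LinearMap.fst ℂ _ _
  let ψ : V →ₗ[ℂ] C(ℝ, X) × C(ℝ, X) × C(ℝ, X) :=
    (testCurves G T).subtype ∘ₗ LinearMap.snd ℂ _ _
  let π₀ : C(ℝ, X) × C(ℝ, X) × C(ℝ, X) →ₗ[ℂ] C(ℝ, X) := LinearMap.fst ℂ _ _
  let π₁ : C(ℝ, X) × C(ℝ, X) × C(ℝ, X) →ₗ[ℂ] C(ℝ, X) := LinearMap.fst ℂ _ _ ∘ₗ LinearMap.snd ℂ _ _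
  let π₂ : C(ℝ, X) × C(ℝ, X) × C(ℝ, X) →ₗ[ℂ] C(ℝ, X) := LinearMap.snd ℂ _ _ ∘ₗ LinearMap.snd ℂ _ _
  let Pc : C(ℝ, X) →ₗ[ℂ] C(ℝ, X) := (P.compLeftContinuous ℂ ℝ).toLinearMap
  let Rc : C(ℝ, X) →ₗ[ℂ] C(ℝ, X) := (R.compLeftContinuous ℂ ℝ).toLinearMap
  let a : V →ₗ[ℂ] C(ℝ, X) := π₂ ∘ₗ φ - Pc ∘ₗ π₁ ∘ₗ ψ
  -- The pair `(a, b)` is the adjoint operator on `(Φ, Ψ)`: adding Faraday's equation tested with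
  -- `Φ` and Ampère's tested with `Ψ` pairs `E` with `a` and `B` with `b`, once `P` and `R` are
  -- moved by symmetry.
  let b : V →ₗ[ℂ] C(ℝ, X) := -(π₁ ∘ₗ φ) - Rc ∘ₗ π₂ ∘ₗ ψ
  let l : V →ₗ[ℂ] ℂ := dataFunctional T hf B₀ ∘ₗ π₀ ∘ₗ φ + dataFunctional T hg (P E₀) ∘ₗ π₀ ∘ₗ ψ
  set Df := (∫ t in Ioo 0 T, ‖f t‖) + ‖B₀‖
  set Dg := (∫ t in Ioo 0 T, ‖g t‖) + ‖P E₀‖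
  have hDf : 0 ≤ Df := by positivity
  have hDg : 0 ≤ Dg := by positivity
  have hl : ∀ v, ‖l v‖ ≤ ((Df * ‖R‖ + Dg) * (K * ((1 + ‖Q‖) * (1 + T)))) *
      (‖(curveToL2 T ∘ₗ a) v‖ + ‖(curveToL2 T ∘ₗ b) v‖) := by
    rintro ⟨⟨⟨Φ, Φ', C⟩, hΦ⟩, ⟨⟨Ψ, Ψ', D⟩, hΨ⟩⟩
    have hΦ : IsTestCurve G T Φ Φ' C := hΦ
    have hΨ : IsTestCurve G T Ψ Ψ' D := hΨ
    set v : V := ⟨⟨⟨Φ, Φ', C⟩, hΦ⟩, ⟨⟨Ψ, Ψ', D⟩, hΨ⟩⟩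
    have ha : ∀ t, a v t = C t - P (Ψ' t) := fun t => rfl
    have hb : ∀ t, b v t = -Φ' t - R (D t) := fun t => rfl
    -- A test pair is itself a classical solution, with `Ψ` as electric field, `Q Φ` as magnetic
    -- field and `a`, `b` in the sources. Both components vanish at `T`, so the a priori bound with
    -- reference time `T` has no contribution from data.
    have hsol : IsClassicalSolution G P R 0 T Ψ (fun t => Q (Φ t)) (fun t => -Q (b v t))
        (fun t => -a v t) := by
      refine ⟨fun t _ => ⟨_, _, hΨ.hasDerivAt t,
        (Q.restrictScalars ℝ).hasFDerivAt.comp_hasDerivAt t (hΦ.hasDerivAt t), ?_, ?_⟩, ?_, ?_⟩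
      · convert hΨ.mem t using 2
        change -Q (b v t) - Q (Φ' t) = D t
        rw [hb, map_sub, map_neg, hQR]
        abel
      · convert hΦ.mem t using 2
        · exact hRQ _
        · rw [ha]
          abel
      · exact (Q.continuous.comp (b v).continuous).neg.continuousOn
      · exact (a v).continuous.neg.continuousOn
    have hbound := hap 0 T _ _ _ _ hsol T ⟨hT.le, le_rfl⟩
    simp only [hΦ.zero T le_rfl, hΨ.zero T le_rfl, map_zero, norm_zero, zero_add,
      norm_neg] at hbound
    set S := ‖(curveToL2 T ∘ₗ a) v‖ + ‖(curveToL2 T ∘ₗ b) v‖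
    have hS : ∫ r in (0 : ℝ)..T, (‖Q (b v r)‖ + ‖a v r‖) ≤ (1 + ‖Q‖) * (1 + T) * S := by
      have hia : IntervalIntegrable (fun r => ‖a v r‖) volume 0 T :=
        (a v).continuous.norm.intervalIntegrable _ _
      have hib : IntervalIntegrable (fun r => ‖b v r‖) volume 0 T :=
        (b v).continuous.norm.intervalIntegrable _ _
      have hiQ : IntervalIntegrable (fun r => ‖Q (b v r)‖) volume 0 T :=
        (Q.continuous.comp (b v).continuous).norm.intervalIntegrable _ _
      have h1 := integral_norm_le_norm_curveToL2 T hT (a v)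
      have h2 := integral_norm_le_norm_curveToL2 T hT (b v)
      have h3 : ∫ r in (0 : ℝ)..T, ‖Q (b v r)‖ ≤ ‖Q‖ * ∫ r in (0 : ℝ)..T, ‖b v r‖ := by
        rw [← intervalIntegral.integral_const_mul]
        exact intervalIntegral.integral_mono_on hT.le hiQ (hib.const_mul _)
          fun r _ => Q.le_opNorm _
      rw [intervalIntegral.integral_add hiQ hia]
      have h4 : ‖Q‖ * ∫ r in (0 : ℝ)..T, ‖b v r‖ ≤ ‖Q‖ * ((1 + T) * ‖curveToL2 T (b v)‖) := by
        gcongr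
      have h5 : 0 ≤ (1 + T) * ‖curveToL2 T (b v)‖ := by positivity
      have h6 : 0 ≤ ‖Q‖ * ((1 + T) * ‖curveToL2 T (a v)‖) := by positivity
      simp only [S, LinearMap.comp_apply]
      nlinarith
    have hKS : ∀ t ∈ Icc 0 T, ‖Ψ t‖ + ‖Q (Φ t)‖ ≤ K * ((1 + ‖Q‖) * (1 + T)) * S :=
      fun t ht => (hbound t ht).trans (by
        rw [mul_assoc]
        gcongr)
    have hS0 : 0 ≤ K * ((1 + ‖Q‖) * (1 + T)) * S := by positivity
    have h1 := norm_dataFunctional_le hT hf B₀ (F := Φ) (M := ‖R‖ * (K * ((1 + ‖Q‖) * (1 + T)) * S))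
      fun t ht => by
        rw [← hRQ (Φ t)]
        refine (R.le_opNorm _).trans ?_
        gcongr
        linarith [hKS t ht, norm_nonneg (Ψ t)]
    have h2 := norm_dataFunctional_le hT hg (P E₀) (F := Ψ) (M := K * ((1 + ‖Q‖) * (1 + T)) * S)
      fun t ht => by linarith [hKS t ht, norm_nonneg (Q (Φ t))]
    calc ‖l v‖ ≤ ‖dataFunctional T hf B₀ Φ‖ + ‖dataFunctional T hg (P E₀) Ψ‖ := norm_add_le _ _
      _ ≤ Df * (‖R‖ * (K * ((1 + ‖Q‖) * (1 + T)) * S)) +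
          Dg * (K * ((1 + ‖Q‖) * (1 + T)) * S) := add_le_add h1 h2
      _ = _ := by ring
  obtain ⟨E, B, hEB⟩ := exists_inner_representation (curveToL2 T ∘ₗ a) (curveToL2 T ∘ₗ b) l hl
  have hint : ∀ (u : Lp X 2 ((volume : Measure ℝ).restrict (Ioo 0 T))) (F : C(ℝ, X)),
      Integrable (fun t => inner ℂ (F t) (u t)) ((volume : Measure ℝ).restrict (Ioo 0 T)) := by
    intro u F
    refine (L2.integrable_inner (𝕜 := ℂ) (curveToL2 T F) u).congr ?_
    exact (memLp_Ioo T 2 F).coeFn_toLp.mono fun t ht => by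
      simp only
      rw [curveToL2, LinearMap.coe_mk, AddHom.coe_mk, ht]
  -- The representation is linear in the test curve, whereas the weak form has the test curve in the
  -- conjugate-linear slot; conjugating exchanges the two.
  have hconj : ∀ (u : ℝ → X) (F : C(ℝ, X)),
      starRingEnd ℂ (∫ t in Ioo 0 T, inner ℂ (u t) (F t)) =
        ∫ t in Ioo 0 T, inner ℂ (F t) (u t) := by
    intro u F
    rw [← integral_conj]
    simp only [inner_conj_symm]
  -- The test pairs `(Φ, 0)` and `(0, Φ)` decouple the two equations.
  refine ⟨E, B, fun Φ Φ' C h => ?_, fun Φ Φ' C h => ?_⟩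
  · let p : testCurves G T := ⟨⟨⟨Φ, h.continuous⟩, ⟨Φ', h.continuous_deriv⟩,
      ⟨C, h.continuous_image⟩⟩, h⟩
    have h1 := hEB (p, 0)
    have ha : a (p, 0) = ⟨C, h.continuous_image⟩ := ContinuousMap.ext fun t => by
      change C t - P 0 = C t
      rw [map_zero, sub_zero]
    have hb : b (p, 0) = -⟨Φ', h.continuous_deriv⟩ := ContinuousMap.ext fun t => by
      change -Φ' t - R 0 = -Φ' t
      rw [map_zero, sub_zero]
    have hll : l (p, 0) = dataFunctional T hf B₀ ⟨Φ, h.continuous⟩ := by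
      change _ + dataFunctional T hg (P E₀) 0 = _
      rw [map_zero, add_zero]
      rfl
    rw [LinearMap.comp_apply, LinearMap.comp_apply, ha, hb, hll, map_neg, inner_neg_right,
      inner_curveToL2, inner_curveToL2] at h1
    have h2 := congrArg (starRingEnd ℂ) h1
    simp only [dataFunctional, LinearMap.coe_mk, AddHom.coe_mk, map_add, map_neg, hconj,
      inner_conj_symm] at h2
    simp only [ContinuousMap.coe_mk] at h2
    have h3 : IntegrableOn (fun t => -inner ℂ (Φ' t) (B t)) (Ioo 0 T) :=
      (hint B ⟨Φ', h.continuous_deriv⟩).neg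
    have h4 : IntegrableOn (fun t => inner ℂ (C t) (E t)) (Ioo 0 T) :=
      hint E ⟨C, h.continuous_image⟩
    rw [h2, integral_add h3 h4, integral_neg, add_comm]
  · let p : testCurves G T := ⟨⟨⟨Φ, h.continuous⟩, ⟨Φ', h.continuous_deriv⟩,
      ⟨C, h.continuous_image⟩⟩, h⟩
    have h1 := hEB (0, p)
    have ha : a (0, p) = -Pc ⟨Φ', h.continuous_deriv⟩ := ContinuousMap.ext fun t => by
      change 0 - P (Φ' t) = -P (Φ' t)
      rw [zero_sub]
    have hb : b (0, p) = -Rc ⟨C, h.continuous_image⟩ := ContinuousMap.ext fun t => by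
      change -0 - R (C t) = -R (C t)
      rw [neg_zero, zero_sub]
    have hll : l (0, p) = dataFunctional T hg (P E₀) ⟨Φ, h.continuous⟩ := by
      change dataFunctional T hf B₀ 0 + _ = _
      rw [map_zero, zero_add]
      rfl
    rw [LinearMap.comp_apply, LinearMap.comp_apply, ha, hb, hll, map_neg, map_neg, inner_neg_right,
      inner_neg_right, inner_curveToL2, inner_curveToL2] at h1
    have h2 := congrArg (starRingEnd ℂ) h1
    simp only [dataFunctional, LinearMap.coe_mk, AddHom.coe_mk, map_add, map_neg, hconj,
      inner_conj_symm] at h2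
    have h3 := hint E (Pc ⟨Φ', h.continuous_deriv⟩)
    have h4 := hint B (Rc ⟨C, h.continuous_image⟩)
    have hPc : ∀ t, Pc ⟨Φ', h.continuous_deriv⟩ t = P (Φ' t) := fun t => rfl
    have hRc : ∀ t, Rc ⟨C, h.continuous_image⟩ t = R (C t) := fun t => rfl
    simp only [hPc, hRc, hP.symm, hR.symm] at h2 h3 h4
    simp only [ContinuousMap.coe_mk] at h2
    have h5 : IntegrableOn (fun t => -inner ℂ (Φ' t) (P (E t))) (Ioo 0 T) := h3.neg
    rw [h2, integral_sub h5 h4, integral_neg]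
    ring

end Existence

/-! ### Matrix coefficients as operators on `L²` -/

section Multipliers

lemma act_apply (A : Matrix (Fin 3) (Fin 3) ℂ) (ξ : C3) (i : Fin 3) :
    act A ξ i = ∑ j, A i j * ξ j := rfl

lemma act_add (A : Matrix (Fin 3) (Fin 3) ℂ) (ξ η : C3) : act A (ξ + η) = act A ξ + act A η := by
  simp [act, Matrix.mulVec_add]

lemma act_smul (A : Matrix (Fin 3) (Fin 3) ℂ) (c : ℂ) (ξ : C3) : act A (c • ξ) = c • act A ξ := by
  simp [act, Matrix.mulVec_smul]

lemma act_act (A B : Matrix (Fin 3) (Fin 3) ℂ) (ξ : C3) : act A (act B ξ) = act (A * B) ξ := by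
  simp [act, Matrix.mulVec_mulVec]

lemma act_one (ξ : C3) : act 1 ξ = ξ := by simp [act]

lemma inner_act_left {A : Matrix (Fin 3) (Fin 3) ℂ} (hA : A.IsHermitian) (ξ η : C3) :
    inner ℂ (act A ξ) η = inner ℂ ξ (act A η) := by
  rw [EuclideanSpace.inner_eq_star_dotProduct, EuclideanSpace.inner_eq_star_dotProduct, act, act]
  simp only
  rw [Matrix.star_mulVec, hA.eq, dotProduct_comm, ← Matrix.dotProduct_mulVec, dotProduct_comm]

lemma norm_le_sum_norm (v : C3) : ‖v‖ ≤ ∑ i, ‖v i‖ := by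
  rw [EuclideanSpace.norm_eq, Real.sqrt_le_iff]
  refine ⟨by positivity, ?_⟩
  simp only [Fin.sum_univ_three]
  nlinarith [norm_nonneg (v 0), norm_nonneg (v 1), norm_nonneg (v 2),
    mul_nonneg (norm_nonneg (v 0)) (norm_nonneg (v 1)),
    mul_nonneg (norm_nonneg (v 0)) (norm_nonneg (v 2)),
    mul_nonneg (norm_nonneg (v 1)) (norm_nonneg (v 2))]

lemma norm_act_le {A : Matrix (Fin 3) (Fin 3) ℂ} (ξ : C3) :
    ‖act A ξ‖ ≤ (∑ i, ∑ j, ‖A i j‖) * ‖ξ‖ := by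
  refine (norm_le_sum_norm _).trans ?_
  rw [Finset.sum_mul]
  refine Finset.sum_le_sum fun i _ => ?_
  rw [act_apply, Finset.sum_mul]
  refine norm_sum_le_of_le _ fun j _ => ?_
  rw [norm_mul]
  gcongr
  exact PiLp.norm_apply_le ξ j

/-- Measurable matrix fields which act as bounded operators on `L²`. -/
structure IsMultiplier (A : R3 → Matrix (Fin 3) (Fin 3) ℂ) : Prop where
  meas : ∀ i j, AEMeasurable (fun x => A x i j) volume
  bdd : ∃ C : ℝ, 0 < C ∧ ∀ᵐ x, ∀ ξ, ‖act (A x) ξ‖ ≤ C * ‖ξ‖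

lemma IsBoundedCoeff.isMultiplier {A : R3 → Matrix (Fin 3) (Fin 3) ℂ} (hA : IsBoundedCoeff A) :
    IsMultiplier A where
  meas i j := (hA i j).1.aemeasurable
  bdd := by
    have h : ∀ i j, ∃ C : ℝ, 0 ≤ C ∧ ∀ᵐ x, ‖A x i j‖ ≤ C := fun i j => by
      refine ⟨(eLpNormEssSup (fun x => A x i j) volume).toReal, ENNReal.toReal_nonneg, ?_⟩
      have h1 := (hA i j).2
      rw [eLpNorm_exponent_top] at h1
      filter_upwards [ae_le_eLpNormEssSup (f := fun x => A x i j) (μ := volume)] with x hx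
      have h2 := ENNReal.toReal_mono h1.ne hx
      simpa using h2
    choose C hC hAC using h
    refine ⟨(∑ i, ∑ j, C i j) + 1, ?_, ?_⟩
    · have : 0 ≤ ∑ i, ∑ j, C i j := Finset.sum_nonneg fun i _ => Finset.sum_nonneg fun j _ => hC i j
      linarith
    · filter_upwards [ae_all_iff.2 fun i => ae_all_iff.2 (hAC i)] with x hx ξ
      refine (norm_act_le ξ).trans ?_
      gcongr
      have : ∑ i, ∑ j, ‖A x i j‖ ≤ ∑ i, ∑ j, C i j :=
        Finset.sum_le_sum fun i _ => Finset.sum_le_sum fun j _ => hx i j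
      linarith

namespace IsMultiplier

variable {A : R3 → Matrix (Fin 3) (Fin 3) ℂ}

lemma aestronglyMeasurable_act (hA : IsMultiplier A) {u : R3 → C3}
    (hu : AEStronglyMeasurable u volume) :
    AEStronglyMeasurable (fun x => act (A x) (u x)) volume := by
  have h1 : ∀ j, AEMeasurable (fun x => u x j) volume := fun j =>
    ((PiLp.continuous_apply 2 _ j).comp_aestronglyMeasurable hu).aemeasurable
  have h2 : AEMeasurable (fun x i => ∑ j, A x i j * u x j) volume :=
    aemeasurable_pi_lambda _ fun i => Finset.aemeasurable_fun_sum _ fun j _ =>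
      (hA.meas i j).mul (h1 j)
  exact (PiLp.continuous_toLp 2 _).comp_aestronglyMeasurable h2.aestronglyMeasurable

lemma memLp_act (hA : IsMultiplier A) (u : L2) : MemLp (fun x => act (A x) (u x)) 2 volume := by
  obtain ⟨C, -, hC⟩ := hA.bdd
  exact (Lp.memLp u).of_le_mul (hA.aestronglyMeasurable_act (Lp.memLp u).1)
    (hC.mono fun x hx => hx (u x))

/-- The multiplication operator of a bounded matrix field on `L²`. -/
def op (hA : IsMultiplier A) : L2 →L[ℂ] L2 :=
  LinearMap.mkContinuousOfExistsBound
    { toFun := fun u => (hA.memLp_act u).toLp _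
      map_add' := fun u v => by
        rw [← MemLp.toLp_add, MemLp.toLp_eq_toLp_iff]
        filter_upwards [Lp.coeFn_add u v] with x hx
        rw [hx, Pi.add_apply, act_add]
        rfl
      map_smul' := fun c u => by
        rw [RingHom.id_apply, ← MemLp.toLp_const_smul, MemLp.toLp_eq_toLp_iff]
        filter_upwards [Lp.coeFn_smul c u] with x hx
        rw [hx, Pi.smul_apply, act_smul]
        rfl } (by
    obtain ⟨C, -, hC⟩ := hA.bdd
    refine ⟨C, fun u => Lp.norm_le_mul_norm_of_ae_le_mul ?_⟩
    filter_upwards [hC, (hA.memLp_act u).coeFn_toLp] with x hx hx'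
    simp only [LinearMap.coe_mk, AddHom.coe_mk]
    rw [hx']
    exact hx (u x))

lemma coeFn_op (hA : IsMultiplier A) (u : L2) : hA.op u =ᵐ[volume] fun x => act (A x) (u x) :=
  (hA.memLp_act u).coeFn_toLp

lemma inner_op_right (hA : IsMultiplier A) (u v : L2) :
    inner ℂ u (hA.op v) = ∫ x, inner ℂ (u x) (act (A x) (v x)) := by
  rw [L2.inner_def]
  exact integral_congr_ae ((hA.coeFn_op v).mono fun x hx => by simp only [hx])

lemma inner_op_left (hA : IsMultiplier A) (u v : L2) :
    inner ℂ (hA.op u) v = ∫ x, inner ℂ (act (A x) (u x)) (v x) := by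
  rw [L2.inner_def]
  exact integral_congr_ae ((hA.coeFn_op u).mono fun x hx => by simp only [hx])

lemma integrable_inner_act (hA : IsMultiplier A) (u v : L2) :
    Integrable (fun x => inner ℂ (u x) (act (A x) (v x))) := by
  refine (L2.integrable_inner (𝕜 := ℂ) u (hA.op v)).congr ?_
  exact (hA.coeFn_op v).mono fun x hx => by simp only [hx]

lemma op_op (hA : IsMultiplier A) {B : R3 → Matrix (Fin 3) (Fin 3) ℂ} (hB : IsMultiplier B)
    (h : ∀ᵐ x, A x * B x = 1) (u : L2) : hA.op (hB.op u) = u := by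
  refine Lp.ext ?_
  filter_upwards [hA.coeFn_op (hB.op u), hB.coeFn_op u, h] with x h1 h2 h3
  rw [h1, h2, act_act, h3, act_one]

lemma isCoerciveSymm_op (hA : IsMultiplier A) (hh : ∀ᵐ x, (A x).IsHermitian) {c : ℝ} (hc : 0 < c)
    (hlow : ∀ᵐ x, ∀ ξ : C3, c * ‖ξ‖ ^ 2 ≤ (inner ℂ ξ (act (A x) ξ)).re) :
    IsCoerciveSymm hA.op where
  symm u v := by
    rw [hA.inner_op_left, hA.inner_op_right]
    exact integral_congr_ae (hh.mono fun x hx => inner_act_left hx _ _)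
  lower := by
    refine ⟨c, hc, fun u => ?_⟩
    have h1 : (inner ℂ u u).re = ‖u‖ ^ 2 := by
      rw [inner_self_eq_norm_sq_to_K]
      norm_cast
    have hre : ∀ {F : R3 → ℂ}, Integrable F → (∫ x, F x).re = ∫ x, (F x).re := fun hF =>
      (integral_re hF).symm
    rw [hA.inner_op_right, hre (hA.integrable_inner_act u u), ← h1, L2.inner_def,
      hre (L2.integrable_inner u u), ← integral_const_mul]
    refine integral_mono_ae ((L2.integrable_inner (𝕜 := ℂ) u u).re.const_mul c)
      (hA.integrable_inner_act u u).re (hlow.mono fun x hx => ?_)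
    have h2 : (inner ℂ (u x) (u x)).re = ‖u x‖ ^ 2 := by
      rw [inner_self_eq_norm_sq_to_K]
      norm_cast
    simp only
    rw [h2]
    exact hx (u x)

end IsMultiplier

section Inverse

variable {A : Matrix (Fin 3) (Fin 3) ℂ} {α : ℝ}

lemma isUnit_det_of_lower (hα : 0 < α) (h : ∀ ξ : C3, α * ‖ξ‖ ^ 2 ≤ (inner ℂ ξ (act A ξ)).re) :
    IsUnit A.det := by
  rw [← Matrix.isUnit_iff_isUnit_det, ← Matrix.mulVec_injective_iff_isUnit]
  intro v w hvw
  have h1 := h (WithLp.toLp 2 (v - w))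
  have h2 : act A (WithLp.toLp 2 (v - w)) = 0 := by
    rw [act, Matrix.mulVec_sub, hvw, sub_self, WithLp.toLp_zero]
  rw [h2, inner_zero_right, Complex.zero_re] at h1
  have h3 : ‖(WithLp.toLp 2 (v - w) : C3)‖ ^ 2 = 0 := le_antisymm (by nlinarith) (by positivity)
  have h4 := norm_eq_zero.1 (pow_eq_zero_iff two_ne_zero |>.1 h3)
  rw [WithLp.toLp_eq_zero] at h4
  exact sub_eq_zero.1 h4

/-- Ellipticity at `η = A⁻¹ ξ` and Cauchy-Schwarz give `α ‖η‖² ≤ ‖η‖ ‖ξ‖`. -/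
lemma norm_act_inv_le (hα : 0 < α) (h : ∀ ξ : C3, α * ‖ξ‖ ^ 2 ≤ (inner ℂ ξ (act A ξ)).re) (ξ : C3) :
    ‖act A⁻¹ ξ‖ ≤ α⁻¹ * ‖ξ‖ := by
  have h1 := h (act A⁻¹ ξ)
  rw [act_act, Matrix.mul_nonsing_inv _ (isUnit_det_of_lower hα h), act_one] at h1
  have h2 := (le_abs_self _).trans (abs_re_inner_le (act A⁻¹ ξ) ξ)
  rw [inv_mul_eq_div, le_div_iff₀ hα]
  rcases (norm_nonneg (act A⁻¹ ξ)).eq_or_lt with h0 | h0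
  · rw [← h0]
    simp
  · refine le_of_mul_le_mul_left ?_ h0
    nlinarith

/-- With `η = A⁻¹ ξ` the form equals `⟨Aη, η⟩`, whose real part is at least `α ‖η‖²`, and `‖ξ‖ = ‖A
η‖ ≤ C ‖η‖`. -/
lemma lower_inv (hα : 0 < α) (hA : A.IsHermitian)
    (h : ∀ ξ : C3, α * ‖ξ‖ ^ 2 ≤ (inner ℂ ξ (act A ξ)).re)
    {C : ℝ} (hC : 0 < C) (hAC : ∀ ξ, ‖act A ξ‖ ≤ C * ‖ξ‖) (ξ : C3) :
    α / C ^ 2 * ‖ξ‖ ^ 2 ≤ (inner ℂ ξ (act A⁻¹ ξ)).re := by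
  have h0 : act A (act A⁻¹ ξ) = ξ := by
    rw [act_act, Matrix.mul_nonsing_inv _ (isUnit_det_of_lower hα h), act_one]
  have h1 := h (act A⁻¹ ξ)
  have h2 := hAC (act A⁻¹ ξ)
  rw [← inner_act_left hA, h0] at h1
  rw [h0] at h2
  refine le_trans ?_ h1
  rw [div_mul_eq_mul_div, div_le_iff₀ (by positivity), mul_assoc]
  gcongr
  rw [← mul_pow, mul_comm]
  gcongr

end Inverse

lemma IsMultiplier.inv {A : R3 → Matrix (Fin 3) (Fin 3) ℂ} (hA : IsMultiplier A) {α : ℝ}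
    (hα : 0 < α) (h : ∀ᵐ x, ∀ ξ : C3, α * ‖ξ‖ ^ 2 ≤ (inner ℂ ξ (act (A x) ξ)).re) :
    IsMultiplier fun x => (A x)⁻¹ where
  meas i j := by
    have hdet : ∀ B : R3 → Matrix (Fin 3) (Fin 3) ℂ,
        (∀ i j, AEMeasurable (fun x => B x i j) volume) →
        AEMeasurable (fun x => (B x).det) volume := by
      intro B hB
      simp only [Matrix.det_apply]
      exact Finset.aemeasurable_fun_sum _ fun σ _ =>
        (Finset.aemeasurable_fun_prod _ fun k _ => hB _ _).const_smul _
    have hadj : AEMeasurable (fun x => (A x).adjugate i j) volume := by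
      simp only [Matrix.adjugate_apply]
      refine hdet _ fun k l => ?_
      by_cases hk : k = j
      · subst hk
        simp only [Matrix.updateRow_self]
        exact aemeasurable_const
      · simp only [Matrix.updateRow_ne hk]
        exact hA.meas k l
    -- Entries of the inverse are cofactors divided by the determinant. Inversion in `ℂ`, with `0⁻¹
    -- = 0`, is measurable, so singular matrices on a null set do no harm.
    simp only [Matrix.inv_def, Ring.inverse_eq_inv', Matrix.smul_apply, smul_eq_mul]
    exact (hdet A hA.meas).inv.mul hadj
  bdd := ⟨α⁻¹, by positivity, h.mono fun x hx ξ => norm_act_inv_le hα hx ξ⟩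

end Multipliers

/-! ### The weak curl as a self-adjoint Fourier multiplier -/

section CurlGraph

open Filter Topology
open scoped SchwartzMap FourierTransform LineDeriv

/-- The matrices of the cross products `e_j × ·`. -/
def crossMatrix : Fin 3 → Matrix (Fin 3) (Fin 3) ℂ :=
  ![!![0, 0, 0; 0, 0, -1; 0, 1, 0], !![0, 0, 1; 0, 0, 0; -1, 0, 0], !![0, -1, 0; 1, 0, 0; 0, 0, 0]]

lemma conjTranspose_crossMatrix (j : Fin 3) : (crossMatrix j).conjTranspose = -crossMatrix j := by
  ext k l
  fin_cases j <;> fin_cases k <;> fin_cases l <;> simp [crossMatrix]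

/-- The action of a matrix as a continuous linear map. -/
def actCLM (A : Matrix (Fin 3) (Fin 3) ℂ) : C3 →L[ℂ] C3 :=
  LinearMap.toContinuousLinearMap
    { toFun := act A, map_add' := act_add A, map_smul' := act_smul A }

lemma actCLM_apply (A : Matrix (Fin 3) (Fin 3) ℂ) (ξ : C3) : actCLM A ξ = act A ξ := rfl

/-- Writing the curl as `∑ⱼ eⱼ × ∂ⱼ v` reduces its Fourier transform to that of a single derivative
followed by a constant matrix. -/
lemma curl_eq_sum {v : R3 → C3} {x : R3} (hv : DifferentiableAt ℝ v x) :
    curl v x = ∑ j, act (crossMatrix j) (fderiv ℝ v x (EuclideanSpace.single j 1)) := by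
  have h : ∀ j k, pderiv v j k x = fderiv ℝ v x (EuclideanSpace.single j 1) k := fun j k => by
    have h1 : HasFDerivAt (fun y => v y k)
        (((EuclideanSpace.proj k : C3 →L[ℂ] ℂ).restrictScalars ℝ).comp (fderiv ℝ v x)) x :=
      ((EuclideanSpace.proj k : C3 →L[ℂ] ℂ).restrictScalars ℝ).hasFDerivAt.comp x hv.hasFDerivAt
    rw [pderiv, h1.fderiv]
    rfl
  ext i
  simp only [curl, h, Fin.sum_univ_three, crossMatrix, PiLp.add_apply, act_apply]
  fin_cases i <;> simp <;> ring

/-- The curl of a Schwartz field. -/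
def schwartzCurl (φ : 𝓢(R3, C3)) : 𝓢(R3, C3) :=
  ∑ j, (∂_{(EuclideanSpace.single j (1 : ℝ) : R3)} φ).postcompCLM (actCLM (crossMatrix j))

lemma schwartzCurl_apply (φ : 𝓢(R3, C3)) (x : R3) : schwartzCurl φ x = curl φ x := by
  rw [curl_eq_sum φ.differentiableAt, schwartzCurl, sum_apply]
  rfl

/-- The symbol of the curl operator. -/
def curlSymbol (ξ : R3) : Matrix (Fin 3) (Fin 3) ℂ :=
  ∑ j, (2 * Real.pi * Complex.I * (ξ j : ℂ)) • crossMatrix j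

/-- Each cross product matrix is skew-Hermitian and its factor is purely imaginary. This is the
origin of the symmetry of the curl. -/
lemma isHermitian_curlSymbol (ξ : R3) : (curlSymbol ξ).IsHermitian := by
  rw [Matrix.IsHermitian, curlSymbol, Matrix.conjTranspose_sum]
  refine Finset.sum_congr rfl fun j _ => ?_
  rw [Matrix.conjTranspose_smul, conjTranspose_crossMatrix]
  simp

lemma act_curlSymbol (ξ : R3) (v : C3) : act (curlSymbol ξ) v =
    ∑ j, act (crossMatrix j) ((2 * Real.pi * Complex.I * (ξ j : ℂ)) • v) := by
  ext i
  simp only [act_apply, curlSymbol, WithLp.ofLp_sum, Finset.sum_apply, Matrix.sum_apply,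
    Matrix.smul_apply, Finset.sum_mul, PiLp.smul_apply, smul_eq_mul]
  rw [Finset.sum_comm]
  exact Finset.sum_congr rfl fun j _ => Finset.sum_congr rfl fun k _ => by ring

lemma fourier_schwartzCurl (φ : 𝓢(R3, C3)) (ξ : R3) :
    𝓕 (schwartzCurl φ) ξ = act (curlSymbol ξ) (𝓕 φ ξ) := by
  have h1 : 𝓕 (schwartzCurl φ) = ∑ j, 𝓕 ((∂_{(EuclideanSpace.single j (1 : ℝ) : R3)} φ).postcompCLM
      (actCLM (crossMatrix j))) := by
    rw [schwartzCurl]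
    exact map_sum (FourierTransform.fourierCLM ℂ 𝓢(R3, C3)) _ _
  have h2 : ∀ (L : C3 →L[ℂ] C3) (f : 𝓢(R3, C3)), 𝓕 (f.postcompCLM L) ξ = L (𝓕 f ξ) := by
    intro L f
    rw [SchwartzMap.fourier_coe, SchwartzMap.fourier_coe, Real.fourier_eq, Real.fourier_eq,
      ← L.integral_comp_comm ((Real.fourierIntegral_convergent_iff ξ).2 f.integrable)]
    refine integral_congr_ae (.of_forall fun x => ?_)
    simp only [SchwartzMap.postcompCLM_apply]
    rw [Circle.smul_def, Circle.smul_def, map_smul]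
  rw [h1, sum_apply, act_curlSymbol]
  refine Finset.sum_congr rfl fun j _ => ?_
  rw [h2, actCLM_apply, SchwartzMap.fourier_lineDerivOp_eq]
  have : (fun x : R3 => inner ℝ x (EuclideanSpace.single j (1 : ℝ))).HasTemperateGrowth := by
    fun_prop
  rw [smul_apply, SchwartzMap.smulLeftCLM_apply_apply this]
  congr 1
  have h3 : inner ℝ ξ (EuclideanSpace.single j (1 : ℝ)) • 𝓕 φ ξ = (ξ j : ℂ) • 𝓕 φ ξ := by
    rw [EuclideanSpace.inner_single_right, Complex.coe_smul]
    simp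
  rw [h3, smul_smul]

/-- The graph of the weak curl operator on `L²`. -/
def curlGraph : Submodule ℂ (L2 × L2) where
  carrier := {p | ∀ φ : 𝓢(R3, C3), HasCompactSupport φ →
    inner ℂ (φ.toLp 2) p.2 = inner ℂ ((schwartzCurl φ).toLp 2) p.1}
  add_mem' {p q} hp hq φ hφ := by
    rw [Prod.snd_add, Prod.fst_add, inner_add_right, inner_add_right, hp φ hφ, hq φ hφ]
  zero_mem' φ hφ := by simp
  smul_mem' c p hp φ hφ := by
    rw [Prod.smul_snd, Prod.smul_fst, inner_smul_right, inner_smul_right, hp φ hφ]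

lemma isClosed_curlGraph : IsClosed (curlGraph : Set (L2 × L2)) := by
  have h : (curlGraph : Set (L2 × L2)) = ⋂ (φ : 𝓢(R3, C3)) (_ : HasCompactSupport φ),
      {p : L2 × L2 | inner ℂ (φ.toLp 2) p.2 = inner ℂ ((schwartzCurl φ).toLp 2) p.1} := by
    ext p
    simp only [mem_iInter]
    rfl
  rw [h]
  exact isClosed_iInter fun φ => isClosed_iInter fun _ =>
    isClosed_eq (by fun_prop) (by fun_prop)

/-- Such a `y` is orthogonal to all smooth compactly supported fields, which are dense. -/
lemma eq_zero_of_zero_mem_curlGraph (y : L2) (h : (0, y) ∈ curlGraph) : y = 0 := by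
  have hd := MeasureTheory.Lp.dense_hasCompactSupport_contDiff (E := R3) (F := C3)
    (μ := volume) (p := 2) (by simp)
  refine hd.eq_zero_of_inner_right ℂ fun v hv => ?_
  obtain ⟨φ, hvφ, hc, hs⟩ := hv
  have h1 := h (hc.toSchwartzMap hs) hc
  rw [inner_zero_right] at h1
  have h2 : v = (hc.toSchwartzMap hs).toLp 2 :=
    Lp.ext (hvφ.trans ((hc.toSchwartzMap hs).coeFn_toLp 2).symm)
  rw [h2, h1]

lemma inner_toLp (φ : 𝓢(R3, C3)) (u : L2) :
    inner ℂ (φ.toLp 2) u = ∫ x, inner ℂ (φ x) (u x) := by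
  rw [L2.inner_def]
  refine integral_congr_ae ?_
  filter_upwards [φ.coeFn_toLp 2 (μ := volume)] with x hx
  rw [hx]

lemma inner_toLp_fourier (φ : 𝓢(R3, C3)) (u : L2) :
    inner ℂ (φ.toLp 2) u = ∫ ξ, inner ℂ (𝓕 φ ξ) ((𝓕 u : L2) ξ) := by
  rw [← inner_toLp, ← SchwartzMap.toLp_fourier_eq]
  exact (Lp.inner_fourier_eq _ _).symm

/-- The curl as a function of the derivative. -/
def curlCLM : (R3 →L[ℝ] C3) →L[ℝ] C3 :=
  ∑ j, ((actCLM (crossMatrix j)).restrictScalars ℝ).comp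
    (ContinuousLinearMap.apply ℝ C3 (EuclideanSpace.single j (1 : ℝ) : R3))

lemma curl_eq_curlCLM {v : R3 → C3} {x : R3} (hv : DifferentiableAt ℝ v x) :
    curl v x = curlCLM (fderiv ℝ v x) := by
  rw [curl_eq_sum hv, curlCLM, sum_apply]
  rfl

/-- Every Schwartz field is a limit of compactly supported ones, with the first derivatives
dominated. -/
lemma exists_cutoff (φ : 𝓢(R3, C3)) : ∃ (D : ℝ) (φn : ℕ → 𝓢(R3, C3)),
    (∀ n, HasCompactSupport (φn n)) ∧ (∀ x, ∀ᶠ n in atTop, φn n =ᶠ[𝓝 x] φ) ∧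
    (∀ n x, ‖φn n x‖ ≤ ‖φ x‖) ∧ ∀ n x, ‖fderiv ℝ (φn n) x‖ ≤ ‖fderiv ℝ φ x‖ + D * ‖φ x‖ := by
  let χ : ContDiffBump (0 : R3) := ⟨1, 2, one_pos, one_lt_two⟩
  have hχ : ContDiff ℝ ∞ χ := χ.contDiff
  obtain ⟨D, hD⟩ := (χ.hasCompactSupport.fderiv (𝕜 := ℝ)).exists_bound_of_continuous
    (hχ.continuous_fderiv (by simp))
  let r : ℕ → ℝ := fun n => ((n : ℝ) + 1)⁻¹
  have hr0 : ∀ n, 0 < r n := fun n => by positivity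
  have hr1 : ∀ n, r n ≤ 1 := fun n => inv_le_one_of_one_le₀ (by linarith [n.cast_nonneg (α := ℝ)])
  let v : ℕ → R3 → C3 := fun n x => χ (r n • x) • φ x
  have hvs : ∀ n, ContDiff ℝ ∞ (v n) := fun n =>
    (hχ.comp (contDiff_const_smul (r n))).smul φ.smooth'
  have hvc : ∀ n, HasCompactSupport (v n) := fun n => by
    have h := χ.hasCompactSupport.comp_homeomorph (Homeomorph.smulOfNeZero (r n) (hr0 n).ne')
    exact h.smul_right (f' := φ)
  refine ⟨D, fun n => (hvc n).toSchwartzMap (hvs n), hvc, fun x => ?_, fun n x => ?_, fun n x => ?_⟩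
  -- The dilated cutoff `χ (r n • ·)` equals 1 on the ball of radius `1 / r n`, which eventually
  -- contains the unit ball about `x`; so values and derivatives agree there.
  · have : Tendsto (fun n => r n * (‖x‖ + 1)) atTop (𝓝 (0 * (‖x‖ + 1))) :=
      (tendsto_inv_atTop_zero.comp
        (tendsto_atTop_add_const_right _ _ tendsto_natCast_atTop_atTop)).mul_const _
    rw [zero_mul] at this
    filter_upwards [this.eventually (gt_mem_nhds one_pos)] with n hn
    filter_upwards [Metric.ball_mem_nhds x one_pos] with y hy
    have hy' : ‖y‖ ≤ ‖x‖ + 1 := by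
      have := norm_le_norm_add_norm_sub' y x
      rw [Metric.mem_ball, dist_eq_norm] at hy
      linarith
    have : χ (r n • y) = 1 := by
      refine χ.one_of_mem_closedBall ?_
      rw [mem_closedBall_zero_iff, norm_smul, Real.norm_of_nonneg (hr0 n).le]
      exact (mul_le_mul_of_nonneg_left hy' (hr0 n).le).trans hn.le
    change χ (r n • y) • φ y = φ y
    rw [this, one_smul]
  · change ‖χ (r n • x) • φ x‖ ≤ ‖φ x‖
    rw [norm_smul, Real.norm_of_nonneg χ.nonneg]
    exact mul_le_of_le_one_left (norm_nonneg _) χ.le_one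
  · have h1 : HasFDerivAt (fun x => χ (r n • x))
        ((fderiv ℝ χ (r n • x)).comp (r n • ContinuousLinearMap.id ℝ R3)) x :=
      ((hχ.differentiable (by simp)) _).hasFDerivAt.comp x
        ((hasFDerivAt_id x).const_smul (r n))
    have h2 := h1.smul (φ.differentiableAt (x := x)).hasFDerivAt
    change ‖fderiv ℝ ((fun x => χ (r n • x)) • ⇑φ) x‖ ≤ _
    rw [h2.fderiv]
    refine (norm_add_le _ _).trans (add_le_add ?_ ?_)
    · rw [norm_smul, Real.norm_of_nonneg χ.nonneg]
      exact mul_le_of_le_one_left (norm_nonneg _) χ.le_one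
    · rw [ContinuousLinearMap.norm_smulRight_apply]
      refine mul_le_mul_of_nonneg_right ?_ (norm_nonneg _)
      refine (ContinuousLinearMap.opNorm_comp_le _ _).trans ?_
      have h3 : ‖r n • ContinuousLinearMap.id ℝ R3‖ ≤ 1 := by
        rw [norm_smul, Real.norm_of_nonneg (hr0 n).le]
        exact mul_le_one₀ (hr1 n) (norm_nonneg _) ContinuousLinearMap.norm_id_le
      exact (mul_le_of_le_one_right (norm_nonneg _) h3).trans (hD _)

/-- Cutting off and dominated convergence extend the defining identity to Schwartz fields. The
extension is needed because fields with compactly supported Fourier transform are used as tests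
below. -/
lemma inner_eq_of_mem_curlGraph {p : L2 × L2} (hp : p ∈ curlGraph) (φ : 𝓢(R3, C3)) :
    inner ℂ (φ.toLp 2) p.2 = inner ℂ ((schwartzCurl φ).toLp 2) p.1 := by
  obtain ⟨D, φn, hc, he, h0, h1⟩ := exists_cutoff φ
  have hmem : ∀ u : L2, MemLp (fun x => ‖u x‖) 2 volume := fun u => (Lp.memLp u).norm
  have hφ : MemLp (fun x => ‖φ x‖) 2 volume := (φ.memLp 2).norm
  have hdφ : MemLp (fun x => ‖fderiv ℝ φ x‖) 2 volume :=
    ((SchwartzMap.fderivCLM ℝ R3 C3 φ).memLp 2 volume).norm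
  have hl : Tendsto (fun n => inner ℂ ((φn n).toLp 2) p.2) atTop (𝓝 (inner ℂ (φ.toLp 2) p.2)) := by
    simp only [inner_toLp]
    refine tendsto_integral_of_dominated_convergence (fun x => ‖φ x‖ * ‖p.2 x‖)
      (fun n => ((φn n).continuous.aestronglyMeasurable).inner (Lp.aestronglyMeasurable _))
      (hφ.integrable_mul (hmem _)) (fun n => .of_forall fun x => ?_) (.of_forall fun x => ?_)
    · exact (norm_inner_le_norm _ _).trans (mul_le_mul_of_nonneg_right (h0 n x) (norm_nonneg _))
    · refine tendsto_const_nhds.congr' ?_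
      filter_upwards [he x] with n hn
      rw [hn.eq_of_nhds]
  have hr : Tendsto (fun n => inner ℂ ((schwartzCurl (φn n)).toLp 2) p.1) atTop
      (𝓝 (inner ℂ ((schwartzCurl φ).toLp 2) p.1)) := by
    simp only [inner_toLp]
    refine tendsto_integral_of_dominated_convergence
      (fun x => (‖curlCLM‖ * (‖fderiv ℝ φ x‖ + D * ‖φ x‖)) * ‖p.1 x‖)
      (fun n => ((schwartzCurl (φn n)).continuous.aestronglyMeasurable).inner
        (Lp.aestronglyMeasurable _))
      (((hdφ.add (hφ.const_mul D)).const_mul _).integrable_mul (hmem _))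
      (fun n => .of_forall fun x => ?_) (.of_forall fun x => ?_)
    · refine (norm_inner_le_norm _ _).trans (mul_le_mul_of_nonneg_right ?_ (norm_nonneg _))
      rw [schwartzCurl_apply, curl_eq_curlCLM (φn n).differentiableAt]
      exact (curlCLM.le_opNorm _).trans (mul_le_mul_of_nonneg_left (h1 n x) (norm_nonneg _))
    · refine tendsto_const_nhds.congr' ?_
      filter_upwards [he x] with n hn
      rw [schwartzCurl_apply, schwartzCurl_apply, curl_eq_curlCLM φ.differentiableAt,
        curl_eq_curlCLM (φn n).differentiableAt, hn.fderiv_eq]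
  exact tendsto_nhds_unique hl (hr.congr fun n => (hp (φn n) (hc n)).symm)

lemma continuous_curlSymbol (k l : Fin 3) : Continuous fun ξ => curlSymbol ξ k l := by
  simp only [curlSymbol, Matrix.sum_apply, Matrix.smul_apply, smul_eq_mul]
  fun_prop

/-- The weak curl is the Fourier multiplier with symbol `curlSymbol`. -/
lemma mem_curlGraph_iff (p : L2 × L2) : p ∈ curlGraph ↔
    ∀ᵐ ξ, (𝓕 p.2 : L2) ξ = act (curlSymbol ξ) ((𝓕 p.1 : L2) ξ) := by
  constructor
  · intro hp
    have hL : ∀ u : L2, ∀ k, LocallyIntegrable (fun x => u x k) volume := fun u k =>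
      (((EuclideanSpace.proj k : C3 →L[ℂ] ℂ).comp_memLp u).locallyIntegrable (by simp)).congr
        (.of_forall fun x => rfl)
    have hS : ∀ k, LocallyIntegrable (fun ξ => act (curlSymbol ξ) ((𝓕 p.1 : L2) ξ) k) volume := by
      intro k
      simp only [act_apply]
      refine locallyIntegrable_finsetSum _ fun l _ => ?_
      exact locallyIntegrable_iff.2 fun K hK =>
        ((locallyIntegrable_iff.1 (hL (𝓕 p.1) l) K hK).continuousOn_mul
          (continuous_curlSymbol k l).continuousOn hK)
    have key : ∀ k, ∀ᵐ ξ, (𝓕 p.2 : L2) ξ k - act (curlSymbol ξ) ((𝓕 p.1 : L2) ξ) k = 0 := by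
      intro k
      refine ae_eq_zero_of_integral_contDiff_smul_eq_zero ((hL _ k).sub (hS k)) fun g hg hgc => ?_
      have hvc : HasCompactSupport fun ξ => g ξ • (EuclideanSpace.single k (1 : ℂ) : C3) :=
        hgc.smul_right
      -- Testing with the inverse Fourier transform of `g eₖ` localises the identity in frequency,
      -- and the Hermitian symbol moves onto `𝓕 p.1`. As `g` is arbitrary, the `k`-th components
      -- agree a.e.
      set ψ : 𝓢(R3, C3) := hvc.toSchwartzMap (hg.smul contDiff_const) with hψ
      have h1 := inner_eq_of_mem_curlGraph hp (𝓕⁻ ψ)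
      rw [inner_toLp_fourier, inner_toLp_fourier] at h1
      simp only [fourier_schwartzCurl, FourierTransform.fourier_fourierInv_eq,
        inner_act_left (isHermitian_curlSymbol _)] at h1
      have h2 : ∀ ξ (v : C3), inner ℂ (ψ ξ) v = g ξ • v k := fun ξ v => by
        change inner ℂ (g ξ • (EuclideanSpace.single k (1 : ℂ) : C3)) v = _
        rw [← Complex.coe_smul, inner_smul_left, EuclideanSpace.inner_single_left]
        simp
      simp only [h2] at h1
      simp only [smul_sub]
      rw [integral_sub ((hL _ k).integrable_smul_left_of_hasCompactSupport hg.continuous hgc)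
        ((hS k).integrable_smul_left_of_hasCompactSupport hg.continuous hgc), h1, sub_self]
    filter_upwards [ae_all_iff.2 key] with ξ hξ
    ext k
    exact sub_eq_zero.1 (hξ k)
  · intro h φ _
    rw [inner_toLp_fourier, inner_toLp_fourier]
    refine integral_congr_ae ?_
    filter_upwards [h] with ξ hξ
    rw [hξ, fourier_schwartzCurl, inner_act_left (isHermitian_curlSymbol _)]

/-- By Plancherel's theorem both products are integrals over frequency in which the Hermitian symbol
can be moved from one factor to the other. -/
lemma isSymmGraph_curlGraph : IsSymmGraph curlGraph := by
  intro p hp q hq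
  rw [← Lp.inner_fourier_eq, ← Lp.inner_fourier_eq p.1, L2.inner_def, L2.inner_def]
  refine integral_congr_ae ?_
  filter_upwards [(mem_curlGraph_iff p).1 hp, (mem_curlGraph_iff q).1 hq] with ξ h1 h2
  rw [h1, h2, inner_act_left (isHermitian_curlSymbol _)]

lemma schwartz_mem_curlGraph (φ : 𝓢(R3, C3)) :
    (φ.toLp 2 volume, (schwartzCurl φ).toLp 2 volume) ∈ curlGraph := by
  rw [mem_curlGraph_iff]
  simp only [SchwartzMap.toLp_fourier_eq]
  filter_upwards [(𝓕 φ).coeFn_toLp 2 volume,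
    (𝓕 (schwartzCurl φ)).coeFn_toLp 2 volume] with ξ h1 h2
  rw [h1, h2, fourier_schwartzCurl]

end CurlGraph

/-! ### Time slices of compactly supported fields as curves in `L²` -/

section Slices

open Filter Topology
open scoped SchwartzMap

variable {F : ℝ × R3 → C3}

lemma hasCompactSupport_slice (hc : HasCompactSupport F) (t : ℝ) :
    HasCompactSupport fun x => F (t, x) :=
  HasCompactSupport.intro (hc.image continuous_snd) fun _ hx => image_eq_zero_of_notMem_tsupport
    fun h => hx (mem_image_of_mem Prod.snd h)

lemma memLp_slice (hF : Continuous F) (hc : HasCompactSupport F) (t : ℝ) :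
    MemLp (fun x => F (t, x)) 2 volume :=
  (hF.comp (Continuous.prodMk_right t)).memLp_of_hasCompactSupport (hasCompactSupport_slice hc t)

/-- The slices `F(t, ·)` as elements of `L²`. -/
def sliceLp (hF : Continuous F) (hc : HasCompactSupport F) (t : ℝ) : L2 :=
  (memLp_slice hF hc t).toLp

lemma coeFn_sliceLp (hF : Continuous F) (hc : HasCompactSupport F) (t : ℝ) :
    sliceLp hF hc t =ᵐ[volume] fun x => F (t, x) :=
  (memLp_slice hF hc t).coeFn_toLp

lemma inner_sliceLp (hF : Continuous F) (hc : HasCompactSupport F) (t : ℝ) (u : L2) :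
    inner ℂ (sliceLp hF hc t) u = ∫ x, inner ℂ (F (t, x)) (u x) := by
  rw [L2.inner_def]
  refine integral_congr_ae ?_
  filter_upwards [coeFn_sliceLp hF hc t] with x hx
  rw [hx]

lemma integrable_inner_slice (hF : Continuous F) (hc : HasCompactSupport F) (t : ℝ) (u : L2) :
    Integrable fun x => inner ℂ (F (t, x)) (u x) := by
  refine (L2.integrable_inner (𝕜 := ℂ) (sliceLp hF hc t) u).congr ?_
  filter_upwards [coeFn_sliceLp hF hc t] with x hx
  rw [hx]

/-- Uniformly small fields with a common compact support are small in `L²`. -/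
lemma exists_norm_le_mul {K : Set R3} (hK : IsCompact K) : ∃ M : ℝ, 0 < M ∧
    ∀ (u : L2) (ε : ℝ), (∀ᵐ x, ‖u x‖ ≤ ε) → (∀ᵐ x, x ∉ K → u x = 0) → ‖u‖ ≤ ε * M := by
  let w : Lp ℝ 2 (volume : Measure R3) :=
    indicatorConstLp 2 hK.measurableSet hK.measure_lt_top.ne (1 : ℝ)
  refine ⟨‖w‖ + 1, by positivity, fun u ε h1 h2 => ?_⟩
  -- A negative bound on a norm cannot hold anywhere, and `ℝ³` is not a null set.
  by_cases hε : 0 ≤ ε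
  · refine (Lp.norm_le_mul_norm_of_ae_le_mul (g := w) (c := ε) ?_).trans
      (mul_le_mul_of_nonneg_left (by linarith) hε)
    filter_upwards [h1, h2, indicatorConstLp_coeFn (p := 2) (hs := hK.measurableSet)
      (hμs := hK.measure_lt_top.ne) (c := (1 : ℝ))] with x hx1 hx2 hx3
    rw [hx3]
    by_cases hx : x ∈ K
    · simpa [hx] using hx1
    · simp [hx, hx2 hx]
  · obtain ⟨x, hx⟩ := h1.exists
    exact absurd ((norm_nonneg _).trans hx) hε

lemma slice_eq_zero {t : ℝ} {x : R3} (hx : x ∉ Prod.snd '' tsupport F) : F (t, x) = 0 :=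
  image_eq_zero_of_notMem_tsupport fun h => hx (mem_image_of_mem Prod.snd h)

lemma continuous_sliceLp (hF : Continuous F) (hc : HasCompactSupport F) :
    Continuous (sliceLp hF hc) := by
  obtain ⟨M, hM, hb⟩ := exists_norm_le_mul (hc.image continuous_snd)
  rw [Metric.continuous_iff]
  intro t ε hε
  obtain ⟨δ, hδ, hu⟩ := Metric.uniformContinuous_iff.1 (hc.uniformContinuous_of_continuous hF)
    (ε / (2 * M)) (by positivity)
  refine ⟨δ, hδ, fun s hs => ?_⟩
  rw [dist_eq_norm]
  have h1 : ‖sliceLp hF hc s - sliceLp hF hc t‖ ≤ ε / (2 * M) * M := by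
    refine hb _ _ ?_ ?_
    · filter_upwards [coeFn_sliceLp hF hc s, coeFn_sliceLp hF hc t,
        Lp.coeFn_sub (sliceLp hF hc s) (sliceLp hF hc t)] with x h1 h2 h3
      rw [h3, Pi.sub_apply, h1, h2, ← dist_eq_norm]
      exact (hu (by simpa [Prod.dist_eq] using hs)).le
    · filter_upwards [coeFn_sliceLp hF hc s, coeFn_sliceLp hF hc t,
        Lp.coeFn_sub (sliceLp hF hc s) (sliceLp hF hc t)] with x h1 h2 h3 hx
      rw [h3, Pi.sub_apply, h1, h2, slice_eq_zero hx, slice_eq_zero hx, sub_zero]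
  have h2 : ε / (2 * M) * M = ε / 2 := by field_simp
  linarith

/-- Uniform continuity of `F'` makes the Taylor remainder at most `(ε / M) |s - t|`, uniformly in
`x`. It lives in a fixed compact set, so it is equally small in `L²`. -/
lemma hasDerivAt_sliceLp {F' : ℝ × R3 → C3} (hF : Continuous F) (hc : HasCompactSupport F)
    (hF' : Continuous F') (hc' : HasCompactSupport F')
    (hd : ∀ t x, HasDerivAt (fun s => F (s, x)) (F' (t, x)) t) (t : ℝ) :
    HasDerivAt (sliceLp hF hc) (sliceLp hF' hc' t) t := by
  obtain ⟨M, hM, hb⟩ := exists_norm_le_mul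
    ((hc.image continuous_snd).union (hc'.image continuous_snd))
  rw [hasDerivAt_iff_isLittleO, Asymptotics.isLittleO_iff]
  intro ε hε
  obtain ⟨δ, hδ, hu⟩ := Metric.uniformContinuous_iff.1 (hc'.uniformContinuous_of_continuous hF')
    (ε / M) (by positivity)
  filter_upwards [Metric.ball_mem_nhds t hδ] with s hs
  have h1 : ‖sliceLp hF hc s - sliceLp hF hc t - (s - t) • sliceLp hF' hc' t‖
      ≤ ε / M * ‖s - t‖ * M := by
    have hx : ∀ᵐ x, (sliceLp hF hc s - sliceLp hF hc t - (s - t) • sliceLp hF' hc' t : L2) x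
        = F (s, x) - F (t, x) - (s - t) • F' (t, x) := by
      filter_upwards [coeFn_sliceLp hF hc s, coeFn_sliceLp hF hc t, coeFn_sliceLp hF' hc' t,
        Lp.coeFn_sub (sliceLp hF hc s) (sliceLp hF hc t),
        Lp.coeFn_sub (sliceLp hF hc s - sliceLp hF hc t) ((s - t) • sliceLp hF' hc' t),
        Lp.coeFn_smul (s - t) (sliceLp hF' hc' t)] with x h1 h2 h3 h4 h5 h6
      rw [h5, Pi.sub_apply, h4, h6, Pi.sub_apply, Pi.smul_apply, h1, h2, h3]
    refine hb _ _ ?_ ?_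
    · filter_upwards [hx] with x hx
      rw [hx]
      -- Mean value inequality for `r ↦ F (r, x) - r • F' (t, x)`, whose derivative is small near
      -- `t`.
      have h2 := (convex_ball t δ).norm_image_sub_le_of_norm_hasDerivWithin_le
        (f := fun r => F (r, x) - r • F' (t, x)) (f' := fun r => F' (r, x) - F' (t, x))
        (C := ε / M) (x := t) (y := s) (fun r hr => ?_) (fun r hr => ?_)
        (Metric.mem_ball_self hδ) hs
      · have h3 : F (s, x) - F (t, x) - (s - t) • F' (t, x)
            = F (s, x) - s • F' (t, x) - (F (t, x) - t • F' (t, x)) := by module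
        rwa [h3]
      · have h3 := ((hd r x).sub ((hasDerivAt_id r).smul_const (F' (t, x)))).hasDerivWithinAt
          (s := Metric.ball t δ)
        rw [one_smul] at h3
        exact h3
      · rw [← dist_eq_norm]
        exact (hu (by simpa [Prod.dist_eq] using hr)).le
    · filter_upwards [hx] with x hx hxK
      rw [mem_union, not_or] at hxK
      rw [hx, slice_eq_zero hxK.1, slice_eq_zero hxK.1, slice_eq_zero hxK.2]
      simp
  refine h1.trans_eq ?_
  field_simp

end Slices

/-! ### Test fields as test curves -/

section TestCurves

open Filter Topology
open scoped SchwartzMap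

variable {T : ℝ} {φ : ℝ → R3 → C3}

namespace IsTestField

/-- The time derivative of a test field. -/
def timeDeriv (φ : ℝ → R3 → C3) (z : ℝ × R3) : C3 := fderiv ℝ (Function.uncurry φ) z (1, 0)

/-- The curl of a test field. -/
def spaceCurl (φ : ℝ → R3 → C3) (z : ℝ × R3) : C3 :=
  curlCLM ((fderiv ℝ (Function.uncurry φ) z).comp (ContinuousLinearMap.inr ℝ ℝ R3))

lemma continuous_fderiv_uncurry (h : IsTestField T φ) :
    Continuous (fderiv ℝ (Function.uncurry φ)) :=
  h.smooth.continuous_fderiv (by simp)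

lemma continuous_timeDeriv (h : IsTestField T φ) : Continuous (timeDeriv φ) :=
  h.continuous_fderiv_uncurry.clm_apply continuous_const

lemma hasCompactSupport_timeDeriv (h : IsTestField T φ) : HasCompactSupport (timeDeriv φ) :=
  h.compact.fderiv_apply (𝕜 := ℝ) (1, 0)

lemma continuous_spaceCurl (h : IsTestField T φ) : Continuous (spaceCurl φ) :=
  curlCLM.continuous.comp (h.continuous_fderiv_uncurry.clm_comp continuous_const)

lemma hasCompactSupport_spaceCurl (h : IsTestField T φ) : HasCompactSupport (spaceCurl φ) :=
  (h.compact.fderiv (𝕜 := ℝ)).mono fun z hz h0 => hz (by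
    rw [spaceCurl, h0, ContinuousLinearMap.zero_comp, map_zero])

lemma hasDerivAt_time (h : IsTestField T φ) (t : ℝ) (x : R3) :
    HasDerivAt (fun s => φ s x) (timeDeriv φ (t, x)) t :=
  ((h.smooth.differentiable (by simp)) (t, x)).hasFDerivAt.comp_hasDerivAt (f := fun s => (s, x)) t
    ((hasDerivAt_id t).prodMk (hasDerivAt_const t x))

lemma curl_eq_spaceCurl (h : IsTestField T φ) (t : ℝ) (x : R3) :
    curl (φ t) x = spaceCurl φ (t, x) := by
  have h1 : HasFDerivAt (φ t)
      ((fderiv ℝ (Function.uncurry φ) (t, x)).comp (ContinuousLinearMap.inr ℝ ℝ R3)) x :=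
    ((h.smooth.differentiable (by simp)) (t, x)).hasFDerivAt.comp (f := fun y => (t, y)) x
      (hasFDerivAt_prodMk_right t x)
  rw [curl_eq_curlCLM h1.differentiableAt, h1.fderiv, spaceCurl]

/-- A test field defines a test curve in `L²`. -/
lemma isTestCurve (h : IsTestField T φ) :
    IsTestCurve curlGraph T (sliceLp h.smooth.continuous h.compact)
    (sliceLp h.continuous_timeDeriv h.hasCompactSupport_timeDeriv)
    (sliceLp h.continuous_spaceCurl h.hasCompactSupport_spaceCurl) where
  hasDerivAt := hasDerivAt_sliceLp _ _ _ _ h.hasDerivAt_time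
  continuous_deriv := continuous_sliceLp _ _
  continuous_image := continuous_sliceLp _ _
  mem t := by
    have hs : ContDiff ℝ ∞ fun x => Function.uncurry φ (t, x) :=
      h.smooth.comp (contDiff_prodMk_right t)
    have hm := schwartz_mem_curlGraph ((hasCompactSupport_slice h.compact t).toSchwartzMap hs)
    convert hm using 2
    · refine Lp.ext ?_
      filter_upwards [coeFn_sliceLp h.smooth.continuous h.compact t,
        SchwartzMap.coeFn_toLp ((hasCompactSupport_slice h.compact t).toSchwartzMap hs) 2 volume]
        with x h1 h2
      rw [h1, h2]
      rfl
    · refine Lp.ext ?_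
      filter_upwards [coeFn_sliceLp h.continuous_spaceCurl h.hasCompactSupport_spaceCurl t,
        SchwartzMap.coeFn_toLp
          (schwartzCurl ((hasCompactSupport_slice h.compact t).toSchwartzMap hs)) 2 volume]
        with x h1 h2
      rw [h1, h2, schwartzCurl_apply, ← h.curl_eq_spaceCurl]
      rfl
  zero t ht := by
    refine Lp.ext ((coeFn_sliceLp _ _ t).trans (.trans (.of_forall fun x => ?_)
      (Lp.coeFn_zero C3 2 volume).symm))
    refine image_eq_zero_of_notMem_tsupport fun hx => ?_
    exact absurd (h.support hx).1 (not_lt.2 ht)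

end IsTestField

/-- Products of a scalar function of time and a field in space. -/
lemma isTestField_smul {η : ℝ → ℝ} (hη : ContDiff ℝ ∞ η) (hηc : HasCompactSupport η)
    (hηT : tsupport η ⊆ Iio T) (ζ : 𝓢(R3, C3)) (hζ : HasCompactSupport ζ) :
    IsTestField T fun t x => η t • ζ x where
  smooth := (hη.comp contDiff_fst).smul (ζ.smooth'.comp contDiff_snd)
  compact := HasCompactSupport.intro (hηc.prod hζ) fun z hz => by
    rw [mem_prod, not_and_or] at hz
    rcases hz with hz | hz
    · simp [Function.uncurry, image_eq_zero_of_notMem_tsupport hz]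
    · simp [Function.uncurry, image_eq_zero_of_notMem_tsupport hz]
  support := by
    refine (closure_minimal (t := tsupport η ×ˢ univ) (fun z hz => ⟨?_, mem_univ _⟩)
      ((isClosed_tsupport η).prod isClosed_univ)).trans (prod_mono_left hηT)
    refine subset_tsupport η fun h0 => hz ?_
    simp [Function.uncurry, h0]

lemma curl_smul (c : ℝ) (ζ : 𝓢(R3, C3)) (x : R3) :
    curl (fun y => c • ζ y) x = c • schwartzCurl ζ x := by
  rw [schwartzCurl_apply, curl_eq_curlCLM ζ.differentiableAt, ← map_smul,
    curl_eq_curlCLM (v := fun y => c • ζ y) (ζ.differentiableAt.const_smul c)]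
  congr 1
  exact fderiv_const_smul ζ.differentiableAt c

/-- A scalar function of time times an element of the graph is a test curve. -/
lemma isTestCurve_smul {X : Type*} [NormedAddCommGroup X] [InnerProductSpace ℂ X]
    {G : Submodule ℂ (X × X)} {η : ℝ → ℝ} (hη : ContDiff ℝ ∞ η)
    (hηT : tsupport η ⊆ Iio T) {p : X × X} (hp : p ∈ G) :
    IsTestCurve G T (fun t => η t • p.1) (fun t => deriv η t • p.1) (fun t => η t • p.2) where
  hasDerivAt t := ((hη.differentiable (by simp)) t).hasDerivAt.smul_const p.1
  continuous_deriv := (hη.continuous_deriv (by simp)).smul continuous_const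
  continuous_image := hη.continuous.smul continuous_const
  mem t := by
    have := G.smul_mem (η t : ℂ) hp
    rwa [Complex.coe_smul] at this
  zero t ht := by
    rw [image_eq_zero_of_notMem_tsupport fun h => absurd (hηT h) (not_lt.2 ht), zero_smul]

end TestCurves

/-! ### Differences of weak solutions and uniqueness -/

section TimeWeakDifference

variable {X : Type*} [NormedAddCommGroup X] [InnerProductSpace ℂ X]
  {G : Submodule ℂ (X × X)} {T : ℝ}

lemma integrable_smul_of_hasCompactSupport {η : ℝ → ℝ} (hη : Continuous η)
    (hc : HasCompactSupport η) {v : ℝ → X} (hv : Integrable v) : Integrable fun s => η s • v s :=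
  hv.locallyIntegrable.integrable_smul_left_of_hasCompactSupport hη hc

lemma inner_real_smul_comm (a : ℝ) (x y : X) : inner ℂ (a • x) y = inner ℂ x (a • y) := by
  rw [← Complex.coe_smul, ← Complex.coe_smul, inner_smul_left, inner_smul_right,
    Complex.conj_ofReal]

lemma IsTimeWeak.sub {v h w v' h' w' : ℝ → X} {w₀ w₀' : X} (H : IsTimeWeak G T v h w w₀)
    (H' : IsTimeWeak G T v' h' w' w₀') (hv : Integrable v) (hh : Integrable h) (hw : Integrable w)
    (hv' : Integrable v') (hh' : Integrable h') (hw' : Integrable w') :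
    IsTimeWeak G T (fun s => v s - v' s) (fun s => h s - h' s) (fun s => w s - w' s)
      (w₀ - w₀') := by
  intro η hη hc hT
  have hη' := hη.continuous_deriv (by simp)
  have hI := fun {u : ℝ → X} (hu : Integrable u) =>
    integrable_smul_of_hasCompactSupport hη.continuous hc hu
  have hI' := fun {u : ℝ → X} (hu : Integrable u) =>
    integrable_smul_of_hasCompactSupport hη' hc.deriv hu
  have h1 := G.sub_mem (H η hη hc hT) (H' η hη hc hT)
  simp only [smul_sub]
  rw [integral_sub (hI hv) (hI hv'), integral_sub (hI hh) (hI hh'), integral_sub (hI' hw) (hI' hw')]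
  convert h1 using 1
  rw [Prod.mk_sub_mk, Prod.mk.injEq]
  exact ⟨rfl, by abel⟩

lemma IsTimeWeakSystem.sub {P R : X →L[ℂ] X} {f g f' g' E B E' B' : ℝ → X} {E₀ B₀ E₀' B₀' : X}
    (H : IsTimeWeakSystem G P R T f g E₀ B₀ E B)
    (H' : IsTimeWeakSystem G P R T f' g' E₀' B₀' E' B') :
    IsTimeWeakSystem G P R T (fun s => f s - f' s) (fun s => g s - g' s) (E₀ - E₀') (B₀ - B₀')
      (fun s => E s - E' s) (fun s => B s - B' s) where
  integrable_E := H.integrable_E.sub H'.integrable_E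
  integrable_B := H.integrable_B.sub H'.integrable_B
  integrable_f := H.integrable_f.sub H'.integrable_f
  integrable_g := H.integrable_g.sub H'.integrable_g
  E_zero s hs := by rw [H.E_zero s hs, H'.E_zero s hs, sub_zero]
  B_zero s hs := by rw [H.B_zero s hs, H'.B_zero s hs, sub_zero]
  f_zero s hs := by rw [H.f_zero s hs, H'.f_zero s hs, sub_zero]
  g_zero s hs := by rw [H.g_zero s hs, H'.g_zero s hs, sub_zero]
  faraday := H.faraday.sub H'.faraday H.integrable_E H.integrable_f H.integrable_B H'.integrable_E
    H'.integrable_f H'.integrable_B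
  ampere := by
    have h := H.ampere.sub H'.ampere (R.integrable_comp H.integrable_B).neg H.integrable_g
      (P.integrable_comp H.integrable_E) (R.integrable_comp H'.integrable_B).neg H'.integrable_g
      (P.integrable_comp H'.integrable_E)
    simp only [map_sub]
    convert h using 2
    abel

/-- Time-weak solutions are determined by the data. -/
lemma IsTimeWeakSystem.ae_eq [CompleteSpace X] {P R : X →L[ℂ] X} {f g E B E' B' : ℝ → X}
    {E₀ B₀ : X} (H : IsTimeWeakSystem G P R T f g E₀ B₀ E B)
    (H' : IsTimeWeakSystem G P R T f g E₀ B₀ E' B') (hT : 0 < T)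
    (hP : IsCoerciveSymm P) (hR : IsCoerciveSymm R) (hG : IsSymmGraph G)
    (hGc : IsClosed (G : Set (X × X))) (hG0 : ∀ y, (0, y) ∈ G → y = 0) :
    ∀ᵐ t, t ∈ Ico 0 T → E t = E' t ∧ B t = B' t := by
  have D := H.sub H'
  obtain ⟨c, hc, hle⟩ := exists_sq_le_quadForm hP hR
  obtain ⟨hE0, hB0⟩ := D.contRep_zero hT hP hR hG hGc hG0
  filter_upwards [D.contRep_ae_eq hP hR hG] with t h ht
  obtain ⟨h1, h2⟩ := h ht
  have h3 := D.integral_sourcePower_contRep hT hP hR hG ht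
  rw [hE0, hB0, h1, h2] at h3
  -- The difference has zero sources and zero initial data, so its energy stays zero.
  have h4 : quadForm P R (E t - E' t) (B t - B' t) = 0 := by
    simpa [sourcePower, quadForm] using h3.symm
  have h5 := hle (E t - E' t) (B t - B' t)
  rw [h4] at h5
  have h6 : (‖E t - E' t‖ + ‖B t - B' t‖) ^ 2 = 0 :=
    le_antisymm (nonpos_of_mul_nonpos_right h5 hc) (sq_nonneg _)
  have h7 := (pow_eq_zero_iff two_ne_zero).1 h6
  have h8 := norm_nonneg (E t - E' t)
  have h9 := norm_nonneg (B t - B' t)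
  exact ⟨sub_eq_zero.1 (norm_eq_zero.1 (by linarith)),
    sub_eq_zero.1 (norm_eq_zero.1 (by linarith))⟩

end TimeWeakDifference

/-! ### Testing with products of functions of time and of space -/

section ProductTests

open scoped SchwartzMap

/-- The weak form of the system, tested with products of a function of time and a field. -/
structure IsProductWeakSolution (P R : L2 →L[ℂ] L2) (T : ℝ) (f g : ℝ → L2) (E₀ B₀ : L2)
    (E B : ℝ → L2) : Prop where
  faraday : ∀ η : ℝ → ℝ, ContDiff ℝ ∞ η → HasCompactSupport η → tsupport η ⊆ Iio T →
    ∀ ζ : 𝓢(R3, C3), HasCompactSupport ζ →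
    ∫ t in Ioo 0 T, (-inner ℂ (deriv η t • ζ.toLp 2 volume) (B t)
        + inner ℂ (η t • (schwartzCurl ζ).toLp 2 volume) (E t)) =
      (∫ t in Ioo 0 T, inner ℂ (η t • ζ.toLp 2 volume) (f t))
        + inner ℂ (η 0 • ζ.toLp 2 volume) B₀
  ampere : ∀ η : ℝ → ℝ, ContDiff ℝ ∞ η → HasCompactSupport η → tsupport η ⊆ Iio T →
    ∀ ζ : 𝓢(R3, C3), HasCompactSupport ζ →
    ∫ t in Ioo 0 T, (-inner ℂ (deriv η t • ζ.toLp 2 volume) (P (E t))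
        - inner ℂ (η t • (schwartzCurl ζ).toLp 2 volume) (R (B t))) =
      (∫ t in Ioo 0 T, inner ℂ (η t • ζ.toLp 2 volume) (g t))
        + inner ℂ (η 0 • ζ.toLp 2 volume) (P E₀)

lemma IsCurveWeakSolution.isProductWeakSolution {P R : L2 →L[ℂ] L2} {T : ℝ} {f g : ℝ → L2}
    {E₀ B₀ : L2} {E B : ℝ → L2} (h : IsCurveWeakSolution curlGraph P R T f g E₀ B₀ E B) :
    IsProductWeakSolution P R T f g E₀ B₀ E B where
  faraday _ hη _ hηT ζ _ := h.faraday _ _ _ (isTestCurve_smul hη hηT (schwartz_mem_curlGraph ζ))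
  ampere _ hη _ hηT ζ _ := h.ampere _ _ _ (isTestCurve_smul hη hηT (schwartz_mem_curlGraph ζ))

lemma setIntegral_inner_smul {T : ℝ} {a : ℝ → ℝ} (ha : Continuous a) (hac : HasCompactSupport a)
    {u : ℝ → L2} (hu : IntegrableOn u (Ioo 0 T)) (z : L2) :
    IntegrableOn (fun t => inner ℂ (a t • z) (u t)) (Ioo 0 T) ∧
    ∫ t in Ioo 0 T, inner ℂ (a t • z) (u t) =
      inner ℂ z (∫ t, a t • (Ioo 0 T).indicator u t) := by
  have h1 : Integrable fun t => a t • (Ioo 0 T).indicator u t :=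
    integrable_smul_of_hasCompactSupport ha hac (hu.integrable_indicator measurableSet_Ioo)
  have h2 : ∀ t, inner ℂ (a t • z) (u t) = inner ℂ z (a t • u t) :=
    fun t => inner_real_smul_comm (a t) z (u t)
  have h3 : (fun t => a t • (Ioo 0 T).indicator u t) = (Ioo 0 T).indicator fun t => a t • u t := by
    ext1 t
    rw [← indicator_smul_apply]
  rw [h3, integrable_indicator_iff measurableSet_Ioo] at h1
  simp only [h2]
  rw [h3, integral_indicator measurableSet_Ioo]
  exact ⟨h1.const_inner z, integral_inner h1 z⟩

/-- The weak curl is defined by testing with compactly supported fields, so the equation tested with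
all products `η ζ` is exactly membership of the time integrals in the graph. No regularity of `v` in
space is needed. -/
lemma isTimeWeak_curlGraph {T : ℝ} {v h w : ℝ → L2} {w₀ : L2} (hv : IntegrableOn v (Ioo 0 T))
    (hh : IntegrableOn h (Ioo 0 T)) (hw : IntegrableOn w (Ioo 0 T))
    (H : ∀ η : ℝ → ℝ, ContDiff ℝ ∞ η → HasCompactSupport η → tsupport η ⊆ Iio T →
      ∀ ζ : 𝓢(R3, C3), HasCompactSupport ζ →
      ∫ t in Ioo 0 T, (-inner ℂ (deriv η t • ζ.toLp 2 volume) (w t)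
          + inner ℂ (η t • (schwartzCurl ζ).toLp 2 volume) (v t)) =
        (∫ t in Ioo 0 T, inner ℂ (η t • ζ.toLp 2 volume) (h t))
          + inner ℂ (η 0 • ζ.toLp 2 volume) w₀) :
    IsTimeWeak curlGraph T ((Ioo 0 T).indicator v) ((Ioo 0 T).indicator h)
      ((Ioo 0 T).indicator w) w₀ := by
  intro η hη hc hT ζ hζ
  have hη' := hη.continuous_deriv (by simp)
  obtain ⟨i1, e1⟩ := setIntegral_inner_smul hη' hc.deriv hw (ζ.toLp 2 volume)
  obtain ⟨i2, e2⟩ := setIntegral_inner_smul hη.continuous hc hv ((schwartzCurl ζ).toLp 2 volume)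
  obtain ⟨-, e3⟩ := setIntegral_inner_smul hη.continuous hc hh (ζ.toLp 2 volume)
  have h1 := H η hη hc hT ζ hζ
  have i3 : IntegrableOn (fun t => -inner ℂ (deriv η t • ζ.toLp 2 volume) (w t)) (Ioo 0 T) := i1.neg
  rw [integral_add i3 i2, integral_neg, e1, e2, e3] at h1
  have h2 : inner ℂ (η 0 • ζ.toLp 2 volume) w₀ = inner ℂ (ζ.toLp 2 volume) (η 0 • w₀) :=
    inner_real_smul_comm _ _ _
  rw [h2] at h1
  change inner ℂ (ζ.toLp 2 volume) (_ + _ + _) = inner ℂ ((schwartzCurl ζ).toLp 2 volume) _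
  rw [inner_add_right, inner_add_right]
  have h3 : ∀ a b c d : ℂ, -b + d = a + c → a + b + c = d := fun a b c d h => by
    linear_combination -h
  exact h3 _ _ _ _ h1

lemma IsProductWeakSolution.isTimeWeakSystem {P R : L2 →L[ℂ] L2} {T : ℝ} {f g : ℝ → L2}
    {E₀ B₀ : L2} {E B : ℝ → L2} (h : IsProductWeakSolution P R T f g E₀ B₀ E B)
    (hf : IntegrableOn f (Ioo 0 T)) (hg : IntegrableOn g (Ioo 0 T))
    (hE : IntegrableOn E (Ioo 0 T)) (hB : IntegrableOn B (Ioo 0 T)) :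
    IsTimeWeakSystem curlGraph P R T ((Ioo 0 T).indicator f) ((Ioo 0 T).indicator g) E₀ B₀
      ((Ioo 0 T).indicator E) ((Ioo 0 T).indicator B) where
  integrable_E := hE.integrable_indicator measurableSet_Ioo
  integrable_B := hB.integrable_indicator measurableSet_Ioo
  integrable_f := hf.integrable_indicator measurableSet_Ioo
  integrable_g := hg.integrable_indicator measurableSet_Ioo
  E_zero _ hs := indicator_of_notMem (fun h => absurd h.1 (not_lt.2 hs)) _
  B_zero _ hs := indicator_of_notMem (fun h => absurd h.1 (not_lt.2 hs)) _
  f_zero _ hs := indicator_of_notMem (fun h => absurd h.1 (not_lt.2 hs)) _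
  g_zero _ hs := indicator_of_notMem (fun h => absurd h.1 (not_lt.2 hs)) _
  faraday := isTimeWeak_curlGraph hE hf hB h.faraday
  ampere := by
    have h1 : (fun s => -R ((Ioo 0 T).indicator B s)) = (Ioo 0 T).indicator fun s => -R (B s) := by
      ext1 s
      by_cases hs : s ∈ Ioo 0 T <;> simp [hs]
    have h2 : (fun s => P ((Ioo 0 T).indicator E s)) = (Ioo 0 T).indicator fun s => P (E s) := by
      ext1 s
      by_cases hs : s ∈ Ioo 0 T <;> simp [hs]
    rw [h1, h2]
    refine isTimeWeak_curlGraph (R.integrable_comp hB).neg hg (P.integrable_comp hE) ?_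
    simpa only [inner_neg_right, ← sub_eq_add_neg] using h.ampere

end ProductTests

/-! ### From the integral formulation to scalar products in `L²` -/

section WeakSolutions

open scoped SchwartzMap

variable {T : ℝ} {P Q : R3 → Matrix (Fin 3) (Fin 3) ℂ}

/-- The weak form of the system in terms of `L²` scalar products. -/
lemma isWeakSolution_iff (hP : IsMultiplier P) (hR : IsMultiplier fun x => (Q x)⁻¹)
    {f g : LpL2 1 T} {E₀ B₀ : L2} {E B : LpL2 ∞ T} :
    IsWeakSolution T P Q f g E₀ B₀ E B ↔ ∀ (φ : ℝ → R3 → C3) (h : IsTestField T φ),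
      (∫ t in Ioo 0 T,
          (-inner ℂ (sliceLp h.continuous_timeDeriv h.hasCompactSupport_timeDeriv t) (B t)
          + inner ℂ (sliceLp h.continuous_spaceCurl h.hasCompactSupport_spaceCurl t) (E t))
        = (∫ t in Ioo 0 T, inner ℂ (sliceLp h.smooth.continuous h.compact t) (f t))
          + inner ℂ (sliceLp h.smooth.continuous h.compact 0) B₀) ∧
      (∫ t in Ioo 0 T,
          (-inner ℂ (sliceLp h.continuous_timeDeriv h.hasCompactSupport_timeDeriv t) (hP.op (E t))
          - inner ℂ (sliceLp h.continuous_spaceCurl h.hasCompactSupport_spaceCurl t) (hR.op (B t)))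
        = (∫ t in Ioo 0 T, inner ℂ (sliceLp h.smooth.continuous h.compact t) (g t))
          + inner ℂ (sliceLp h.smooth.continuous h.compact 0) (hP.op E₀)) := by
  have hD : ∀ {φ : ℝ → R3 → C3} (h : IsTestField T φ) (t : ℝ) (u w : L2),
      ∫ x, (-inner ℂ (deriv (fun s => φ s x) t) (u x) + inner ℂ (curl (φ t) x) (w x)) =
        -inner ℂ (sliceLp h.continuous_timeDeriv h.hasCompactSupport_timeDeriv t) u
          + inner ℂ (sliceLp h.continuous_spaceCurl h.hasCompactSupport_spaceCurl t) w := by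
    intro φ h t u w
    simp only [(h.hasDerivAt_time t _).deriv, h.curl_eq_spaceCurl]
    have i1 : Integrable fun x => -inner ℂ (IsTestField.timeDeriv φ (t, x)) (u x) :=
      (integrable_inner_slice h.continuous_timeDeriv h.hasCompactSupport_timeDeriv t u).neg
    rw [integral_add i1
      (integrable_inner_slice h.continuous_spaceCurl h.hasCompactSupport_spaceCurl t w),
      integral_neg, inner_sliceLp, inner_sliceLp]
  have hA : ∀ {φ : ℝ → R3 → C3} (h : IsTestField T φ) (t : ℝ) (u w : L2),
      ∫ x, (-inner ℂ (deriv (fun s => φ s x) t) (act (P x) (u x))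
          - inner ℂ (curl (φ t) x) (act (Q x)⁻¹ (w x))) =
        -inner ℂ (sliceLp h.continuous_timeDeriv h.hasCompactSupport_timeDeriv t) (hP.op u)
          - inner ℂ (sliceLp h.continuous_spaceCurl h.hasCompactSupport_spaceCurl t)
            (hR.op w) := by
    intro φ h t u w
    rw [sub_eq_add_neg, ← inner_neg_right (y := hR.op w), ← hD h]
    refine integral_congr_ae ?_
    filter_upwards [hP.coeFn_op u, hR.coeFn_op w, Lp.coeFn_neg (hR.op w)] with x h1 h2 h3
    rw [h3, Pi.neg_apply, h1, h2, inner_neg_right, sub_eq_add_neg]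
  have hS : ∀ {φ : ℝ → R3 → C3} (h : IsTestField T φ) (t : ℝ) (u : L2),
      ∫ x, inner ℂ (φ t x) (u x) = inner ℂ (sliceLp h.smooth.continuous h.compact t) u :=
    fun h t u => (inner_sliceLp h.smooth.continuous h.compact t u).symm
  have hSP : ∀ {φ : ℝ → R3 → C3} (h : IsTestField T φ) (t : ℝ) (u : L2),
      ∫ x, inner ℂ (φ t x) (act (P x) (u x)) =
        inner ℂ (sliceLp h.smooth.continuous h.compact t) (hP.op u) := fun h t u => by
    rw [← hS h]
    exact integral_congr_ae ((hP.coeFn_op u).mono fun x hx => by simp only [hx])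
  constructor
  · intro H φ h
    have h1 := H.faraday φ h
    have h2 := H.ampere φ h
    simp only [hD h, hS h] at h1
    simp only [hA h, hS h, hSP h] at h2
    exact ⟨h1, h2⟩
  · intro H
    refine ⟨fun φ h => ?_, fun φ h => ?_⟩
    · simp only [hD h, hS h]
      exact (H φ h).1
    · simp only [hA h, hS h, hSP h]
      exact (H φ h).2

lemma IsWeakSolution.isProductWeakSolution (hP : IsMultiplier P)
    (hR : IsMultiplier fun x => (Q x)⁻¹) {f g : LpL2 1 T} {E₀ B₀ : L2} {E B : LpL2 ∞ T}
    (H : IsWeakSolution T P Q f g E₀ B₀ E B) :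
    IsProductWeakSolution hP.op hR.op T f g E₀ B₀ E B := by
  have key : ∀ {η : ℝ → ℝ} (hη : ContDiff ℝ ∞ η) (hc : HasCompactSupport η)
      (hT : tsupport η ⊆ Iio T) (ζ : 𝓢(R3, C3)) (hζ : HasCompactSupport ζ) (t : ℝ),
      sliceLp (isTestField_smul hη hc hT ζ hζ).smooth.continuous
        (isTestField_smul hη hc hT ζ hζ).compact t = η t • ζ.toLp 2 volume ∧
      sliceLp (isTestField_smul hη hc hT ζ hζ).continuous_timeDeriv
        (isTestField_smul hη hc hT ζ hζ).hasCompactSupport_timeDeriv t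
        = deriv η t • ζ.toLp 2 volume ∧
      sliceLp (isTestField_smul hη hc hT ζ hζ).continuous_spaceCurl
        (isTestField_smul hη hc hT ζ hζ).hasCompactSupport_spaceCurl t
        = η t • (schwartzCurl ζ).toLp 2 volume := by
    intro η hη hc hT ζ hζ t
    have h := isTestField_smul hη hc hT ζ hζ
    refine ⟨Lp.ext ?_, Lp.ext ?_, Lp.ext ?_⟩
    · filter_upwards [coeFn_sliceLp h.smooth.continuous h.compact t,
        Lp.coeFn_smul (η t) (ζ.toLp 2 volume), ζ.coeFn_toLp 2 volume] with x h1 h2 h3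
      refine h1.trans (Eq.trans ?_ h2.symm)
      rw [Pi.smul_apply, h3]
      rfl
    · filter_upwards [coeFn_sliceLp h.continuous_timeDeriv h.hasCompactSupport_timeDeriv t,
        Lp.coeFn_smul (deriv η t) (ζ.toLp 2 volume), ζ.coeFn_toLp 2 volume] with x h1 h2 h3
      refine h1.trans (Eq.trans ?_ h2.symm)
      rw [Pi.smul_apply, h3]
      exact (h.hasDerivAt_time t x).unique
        (((hη.differentiable (by simp)) t).hasDerivAt.smul_const (ζ x))
    · filter_upwards [coeFn_sliceLp h.continuous_spaceCurl h.hasCompactSupport_spaceCurl t,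
        Lp.coeFn_smul (η t) ((schwartzCurl ζ).toLp 2 volume),
        (schwartzCurl ζ).coeFn_toLp 2 volume] with x h1 h2 h3
      refine h1.trans (Eq.trans ?_ h2.symm)
      rw [Pi.smul_apply, h3, ← h.curl_eq_spaceCurl, curl_smul]
  rw [isWeakSolution_iff hP hR] at H
  constructor
  · intro η hη hc hT ζ hζ
    have h1 := (H _ (isTestField_smul hη hc hT ζ hζ)).1
    simp only [(key hη hc hT ζ hζ _).1, (key hη hc hT ζ hζ _).2.1, (key hη hc hT ζ hζ _).2.2] at h1
    exact h1
  · intro η hη hc hT ζ hζ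
    have h1 := (H _ (isTestField_smul hη hc hT ζ hζ)).2
    simp only [(key hη hc hT ζ hζ _).1, (key hη hc hT ζ hζ _).2.1, (key hη hc hT ζ hζ _).2.2] at h1
    exact h1

end WeakSolutions

/-! ### Existence, uniqueness and the energy identity -/

section WellPosedness

variable {T : ℝ} {P Q : R3 → Matrix (Fin 3) (Fin 3) ℂ}

lemma isMultiplier_of_elliptic (hP : IsBoundedCoeff P) (hQ : IsBoundedCoeff Q)
    (hPh : IsHermitianCoeff P) (hQh : IsHermitianCoeff Q) (hell : UniformlyElliptic P Q) :
    ∃ (hPm : IsMultiplier P) (hQm : IsMultiplier Q) (hRm : IsMultiplier fun x => (Q x)⁻¹),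
      IsCoerciveSymm hPm.op ∧ IsCoerciveSymm hRm.op ∧ (∀ u, hQm.op (hRm.op u) = u) ∧
      ∀ u, hRm.op (hQm.op u) = u := by
  obtain ⟨α, hα, hell⟩ := hell
  have hPl : ∀ᵐ x, ∀ ξ : C3, α * ‖ξ‖ ^ 2 ≤ (inner ℂ ξ (act (P x) ξ)).re :=
    hell.mono fun x hx ξ => (hx ξ).trans (min_le_left _ _)
  have hQl : ∀ᵐ x, ∀ ξ : C3, α * ‖ξ‖ ^ 2 ≤ (inner ℂ ξ (act (Q x) ξ)).re :=
    hell.mono fun x hx ξ => (hx ξ).trans (min_le_right _ _)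
  have hQm := hQ.isMultiplier
  obtain ⟨C, hC, hQC⟩ := hQm.bdd
  refine ⟨hP.isMultiplier, hQm, hQm.inv hα hQl, IsMultiplier.isCoerciveSymm_op _ hPh hα hPl,
    IsMultiplier.isCoerciveSymm_op _ ?_ (c := α / C ^ 2) (by positivity) ?_,
    fun u => IsMultiplier.op_op _ _ ?_ u, fun u => IsMultiplier.op_op _ _ ?_ u⟩
  · exact hQh.mono fun x hx => hx.inv
  · filter_upwards [hQl, hQh, hQC] with x h1 h2 h3 ξ
    exact lower_inv hα h2 h1 hC h3 ξ
  · exact hQl.mono fun x hx => Matrix.mul_nonsing_inv _ (isUnit_det_of_lower hα hx)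
  · exact hQl.mono fun x hx => Matrix.nonsing_inv_mul _ (isUnit_det_of_lower hα hx)

lemma energy_eq (hP : IsMultiplier P) (hR : IsMultiplier fun x => (Q x)⁻¹) (E B : L2) :
    energy P Q E B = 1 / 2 * quadForm hP.op hR.op E B := by
  have h1 := hP.integrable_inner_act E E
  have h2 := hR.integrable_inner_act B B
  rw [energy, quadForm, hP.inner_op_right, hR.inner_op_right, ← Complex.add_re,
    ← integral_add h1 h2]
  congr 1
  refine (integral_re (h2.add h1)).trans ?_
  exact congrArg _ (integral_congr_ae (.of_forall fun x => add_comm _ _))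

lemma power_eq (hR : IsMultiplier fun x => (Q x)⁻¹) (f g E B : L2) :
    power Q f g E B = sourcePower hR.op f g E B := by
  have h1 := hR.integrable_inner_act B f
  have h2 := L2.integrable_inner (𝕜 := ℂ) E g
  rw [power, sourcePower, hR.inner_op_right, L2.inner_def, ← Complex.add_re,
    ← integral_add h2 h1]
  refine (integral_re (h1.add h2)).trans ?_
  exact congrArg _ (integral_congr_ae (.of_forall fun x => add_comm _ _))

lemma integrableOn_coeFn {p : ℝ≥0∞} (hp : 1 ≤ p) (u : LpL2 p T) : IntegrableOn u (Ioo 0 T) :=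
  (Lp.memLp u).integrable hp

lemma IsWeakSolution.isTimeWeakSystem (hP : IsMultiplier P)
    (hR : IsMultiplier fun x => (Q x)⁻¹) {f g : LpL2 1 T} {E₀ B₀ : L2} {E B : LpL2 ∞ T}
    (H : IsWeakSolution T P Q f g E₀ B₀ E B) :
    IsTimeWeakSystem curlGraph hP.op hR.op T ((Ioo 0 T).indicator f) ((Ioo 0 T).indicator g) E₀ B₀
      ((Ioo 0 T).indicator E) ((Ioo 0 T).indicator B) :=
  (H.isProductWeakSolution hP hR).isTimeWeakSystem (integrableOn_coeFn le_rfl f)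
    (integrableOn_coeFn le_rfl g) (integrableOn_coeFn le_top E) (integrableOn_coeFn le_top B)

/-- Duality gives a solution that is square integrable in time. It agrees a.e. with its bounded
continuous representative, hence defines an element of `L^∞`, and slices of test fields are
admissible test curves. -/
lemma exists_isWeakSolution (hT : 0 < T) (hP : IsMultiplier P) (hQ : IsMultiplier Q)
    (hR : IsMultiplier fun x => (Q x)⁻¹) (hPc : IsCoerciveSymm hP.op) (hRc : IsCoerciveSymm hR.op)
    (hQR : ∀ u, hQ.op (hR.op u) = u) (hRQ : ∀ u, hR.op (hQ.op u) = u)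
    (f g : LpL2 1 T) (E₀ B₀ : L2) :
    ∃ E B : LpL2 ∞ T, IsWeakSolution T P Q f g E₀ B₀ E B := by
  obtain ⟨E, B, hEB⟩ := exists_isCurveWeakSolution hPc hRc isSymmGraph_curlGraph hQR hRQ hT
    (integrableOn_coeFn le_rfl f) (integrableOn_coeFn le_rfl g) E₀ B₀
  have hE : IntegrableOn E (Ioo 0 T) := integrableOn_coeFn one_le_two E
  have hB : IntegrableOn B (Ioo 0 T) := integrableOn_coeFn one_le_two B
  have H := hEB.isProductWeakSolution.isTimeWeakSystem (integrableOn_coeFn le_rfl f)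
    (integrableOn_coeFn le_rfl g) hE hB
  obtain ⟨C, hC⟩ := H.exists_contRep_bound hT hPc hRc isSymmGraph_curlGraph
  have hb : ∀ᵐ t ∂(volume : Measure ℝ).restrict (Ioo 0 T), ‖E t‖ + ‖B t‖ ≤ C := by
    rw [ae_restrict_iff' measurableSet_Ioo]
    filter_upwards [H.contRep_ae_eq hPc hRc isSymmGraph_curlGraph] with t h1 ht
    have ht' := Ioo_subset_Ico_self ht
    have h2 := hC t ht'
    rwa [(h1 ht').1, (h1 ht').2, indicator_of_mem ht, indicator_of_mem ht] at h2
  have hE' : MemLp E ∞ ((volume : Measure ℝ).restrict (Ioo 0 T)) :=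
    memLp_top_of_bound (Lp.aestronglyMeasurable E) C
      (hb.mono fun t ht => le_trans (le_add_of_nonneg_right (norm_nonneg _)) ht)
  have hB' : MemLp B ∞ ((volume : Measure ℝ).restrict (Ioo 0 T)) :=
    memLp_top_of_bound (Lp.aestronglyMeasurable B) C
      (hb.mono fun t ht => le_trans (le_add_of_nonneg_left (norm_nonneg _)) ht)
  refine ⟨hE'.toLp, hB'.toLp, (isWeakSolution_iff hP hR).2 fun φ h => ⟨?_, ?_⟩⟩
  · rw [← hEB.faraday _ _ _ h.isTestCurve]
    refine integral_congr_ae ?_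
    filter_upwards [hE'.coeFn_toLp, hB'.coeFn_toLp] with t h1 h2
    rw [h1, h2]
  · rw [← hEB.ampere _ _ _ h.isTestCurve]
    refine integral_congr_ae ?_
    filter_upwards [hE'.coeFn_toLp, hB'.coeFn_toLp] with t h1 h2
    rw [h1, h2]

lemma IsWeakSolution.unique (hT : 0 < T) (hP : IsMultiplier P)
    (hR : IsMultiplier fun x => (Q x)⁻¹) (hPc : IsCoerciveSymm hP.op) (hRc : IsCoerciveSymm hR.op)
    {f g : LpL2 1 T} {E₀ B₀ : L2} {E B E' B' : LpL2 ∞ T}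
    (H : IsWeakSolution T P Q f g E₀ B₀ E B) (H' : IsWeakSolution T P Q f g E₀ B₀ E' B') :
    E = E' ∧ B = B' := by
  have h := (H.isTimeWeakSystem hP hR).ae_eq (H'.isTimeWeakSystem hP hR) hT hPc hRc
    isSymmGraph_curlGraph isClosed_curlGraph eq_zero_of_zero_mem_curlGraph
  have h' : ∀ᵐ t ∂(volume : Measure ℝ).restrict (Ioo 0 T), E t = E' t ∧ B t = B' t := by
    rw [ae_restrict_iff' measurableSet_Ioo]
    filter_upwards [h] with t h1 ht
    simpa [ht] using h1 (Ioo_subset_Ico_self ht)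
  exact ⟨Lp.ext (h'.mono fun t ht => ht.1), Lp.ext (h'.mono fun t ht => ht.2)⟩

lemma IsWeakSolution.energyIdentity (hT : 0 < T) (hP : IsMultiplier P)
    (hR : IsMultiplier fun x => (Q x)⁻¹) (hPc : IsCoerciveSymm hP.op) (hRc : IsCoerciveSymm hR.op)
    {f g : LpL2 1 T} {E₀ B₀ : L2} {E B : LpL2 ∞ T}
    (H : IsWeakSolution T P Q f g E₀ B₀ E B) : EnergyIdentity T P Q f g E₀ B₀ E B := by
  have W := H.isTimeWeakSystem hP hR
  set F : ℝ → ℝ := fun r => power Q (f r) (g r) (E r) (B r)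
  obtain ⟨hE0, hB0⟩ := W.contRep_zero hT hPc hRc isSymmGraph_curlGraph isClosed_curlGraph
    eq_zero_of_zero_mem_curlGraph
  obtain ⟨M, hM⟩ := W.exists_contRep_bound hT hPc hRc isSymmGraph_curlGraph
  obtain ⟨hcE, hcB⟩ := W.continuousOn_contRep hPc hRc isSymmGraph_curlGraph
  have hrep := W.contRep_ae_eq hPc hRc isSymmGraph_curlGraph
  have hFrep : ∀ᵐ t, t ∈ Ioo 0 T → sourcePower hR.op ((Ioo 0 T).indicator f t)
      ((Ioo 0 T).indicator g t) (IsTimeWeakSystem.contRep ((Ioo 0 T).indicator E) t)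
      (IsTimeWeakSystem.contRep ((Ioo 0 T).indicator B) t) = F t := by
    filter_upwards [hrep] with t h1 ht
    obtain ⟨h2, h3⟩ := h1 (Ioo_subset_Ico_self ht)
    rw [h2, h3, indicator_of_mem ht, indicator_of_mem ht, indicator_of_mem ht, indicator_of_mem ht]
    exact (power_eq hR _ _ _ _).symm
  have hint : IntegrableOn F (Ioo 0 T) := by
    refine (W.integrableOn_sourcePower measurableSet_Ioo
      ((hcE.mono Ioo_subset_Ico_self).aestronglyMeasurable measurableSet_Ioo)
      ((hcB.mono Ioo_subset_Ico_self).aestronglyMeasurable measurableSet_Ioo)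
      fun t ht => hM t (Ioo_subset_Ico_self ht)).congr ?_
    exact (ae_restrict_iff' measurableSet_Ioo).2 hFrep
  have hii : IntervalIntegrable F volume 0 T := by
    rwa [intervalIntegrable_iff_integrableOn_Ioo_of_le hT.le]
  -- The absolutely continuous representative is the initial energy plus the integral of the power.
  -- The energy balance of the continuous representatives identifies it with the energy, and
  -- Lebesgue's differentiation theorem gives its derivative.
  refine ⟨fun t => energy P Q E₀ B₀ + ∫ r in (0 : ℝ)..t, F r, ?_, by simp, ?_, ?_⟩
  · have h1 := hii.absolutelyContinuousOnInterval_intervalIntegral left_mem_uIcc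
    have h2 : AbsolutelyContinuousOnInterval (fun _ : ℝ => energy P Q E₀ B₀) 0 T :=
      
      ((LipschitzWith.const _).lipschitzOnWith (s := uIcc 0 T)).absolutelyContinuousOnInterval
    exact h2.add h1
  · rw [ae_restrict_iff' measurableSet_Ioo]
    filter_upwards [hrep] with t h1 ht
    have ht' := Ioo_subset_Ico_self ht
    obtain ⟨h2, h3⟩ := h1 ht'
    have h4 := W.integral_sourcePower_contRep hT hPc hRc isSymmGraph_curlGraph ht'
    have h5 : ∫ r in (0 : ℝ)..t, 2 * sourcePower hR.op ((Ioo 0 T).indicator f r)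
        ((Ioo 0 T).indicator g r) (IsTimeWeakSystem.contRep ((Ioo 0 T).indicator E) r)
        (IsTimeWeakSystem.contRep ((Ioo 0 T).indicator B) r) = 2 * ∫ r in (0 : ℝ)..t, F r := by
      rw [← intervalIntegral.integral_const_mul]
      refine intervalIntegral.integral_congr_ae ?_
      filter_upwards [hFrep] with r hr hrt
      rw [uIoc_of_le ht.1.le] at hrt
      rw [hr ⟨hrt.1, hrt.2.trans_lt ht.2⟩]
    rw [hE0, hB0, h2, h3, h5, indicator_of_mem ht, indicator_of_mem ht] at h4
    rw [energy_eq hP hR, energy_eq hP hR]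
    linarith
  · rw [ae_restrict_iff' measurableSet_Ioo]
    filter_upwards [hii.ae_hasDerivAt_integral] with t h1 ht
    rw [uIcc_of_le hT.le] at h1
    exact (h1 (Ioo_subset_Icc_self ht) 0 (left_mem_Icc.2 hT.le)).const_add _

end WellPosedness

end Maxwell

end

theorem theorem3p1 (T : ℝ) (hT : 0 < T)
    (P Q : Maxwell.R3 → Matrix (Fin 3) (Fin 3) ℂ)
    (hP : Maxwell.IsBoundedCoeff P) (hQ : Maxwell.IsBoundedCoeff Q)
    (hPh : Maxwell.IsHermitianCoeff P) (hQh : Maxwell.IsHermitianCoeff Q)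
    (hell : Maxwell.UniformlyElliptic P Q)
    (f g : Maxwell.LpL2 1 T) (E₀ B₀ : Maxwell.L2) :
    (∃! u : Maxwell.LpL2 ∞ T × Maxwell.LpL2 ∞ T,
      Maxwell.IsWeakSolution T P Q f g E₀ B₀ u.1 u.2) ∧
    ∀ E B : Maxwell.LpL2 ∞ T, Maxwell.IsWeakSolution T P Q f g E₀ B₀ E B →
      Maxwell.EnergyIdentity T P Q f g E₀ B₀ E B := by
  obtain ⟨hPm, hQm, hRm, hPc, hRc, hQR, hRQ⟩ :=
    Maxwell.isMultiplier_of_elliptic hP hQ hPh hQh hell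
  refine ⟨?_, fun E B H => H.energyIdentity hT hPm hRm hPc hRc⟩
  obtain ⟨E, B, H⟩ := Maxwell.exists_isWeakSolution hT hPm hQm hRm hPc hRc hQR hRQ f g E₀ B₀
  refine ⟨(E, B), H, fun u hu => ?_⟩
  obtain ⟨h1, h2⟩ := hu.unique hT hPm hRm hPc hRc H
  exact Prod.ext h1 h2
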